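/- Let \begin{align*} f={}&40x_0^4+8x_0^2x_1^2+32x_0^2x_1x_2+64x_0^2x_1x_3+16x_0^2x_2^2+16x_0^2x_2x_3+32x_0^2x_3^2\\ &+2x_1^4+8x_1^2x_2^2+8x_1^2x_2x_3+16x_1x_2x_3^2+8x_2^2x_3^2+8x_3^4,\\ g={}&(y_0^2-y_3^2)^2+(y_1^2-y_3^2)^2+(y_2^2-y_3^2)^2\\ &+(-y_0^2-y_0y_1-y_0y_2+y_0y_3-y_1y_2+y_1y_3+y_2y_3)^2, \end{align*} and let $h=f+g+(x_2^2-y_2^2)^2\in\mathbb{Q}[x_0,x_1,x_2,x_3,y_0,y_1,y_2,y_3]$. Then the projective hypersurface $\{h=0\}\subset\mathbb{P}^7$ is nonsingular, that is, $$\sqrt{\left\langle h,\frac{\partial h}{\partial x_0},\dots,\frac{\partial h}{\partial x_3},\frac{\partial h}{\partial y_0},\dots,\frac{\partial h}{\partial y_3}\right\rangle}=\langle x_0,x_1,x_2,x_3,y_0,y_1,y_2,y_3\rangle$$ in $\mathbb{Q}[x_0,\dots,x_3,y_0,\dots,y_3]$, and for every field $K\supseteq\mathbb{Q}$ there is no point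 of $\mathbb{P}^7(K)$ at which $h$ and its eight partial derivatives all vanish. Moreover, $h$ is homogeneous of degree $4$, it is a sum of squares of polynomials with real coefficients, and it is not a sum of squares of polynomials with rational coefficients. Hence there is a form with rational coefficients that is a sum of squares over $\mathbb{R}$ but not over $\mathbb{Q}$ and defines a nonsingular projective hypersurface, which answers a question of Scheiderer affirmatively. -/

import Mathlib

open MvPolynomial
open scoped LinearAlgebra.Projectivization

namespace NonsingularSos

/-- The eight variables: `Sum.inl i` is `x_i` and `Sum.inr i` is `y_i`, for `i = 0, 1, 2, 3`. -/
abbrev Var : Type := Fin 4 ⊕ Fin 4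

/-- The variable `x_i`. -/
noncomputable def x (i : Fin 4) : MvPolynomial Var ℚ := X (Sum.inl i)

/-- The variable `y_i`. -/
noncomputable def y (i : Fin 4) : MvPolynomial Var ℚ := X (Sum.inr i)

/-- The quartic form `f` in the variables `x_0, …, x_3`. -/
noncomputable def f : MvPolynomial Var ℚ :=
  40 * x 0 ^ 4 + 8 * x 0 ^ 2 * x 1 ^ 2 + 32 * x 0 ^ 2 * x 1 * x 2 + 64 * x 0 ^ 2 * x 1 * x 3
    + 16 * x 0 ^ 2 * x 2 ^ 2 + 16 * x 0 ^ 2 * x 2 * x 3 + 32 * x 0 ^ 2 * x 3 ^ 2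
    + 2 * x 1 ^ 4 + 8 * x 1 ^ 2 * x 2 ^ 2 + 8 * x 1 ^ 2 * x 2 * x 3 + 16 * x 1 * x 2 * x 3 ^ 2
    + 8 * x 2 ^ 2 * x 3 ^ 2 + 8 * x 3 ^ 4

noncomputable def q₁ : MvPolynomial Var ℚ := y 0 ^ 2 - y 3 ^ 2

noncomputable def q₂ : MvPolynomial Var ℚ := y 1 ^ 2 - y 3 ^ 2

noncomputable def q₃ : MvPolynomial Var ℚ := y 2 ^ 2 - y 3 ^ 2

noncomputable def q₄ : MvPolynomial Var ℚ :=
  -y 0 ^ 2 - y 0 * y 1 - y 0 * y 2 + y 0 * y 3 - y 1 * y 2 + y 1 * y 3 + y 2 * y 3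

/-- The quartic form `g` in the variables `y_0, …, y_3`. -/
noncomputable def g : MvPolynomial Var ℚ := q₁ ^ 2 + q₂ ^ 2 + q₃ ^ 2 + q₄ ^ 2

noncomputable def r : MvPolynomial Var ℚ := x 2 ^ 2 - y 2 ^ 2

/-- The quartic form `h = f + g + r²` in eight variables. -/
noncomputable def h : MvPolynomial Var ℚ := f + g + r ^ 2

/-- `F ∈ ℚ[σ]` is a sum of squares of polynomials with coefficients in `K` (`F` is `K`-sos). -/
def IsSosOver (K : Type*) [CommRing K] [Algebra ℚ K] {σ : Type*} (F : MvPolynomial σ ℚ) : Prop :=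
  IsSumSq (map (algebraMap ℚ K) F)

/-- The ideal generated by `F` and all its partial derivatives. -/
noncomputable def singularIdeal {k σ : Type*} [CommRing k] (F : MvPolynomial σ k) :
    Ideal (MvPolynomial σ k) :=
  Ideal.span (insert F (Set.range fun i : σ => pderiv i F))

/-- The ideal generated by all the variables. -/
noncomputable def irrelevantIdeal (k σ : Type*) [CommRing k] : Ideal (MvPolynomial σ k) :=
  Ideal.span (Set.range fun i : σ => (X i : MvPolynomial σ k))

/-- The `K`-point `P` of projective space is a singular point of the hypersurface `{F = 0}`, for a
form `F` with coefficients in `k ⊆ K`: `F` and all its partial derivatives vanish at `P`. As these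
are forms, the choice of homogeneous coordinates `P.rep` of `P` does not matter. -/
def IsSingularPoint {k K σ : Type*} [Field k] [Field K] [Algebra k K] (F : MvPolynomial σ k)
    (P : ℙ K (σ → K)) : Prop :=
  aeval P.rep F = 0 ∧ ∀ i : σ, aeval P.rep (pderiv i F) = 0

end NonsingularSos

/-! Nonsingularity is proved by reduction modulo the prime 3449. If `h` had a singular point over a
field `K` of characteristic zero, choose a valuation ring of `K` with 3449 in its maximal ideal and
scale the coordinates so that all are integral and one equals 1. The residue point is then a nonzero
common zero of the partial derivatives in characteristic 3449. There the system nearly decouples,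
because `f` and `g` share no variables and are linked only through `r = x₂² - y₂²`. If `x₂ ≠ 0` and
`∂f/∂x₂ = 8 v x₂³`, the `x₂`-equation gives `y₂² = (1 + 2v) x₂²`, and the `y`-equations become those
of `g` with `∂g/∂y₂ = 2 t y₂³`, where `t = -4v / (1 + 2v)`. Eliminating the other `x`-variables
leaves finitely many `v`, and modulo 3449 all of them lie in the prime field. For each resulting `t`
an explicit ideal membership (`GCrit.pow_nine_eq_zero_of_*`) forces `y₂ = 0`, which is absurd. The
case `x₂ = 0` corresponds to `t = -2`. The radical statement follows by the Nullstellensatz.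

Over `ℝ`, with `α³ = 2`, one has `f = 16 x₀² (x₂ + α x₁ + α² x₃)² + 8 s² + 2 t²` for quadratic forms
`s`, `t` that restrict to `x₁x₂ + x₃²` and `x₁² + 2x₂x₃` on `x₀ = 0`.

Over `ℚ`, suppose `h` is a sum of squares of polynomials. Comparing lowest terms, one may replace
these by their quadratic parts, each of which splits into an `x`-part `Pᵢ`, a mixed part and a
`y`-part `Qᵢ`. Three inputs now combine. (a) The eight sign vectors are the intersection of the
three quadrics `q₁ = q₂ = q₃ = 0`, so the values of a quadratic form at them satisfy one linear
relation (Cayley–Bacharach). The form `g` equals 1 at seven of them and 49 at the eighth, so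
Cauchy–Schwarz holds with equality. At a real zero `u` of `f` with `u₂ = 1` this determines `Pᵢ(u)`
from `Qᵢ` alone, independently of `u`. (b) Hence `Pᵢ` agrees at the zeros `(0, 0, 1, 0)` and `(0,
-α², 1, -α)` of `f`. As its coefficients are rational and `1, α, α²` are independent over `ℚ`, the
restriction of `Pᵢ` to `x₀ = 0` is a combination of `x₂²`, `x₁x₂ + x₃²` and `x₁² + 2x₂x₃`. (c) The
coefficient of `x₀²` in `h`, minus the contribution of the products of `x₀²` with these
restrictions, is a sum of squares of linear forms. The coefficient of `x₂²` lost in this subtraction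
has a favourable sign, again by (a). What remains is a positive semidefinite rational quadratic form
in the family of `not_forall_nonneg`. Its only real semidefinite member is `16 (x₂ + α x₁ + α²
x₃)²`, which is not rational. -/

namespace NonsingularSos

/-! ### The critical equations -/

/-- `(y₀, y₁, y₂, y₃)` is a common zero of `∂g/∂y₀`, `∂g/∂y₁`, `∂g/∂y₃` and of
`∂g/∂y₂ - 2 t y₂³` (each divided by `2`). -/
structure GCrit {k : Type*} [CommRing k] (t y₀ y₁ y₂ y₃ : k) : Prop where
  eq₀ : 4 * y₀ ^ 3 + 3 * y₀ ^ 2 * y₁ + 3 * y₀ ^ 2 * y₂ - 3 * y₀ ^ 2 * y₃ + y₀ * y₁ ^ 2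
    + 4 * y₀ * y₁ * y₂ - 4 * y₀ * y₁ * y₃ + y₀ * y₂ ^ 2 - 4 * y₀ * y₂ * y₃ - y₀ * y₃ ^ 2
    + y₁ ^ 2 * y₂ - y₁ ^ 2 * y₃ + y₁ * y₂ ^ 2 - 3 * y₁ * y₂ * y₃ + y₁ * y₃ ^ 2 - y₂ ^ 2 * y₃
    + y₂ * y₃ ^ 2 = 0
  eq₁ : y₀ ^ 3 + y₀ ^ 2 * y₁ + 2 * y₀ ^ 2 * y₂ - 2 * y₀ ^ 2 * y₃ + 2 * y₀ * y₁ * y₂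
    - 2 * y₀ * y₁ * y₃ + y₀ * y₂ ^ 2 - 3 * y₀ * y₂ * y₃ + y₀ * y₃ ^ 2 + 2 * y₁ ^ 3 + y₁ * y₂ ^ 2
    - 2 * y₁ * y₂ * y₃ - y₁ * y₃ ^ 2 - y₂ ^ 2 * y₃ + y₂ * y₃ ^ 2 = 0
  eq₂ : y₀ ^ 3 + 2 * y₀ ^ 2 * y₁ + y₀ ^ 2 * y₂ - 2 * y₀ ^ 2 * y₃ + y₀ * y₁ ^ 2 + 2 * y₀ * y₁ * y₂
    - 3 * y₀ * y₁ * y₃ - 2 * y₀ * y₂ * y₃ + y₀ * y₃ ^ 2 + y₁ ^ 2 * y₂ - y₁ ^ 2 * y₃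
    - 2 * y₁ * y₂ * y₃ + y₁ * y₃ ^ 2 + 2 * y₂ ^ 3 - y₂ * y₃ ^ 2 = t * y₂ ^ 3
  eq₃ : -y₀ ^ 3 - 2 * y₀ ^ 2 * y₁ - 2 * y₀ ^ 2 * y₂ - y₀ ^ 2 * y₃ - y₀ * y₁ ^ 2 - 3 * y₀ * y₁ * y₂
    + 2 * y₀ * y₁ * y₃ - y₀ * y₂ ^ 2 + 2 * y₀ * y₂ * y₃ - y₁ ^ 2 * y₂ - y₁ ^ 2 * y₃ - y₁ * y₂ ^ 2
    + 2 * y₁ * y₂ * y₃ - y₂ ^ 2 * y₃ + 6 * y₃ ^ 3 = 0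

/-- `(x, y)` is a common zero of the partial derivatives of `h`, each divided by a power of `2`. -/
structure HCrit {k : Type*} [CommRing k] (x₀ x₁ x₂ x₃ y₀ y₁ y₂ y₃ : k) : Prop where
  eqx₀ : 10 * x₀ ^ 3 + x₀ * x₁ ^ 2 + 4 * x₀ * x₁ * x₂ + 8 * x₀ * x₁ * x₃ + 2 * x₀ * x₂ ^ 2
    + 2 * x₀ * x₂ * x₃ + 4 * x₀ * x₃ ^ 2 = 0
  eqx₁ : 2 * x₀ ^ 2 * x₁ + 4 * x₀ ^ 2 * x₂ + 8 * x₀ ^ 2 * x₃ + x₁ ^ 3 + 2 * x₁ * x₂ ^ 2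
    + 2 * x₁ * x₂ * x₃ + 2 * x₂ * x₃ ^ 2 = 0
  eqx₂ : 2 * (4 * x₀ ^ 2 * x₁ + 4 * x₀ ^ 2 * x₂ + 2 * x₀ ^ 2 * x₃ + 2 * x₁ ^ 2 * x₂ + x₁ ^ 2 * x₃
    + 2 * x₁ * x₃ ^ 2 + 2 * x₂ * x₃ ^ 2) = -x₂ * (x₂ ^ 2 - y₂ ^ 2)
  eqx₃ : 8 * x₀ ^ 2 * x₁ + 2 * x₀ ^ 2 * x₂ + 8 * x₀ ^ 2 * x₃ + x₁ ^ 2 * x₂ + 4 * x₁ * x₂ * x₃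
    + 2 * x₂ ^ 2 * x₃ + 4 * x₃ ^ 3 = 0
  eqy₀ : 4 * y₀ ^ 3 + 3 * y₀ ^ 2 * y₁ + 3 * y₀ ^ 2 * y₂ - 3 * y₀ ^ 2 * y₃ + y₀ * y₁ ^ 2
    + 4 * y₀ * y₁ * y₂ - 4 * y₀ * y₁ * y₃ + y₀ * y₂ ^ 2 - 4 * y₀ * y₂ * y₃ - y₀ * y₃ ^ 2
    + y₁ ^ 2 * y₂ - y₁ ^ 2 * y₃ + y₁ * y₂ ^ 2 - 3 * y₁ * y₂ * y₃ + y₁ * y₃ ^ 2 - y₂ ^ 2 * y₃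
    + y₂ * y₃ ^ 2 = 0
  eqy₁ : y₀ ^ 3 + y₀ ^ 2 * y₁ + 2 * y₀ ^ 2 * y₂ - 2 * y₀ ^ 2 * y₃ + 2 * y₀ * y₁ * y₂
    - 2 * y₀ * y₁ * y₃ + y₀ * y₂ ^ 2 - 3 * y₀ * y₂ * y₃ + y₀ * y₃ ^ 2 + 2 * y₁ ^ 3 + y₁ * y₂ ^ 2
    - 2 * y₁ * y₂ * y₃ - y₁ * y₃ ^ 2 - y₂ ^ 2 * y₃ + y₂ * y₃ ^ 2 = 0
  eqy₂ : y₀ ^ 3 + 2 * y₀ ^ 2 * y₁ + y₀ ^ 2 * y₂ - 2 * y₀ ^ 2 * y₃ + y₀ * y₁ ^ 2 + 2 * y₀ * y₁ * y₂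
    - 3 * y₀ * y₁ * y₃ - 2 * y₀ * y₂ * y₃ + y₀ * y₃ ^ 2 + y₁ ^ 2 * y₂ - y₁ ^ 2 * y₃
    - 2 * y₁ * y₂ * y₃ + y₁ * y₃ ^ 2 + 2 * y₂ ^ 3 - y₂ * y₃ ^ 2 = 2 * y₂ * (x₂ ^ 2 - y₂ ^ 2)
  eqy₃ : -y₀ ^ 3 - 2 * y₀ ^ 2 * y₁ - 2 * y₀ ^ 2 * y₂ - y₀ ^ 2 * y₃ - y₀ * y₁ ^ 2
    - 3 * y₀ * y₁ * y₂ + 2 * y₀ * y₁ * y₃ - y₀ * y₂ ^ 2 + 2 * y₀ * y₂ * y₃ - y₁ ^ 2 * y₂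
    - y₁ ^ 2 * y₃ - y₁ * y₂ ^ 2 + 2 * y₁ * y₂ * y₃ - y₂ ^ 2 * y₃ + 6 * y₃ ^ 3 = 0

/-! ### Membership certificates modulo 3449 for the `y`-equations -/

/-- Four cubics in four variables with only the trivial common zero generate every form of degree `4
· (3 - 1) + 1 = 9` (Macaulay), so `c ^ 9` is a combination of the equations with cofactors of degree
6. The cofactors here are integer lifts of such a combination over the field with 3449 elements, and
the final multiple of `hp` absorbs the discrepancy, which leaves an identity over `ℤ`. The value `t
= -2` is the one that occurs for `x₂ = 0`. -/
theorem GCrit.pow_nine_eq_zero_of_neg_2 {k : Type*} [CommRing k] (hp : (3449 : k) = 0) {a b c d : k}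
    (h : GCrit (-2) a b c d) : c ^ 9 = 0 := by
  linear_combination (596 * a ^ 6 + 204 * a ^ 5 * b - 619 * a ^ 5 * c - 403 * a ^ 5 * d
    - 1259 * a ^ 4 * b ^ 2 + 5 * a ^ 4 * b * c - 1475 * a ^ 4 * b * d + 1040 * a ^ 4 * c ^ 2
    - 1706 * a ^ 4 * c * d - 535 * a ^ 4 * d ^ 2 + 161 * a ^ 3 * b ^ 3 + 647 * a ^ 3 * b ^ 2 * c
    - 1650 * a ^ 3 * b ^ 2 * d - 346 * a ^ 3 * b * c ^ 2 + 175 * a ^ 3 * b * c * d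
    - 899 * a ^ 3 * b * d ^ 2 - 320 * a ^ 3 * c ^ 3 + 1663 * a ^ 3 * c ^ 2 * d
    - 537 * a ^ 3 * c * d ^ 2 - 1394 * a ^ 3 * d ^ 3 + 494 * a ^ 2 * b ^ 4
    + 417 * a ^ 2 * b ^ 3 * c + 556 * a ^ 2 * b ^ 3 * d - 1717 * a ^ 2 * b ^ 2 * c ^ 2
    - 1087 * a ^ 2 * b ^ 2 * c * d + 1114 * a ^ 2 * b ^ 2 * d ^ 2 - 387 * a ^ 2 * b * c ^ 3
    + 1071 * a ^ 2 * b * c ^ 2 * d - 1056 * a ^ 2 * b * c * d ^ 2 + 1694 * a ^ 2 * b * d ^ 3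
    - 900 * a ^ 2 * c ^ 4 - 287 * a ^ 2 * c ^ 3 * d + 1622 * a ^ 2 * c ^ 2 * d ^ 2
    - 850 * a ^ 2 * c * d ^ 3 + 290 * a ^ 2 * d ^ 4 - 92 * a * b ^ 5 + 1724 * a * b ^ 4 * c
    + 1443 * a * b ^ 4 * d - 413 * a * b ^ 3 * c ^ 2 + 981 * a * b ^ 3 * c * d
    + 397 * a * b ^ 3 * d ^ 2 + 1601 * a * b ^ 2 * c ^ 3 + 325 * a * b ^ 2 * c ^ 2 * d
    - 916 * a * b ^ 2 * c * d ^ 2 + 1273 * a * b ^ 2 * d ^ 3 + 1151 * a * b * c ^ 4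
    + 394 * a * b * c ^ 3 * d + 1020 * a * b * c ^ 2 * d ^ 2 + 772 * a * b * c * d ^ 3
    - 305 * a * b * d ^ 4 - 834 * a * c ^ 5 + 488 * a * c ^ 4 * d + 307 * a * c ^ 3 * d ^ 2
    + 709 * a * c ^ 2 * d ^ 3 + 1371 * a * c * d ^ 4 + 201 * a * d ^ 5 - 219 * b ^ 6
    + 361 * b ^ 5 * c - 947 * b ^ 5 * d + 381 * b ^ 4 * c ^ 2 - 523 * b ^ 4 * c * d
    + 1155 * b ^ 4 * d ^ 2 + 1177 * b ^ 3 * c ^ 3 + 971 * b ^ 3 * c ^ 2 * d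
    + 603 * b ^ 3 * c * d ^ 2 - 201 * b ^ 3 * d ^ 3 - 455 * b ^ 2 * c ^ 4
    + 1127 * b ^ 2 * c ^ 3 * d - 1289 * b ^ 2 * c ^ 2 * d ^ 2 + 536 * b ^ 2 * c * d ^ 3
    + 561 * b * c ^ 5 - 549 * b * c ^ 4 * d - 67 * b * c ^ 3 * d ^ 2 - 1691 * b * c ^ 2 * d ^ 3
    + 268 * b * c * d ^ 4 + 67 * b * d ^ 5 + 546 * c ^ 6 + 55 * c ^ 5 * d + 1624 * c ^ 4 * d ^ 2
    + 1624 * c ^ 3 * d ^ 3 + 1624 * c ^ 2 * d ^ 4 - 1691 * c * d ^ 5) * h.eq₀ + (989 * a ^ 6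
    + 1580 * a ^ 5 * b - 1568 * a ^ 5 * c - 555 * a ^ 5 * d + 643 * a ^ 4 * b ^ 2
    + 179 * a ^ 4 * b * c - 668 * a ^ 4 * b * d + 935 * a ^ 4 * c ^ 2 - 968 * a ^ 4 * c * d
    - 1172 * a ^ 4 * d ^ 2 + 1547 * a ^ 3 * b ^ 3 - 1052 * a ^ 3 * b ^ 2 * c
    + 639 * a ^ 3 * b ^ 2 * d - 97 * a ^ 3 * b * c ^ 2 + 1698 * a ^ 3 * b * c * d
    + 11 * a ^ 3 * b * d ^ 2 + 1350 * a ^ 3 * c ^ 3 + 291 * a ^ 3 * c ^ 2 * d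
    + 1309 * a ^ 3 * d ^ 3 - 1326 * a ^ 2 * b ^ 4 - 1656 * a ^ 2 * b ^ 3 * c
    + 823 * a ^ 2 * b ^ 3 * d - 673 * a ^ 2 * b ^ 2 * c ^ 2 - 1485 * a ^ 2 * b ^ 2 * c * d
    + 524 * a ^ 2 * b ^ 2 * d ^ 2 + 1237 * a ^ 2 * b * c ^ 3 - 1485 * a ^ 2 * b * c ^ 2 * d
    + 216 * a ^ 2 * b * d ^ 3 + 401 * a ^ 2 * c ^ 4 - 560 * a ^ 2 * c ^ 3 * d
    + 1315 * a ^ 2 * d ^ 4 + 1289 * a * b ^ 5 - 48 * a * b ^ 4 * c - 1446 * a * b ^ 4 * d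
    + 1174 * a * b ^ 3 * c ^ 2 - 914 * a * b ^ 3 * c * d - 109 * a * b ^ 3 * d ^ 2
    - 763 * a * b ^ 2 * c ^ 3 + 1238 * a * b ^ 2 * c ^ 2 * d - 1674 * a * b ^ 2 * d ^ 3
    - 529 * a * b * c ^ 4 - 1351 * a * b * c ^ 3 * d - 253 * a * b * d ^ 4 + 1703 * a * c ^ 5
    - 1427 * a * c ^ 4 * d - 1693 * a * d ^ 5 + 1289 * b ^ 5 * c - 1289 * b ^ 5 * d
    + 1278 * b ^ 4 * c ^ 2 - 474 * b ^ 4 * c * d + 1356 * b ^ 4 * d ^ 2 - 1471 * b ^ 3 * c ^ 3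
    + 593 * b ^ 3 * c ^ 2 * d - 134 * b ^ 3 * d ^ 3 + 225 * b ^ 2 * c ^ 4
    + 1418 * b ^ 2 * c ^ 3 * d + 463 * b * c ^ 5 - 1654 * b * c ^ 4 * d - 1691 * b * d ^ 5
    + 470 * c ^ 6 - 1626 * c ^ 5 * d - 1691 * d ^ 6) * h.eq₁ + (-184 * a ^ 6 + 253 * a ^ 5 * b
    - 396 * a ^ 5 * c + 124 * a ^ 5 * d - 1040 * a ^ 4 * b ^ 2 + 1413 * a ^ 4 * b * c
    - 1317 * a ^ 4 * b * d + 1222 * a ^ 4 * c ^ 2 + 396 * a ^ 4 * c * d + 812 * a ^ 4 * d ^ 2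
    + 1411 * a ^ 3 * b ^ 3 - 711 * a ^ 3 * b ^ 2 * c + 410 * a ^ 3 * b ^ 2 * d
    + 676 * a ^ 3 * b * c ^ 2 + 1275 * a ^ 3 * b * c * d - 1348 * a ^ 3 * c ^ 3
    - 263 * a ^ 3 * c ^ 2 * d + 1464 * a ^ 3 * d ^ 3 - 1681 * a ^ 2 * b ^ 4
    - 722 * a ^ 2 * b ^ 3 * c - 814 * a ^ 2 * b ^ 3 * d + 703 * a ^ 2 * b ^ 2 * c ^ 2
    - 223 * a ^ 2 * b ^ 2 * c * d - 606 * a ^ 2 * b * c ^ 3 + 216 * a ^ 2 * c ^ 4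
    + 1348 * a ^ 2 * c ^ 3 * d - 175 * a ^ 2 * d ^ 4 - 195 * a * b ^ 5 - 794 * a * b ^ 4 * c
    - 1099 * a * b ^ 4 * d + 1656 * a * b ^ 3 * c ^ 2 + 1312 * a * b ^ 2 * c ^ 3
    + 39 * a * b * c ^ 4 - 254 * a * c ^ 5 - 647 * a * c ^ 4 * d - 1693 * a * d ^ 5 + 1090 * b ^ 6
    + 751 * b ^ 5 * c + 1081 * b ^ 5 * d + 608 * b ^ 3 * c ^ 3 - 177 * b ^ 2 * c ^ 4
    - 254 * b * c ^ 5 - 862 * c ^ 6 + 254 * c ^ 5 * d - 1691 * d ^ 6) * h.eq₂ + (-260 * a ^ 6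
    - 1320 * a ^ 5 * b - 338 * a ^ 5 * c + 1717 * a ^ 5 * d + 577 * a ^ 4 * b ^ 2
    - 837 * a ^ 4 * b * c + 571 * a ^ 4 * b * d + 1391 * a ^ 4 * c * d + 1512 * a ^ 4 * d ^ 2
    + 989 * a ^ 3 * b ^ 3 - 1076 * a ^ 3 * b ^ 2 * c + 745 * a ^ 3 * b ^ 2 * d
    - 1634 * a ^ 3 * b * c ^ 2 - 1514 * a ^ 3 * b * c * d - 1100 * a ^ 3 * c ^ 3
    - 129 * a ^ 3 * d ^ 3 - 1322 * a ^ 2 * b ^ 4 + 703 * a ^ 2 * b ^ 3 * c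
    + 1176 * a ^ 2 * b ^ 3 * d + 238 * a ^ 2 * b ^ 2 * c ^ 2 - 1447 * a ^ 2 * b ^ 2 * c * d
    + 1195 * a ^ 2 * d ^ 4 - 1416 * a * b ^ 5 + 1230 * a * b ^ 4 * c - 586 * a * d ^ 5) * h.eq₃
    - (a ^ 9 + 2 * a ^ 8 * b - 2 * a ^ 8 * d + 3 * a ^ 7 * b * c - 6 * a ^ 7 * b * d
    + a ^ 7 * c ^ 2 - 4 * a ^ 7 * c * d - a ^ 7 * d ^ 2 + 3 * a ^ 6 * b ^ 2 * c
    - 6 * a ^ 6 * b ^ 2 * d + 3 * a ^ 6 * b * c ^ 2 - 8 * a ^ 6 * b * c * d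
    + 2 * a ^ 6 * b * d ^ 2 + a ^ 6 * c ^ 3 - 2 * a ^ 6 * c ^ 2 * d + a ^ 6 * c * d ^ 2
    - a ^ 6 * d ^ 3 + a ^ 5 * b ^ 4 - a ^ 5 * b ^ 3 * c - 2 * a ^ 5 * b ^ 3 * d
    + 2 * a ^ 5 * b ^ 2 * c ^ 2 - 6 * a ^ 5 * b ^ 2 * c * d + 4 * a ^ 5 * b ^ 2 * d ^ 2
    + 3 * a ^ 5 * b * c ^ 3 - 3 * a ^ 5 * b * c ^ 2 * d + 3 * a ^ 5 * b * c * d ^ 2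
    + 2 * a ^ 5 * b * d ^ 3 - a ^ 5 * c ^ 3 * d + 2 * a ^ 5 * c ^ 2 * d ^ 2 + a ^ 5 * c * d ^ 3
    + 3 * a ^ 5 * d ^ 4 + a ^ 4 * b ^ 5 + a ^ 4 * b ^ 4 * c - 2 * a ^ 4 * b ^ 3 * c * d
    + 2 * a ^ 4 * b ^ 3 * d ^ 2 + a ^ 4 * b ^ 2 * c ^ 3 + a ^ 4 * b ^ 2 * c * d ^ 2
    + 3 * a ^ 4 * b ^ 2 * d ^ 3 + 4 * a ^ 4 * b * c ^ 4 - 2 * a ^ 4 * b * c ^ 3 * d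
    - 2 * a ^ 4 * b * c ^ 2 * d ^ 2 + 5 * a ^ 4 * b * c * d ^ 3 - a ^ 4 * b * d ^ 4
    + a ^ 4 * c ^ 5 + a ^ 4 * c ^ 3 * d ^ 2 - 2 * a ^ 4 * c ^ 2 * d ^ 3 + 4 * a ^ 4 * c * d ^ 4
    + 2 * a ^ 4 * d ^ 5 + 2 * a ^ 3 * b ^ 6 + 2 * a ^ 3 * b ^ 5 * c - a ^ 3 * b ^ 5 * d
    + a ^ 3 * b ^ 4 * c ^ 2 + 2 * a ^ 3 * b ^ 4 * d ^ 2 + 4 * a ^ 3 * b ^ 3 * c ^ 3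
    + 4 * a ^ 3 * b ^ 3 * c ^ 2 * d + 3 * a ^ 3 * b ^ 3 * c * d ^ 2 + a ^ 3 * b ^ 3 * d ^ 3
    + 6 * a ^ 3 * b ^ 2 * c ^ 3 * d - 4 * a ^ 3 * b ^ 2 * c ^ 2 * d ^ 2
    + 2 * a ^ 3 * b ^ 2 * c * d ^ 3 - 2 * a ^ 3 * b ^ 2 * d ^ 4 + 2 * a ^ 3 * b * c ^ 5
    - 5 * a ^ 3 * b * c ^ 2 * d ^ 3 - 4 * a ^ 3 * b * c * d ^ 4 - 2 * a ^ 3 * b * d ^ 5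
    - a ^ 3 * c ^ 6 - a ^ 3 * c ^ 5 * d + 4 * a ^ 3 * c ^ 4 * d ^ 2 + a ^ 3 * c ^ 3 * d ^ 3
    + 3 * a ^ 3 * c ^ 2 * d ^ 4 - 5 * a ^ 3 * c * d ^ 5 + a ^ 3 * d ^ 6 + 2 * a ^ 2 * b ^ 6 * c
    - a ^ 2 * b ^ 6 * d + 3 * a ^ 2 * b ^ 5 * c ^ 2 - 6 * a ^ 2 * b ^ 5 * c * d
    + 3 * a ^ 2 * b ^ 5 * d ^ 2 + 2 * a ^ 2 * b ^ 4 * c ^ 3 - a ^ 2 * b ^ 4 * c ^ 2 * d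
    + 4 * a ^ 2 * b ^ 4 * c * d ^ 2 - 6 * a ^ 2 * b ^ 4 * d ^ 3 + a ^ 2 * b ^ 3 * c ^ 4
    - 3 * a ^ 2 * b ^ 3 * c ^ 2 * d ^ 2 + 2 * a ^ 2 * b ^ 3 * c * d ^ 3
    + 2 * a ^ 2 * b ^ 3 * d ^ 4 + 2 * a ^ 2 * b ^ 2 * c ^ 5 - a ^ 2 * b ^ 2 * c ^ 4 * d
    - 4 * a ^ 2 * b ^ 2 * c ^ 3 * d ^ 2 + 2 * a ^ 2 * b ^ 2 * c ^ 2 * d ^ 3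
    - 5 * a ^ 2 * b ^ 2 * c * d ^ 4 - a ^ 2 * b ^ 2 * d ^ 5 - 4 * a ^ 2 * b * c ^ 5 * d
    + 5 * a ^ 2 * b * c ^ 4 * d ^ 2 - 2 * a ^ 2 * b * c ^ 3 * d ^ 3
    + 3 * a ^ 2 * b * c ^ 2 * d ^ 4 - 5 * a ^ 2 * b * c * d ^ 5 + a ^ 2 * b * d ^ 6
    + a ^ 2 * c ^ 7 + 4 * a ^ 2 * c ^ 5 * d ^ 2 - 2 * a ^ 2 * c ^ 4 * d ^ 3
    - 6 * a ^ 2 * c ^ 2 * d ^ 5 + 2 * a ^ 2 * c * d ^ 6 + 3 * a ^ 2 * d ^ 7 + a * b ^ 8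
    + a * b ^ 7 * c - a * b ^ 7 * d + 3 * a * b ^ 6 * c ^ 2 - 6 * a * b ^ 6 * c * d
    + a * b ^ 6 * d ^ 2 + 2 * a * b ^ 5 * c ^ 3 - 4 * a * b ^ 5 * c ^ 2 * d
    + 6 * a * b ^ 5 * c * d ^ 2 - 5 * a * b ^ 5 * d ^ 3 + a * b ^ 4 * c ^ 4
    - 6 * a * b ^ 4 * c ^ 3 * d + a * b ^ 4 * c ^ 2 * d ^ 2 + 3 * a * b ^ 3 * c ^ 5
    - 6 * a * b ^ 3 * c ^ 3 * d ^ 2 + a * b ^ 3 * c ^ 2 * d ^ 3 - a * b ^ 3 * c * d ^ 4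
    + 2 * a * b ^ 2 * c ^ 6 - 2 * a * b ^ 2 * c ^ 5 * d + a * b ^ 2 * c ^ 3 * d ^ 3
    + 2 * a * b ^ 2 * c ^ 2 * d ^ 4 - 2 * a * b ^ 2 * c * d ^ 5 + a * b ^ 2 * d ^ 6
    + a * b * c ^ 7 - 3 * a * b * c ^ 6 * d + 5 * a * b * c ^ 5 * d ^ 2 - a * b * c ^ 4 * d ^ 3
    + 2 * a * b * c ^ 3 * d ^ 4 - 5 * a * b * c ^ 2 * d ^ 5 + 3 * a * b * c * d ^ 6
    + 2 * a * b * d ^ 7 - 2 * a * c ^ 7 * d + 2 * a * c ^ 6 * d ^ 2 - 2 * a * c ^ 5 * d ^ 3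
    - 2 * a * c ^ 4 * d ^ 4 - 5 * a * c ^ 3 * d ^ 5 + 2 * a * c ^ 2 * d ^ 6 + 3 * a * c * d ^ 7
    - 2 * a * d ^ 8 + b ^ 8 * c - b ^ 8 * d + b ^ 7 * c ^ 2 - b ^ 7 * c * d + b ^ 7 * d ^ 2
    + b ^ 6 * c ^ 3 - 2 * b ^ 6 * c ^ 2 * d + b ^ 6 * c * d ^ 2 + 2 * b ^ 5 * c ^ 4
    + 2 * b ^ 5 * c ^ 2 * d ^ 2 - 3 * b ^ 5 * c * d ^ 3 - b ^ 4 * c ^ 4 * d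
    - b ^ 4 * c ^ 2 * d ^ 3 + b ^ 4 * c * d ^ 4 - b ^ 4 * d ^ 5 + b ^ 3 * c ^ 6
    - 3 * b ^ 3 * c ^ 4 * d ^ 2 + b ^ 3 * c ^ 3 * d ^ 3 - b ^ 3 * d ^ 6 - b ^ 2 * c ^ 6 * d
    + b ^ 2 * c ^ 5 * d ^ 2 + b ^ 2 * c ^ 4 * d ^ 3 + b ^ 2 * c ^ 3 * d ^ 4
    - 2 * b ^ 2 * c ^ 2 * d ^ 5 + b ^ 2 * c * d ^ 6 + b ^ 2 * d ^ 7 - b * c ^ 7 * d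
    + 2 * b * c ^ 6 * d ^ 2 - b * c ^ 5 * d ^ 3 - 2 * b * c ^ 3 * d ^ 5 + 2 * b * c ^ 2 * d ^ 6
    + b * c * d ^ 7 - c ^ 9 + c ^ 7 * d ^ 2 - c ^ 6 * d ^ 3 - c ^ 3 * d ^ 6) * hp

/-- The value `t = 0` belongs to the ratio `v = 0`, where the equations are those of the critical
points of `g` itself. -/
theorem GCrit.pow_nine_eq_zero_of_0 {k : Type*} [CommRing k] (hp : (3449 : k) = 0) {a b c d : k}
    (h : GCrit (0) a b c d) : c ^ 9 = 0 := by
  linear_combination (-412 * a ^ 6 + 1622 * a ^ 5 * b + 733 * a ^ 5 * c - 125 * a ^ 5 * d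
    + 705 * a ^ 4 * b ^ 2 - 78 * a ^ 4 * b * c - 1570 * a ^ 4 * b * d - 1506 * a ^ 4 * c ^ 2
    + 107 * a ^ 4 * c * d + 799 * a ^ 4 * d ^ 2 + 1079 * a ^ 3 * b ^ 3 + 1042 * a ^ 3 * b ^ 2 * c
    - 1400 * a ^ 3 * b ^ 2 * d + 928 * a ^ 3 * b * c ^ 2 - 986 * a ^ 3 * b * c * d
    - 1130 * a ^ 3 * b * d ^ 2 + 233 * a ^ 3 * c ^ 3 - 145 * a ^ 3 * c ^ 2 * d
    + 549 * a ^ 3 * c * d ^ 2 - 1540 * a ^ 3 * d ^ 3 - 864 * a ^ 2 * b ^ 4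
    - 49 * a ^ 2 * b ^ 3 * c + 1069 * a ^ 2 * b ^ 3 * d - 819 * a ^ 2 * b ^ 2 * c ^ 2
    + 130 * a ^ 2 * b ^ 2 * c * d - 390 * a ^ 2 * b ^ 2 * d ^ 2 - 1190 * a ^ 2 * b * c ^ 3
    - 564 * a ^ 2 * b * c ^ 2 * d + 987 * a ^ 2 * b * c * d ^ 2 - 207 * a ^ 2 * b * d ^ 3
    + 1047 * a ^ 2 * c ^ 4 - 1207 * a ^ 2 * c ^ 3 * d - 1005 * a ^ 2 * c ^ 2 * d ^ 2
    + 388 * a ^ 2 * c * d ^ 3 - 116 * a ^ 2 * d ^ 4 + 232 * a * b ^ 5 + 767 * a * b ^ 4 * c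
    - 486 * a * b ^ 4 * d - 872 * a * b ^ 3 * c ^ 2 - 439 * a * b ^ 3 * c * d
    + 1021 * a * b ^ 3 * d ^ 2 - 1692 * a * b ^ 2 * c ^ 3 + 209 * a * b ^ 2 * c ^ 2 * d
    + 558 * a * b ^ 2 * c * d ^ 2 - 798 * a * b ^ 2 * d ^ 3 - 1420 * a * b * c ^ 4
    - 521 * a * b * c ^ 3 * d + 748 * a * b * c ^ 2 * d ^ 2 - 322 * a * b * c * d ^ 3
    + 284 * a * b * d ^ 4 + 187 * a * c ^ 5 + 1538 * a * c ^ 4 * d + 665 * a * c ^ 3 * d ^ 2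
    - 1155 * a * c ^ 2 * d ^ 3 + 1507 * a * c * d ^ 4 + 719 * a * d ^ 5 + 1599 * b ^ 6
    + 33 * b ^ 5 * c - 322 * b ^ 5 * d + 530 * b ^ 4 * c ^ 2 - 60 * b ^ 4 * c * d
    + 191 * b ^ 4 * d ^ 2 - 143 * b ^ 3 * c ^ 3 + 158 * b ^ 3 * c ^ 2 * d + 73 * b ^ 3 * c * d ^ 2
    + 910 * b ^ 3 * d ^ 3 - 1645 * b ^ 2 * c ^ 4 - 1119 * b ^ 2 * c ^ 3 * d
    + 983 * b ^ 2 * c ^ 2 * d ^ 2 + 1438 * b ^ 2 * c * d ^ 3 - 455 * b ^ 2 * d ^ 4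
    + 805 * b * c ^ 5 - 347 * b * c ^ 4 * d - 910 * b * c ^ 3 * d ^ 2 - 1365 * b * c ^ 2 * d ^ 3
    + 719 * b * c * d ^ 4 - 910 * b * d ^ 5 - 180 * c ^ 6 - 894 * c ^ 5 * d + 455 * c ^ 4 * d ^ 2
    + 455 * c ^ 3 * d ^ 3 + 455 * c ^ 2 * d ^ 4 - 455 * c * d ^ 5) * h.eq₀ + (1099 * a ^ 6
    - 1375 * a ^ 5 * b + 396 * a ^ 5 * c + 1670 * a ^ 5 * d - 1036 * a ^ 4 * b ^ 2
    - 631 * a ^ 4 * b * c + 1554 * a ^ 4 * b * d + 346 * a ^ 4 * c ^ 2 + 1112 * a ^ 4 * c * d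
    - 1273 * a ^ 4 * d ^ 2 - 15 * a ^ 3 * b ^ 3 + 1535 * a ^ 3 * b ^ 2 * c
    - 1475 * a ^ 3 * b ^ 2 * d - 547 * a ^ 3 * b * c ^ 2 - 1371 * a ^ 3 * b * c * d
    - 239 * a ^ 3 * b * d ^ 2 - 337 * a ^ 3 * c ^ 3 + 550 * a ^ 3 * c ^ 2 * d
    - 833 * a ^ 3 * d ^ 3 + 1001 * a ^ 2 * b ^ 4 + 648 * a ^ 2 * b ^ 3 * c
    + 1696 * a ^ 2 * b ^ 3 * d + 126 * a ^ 2 * b ^ 2 * c ^ 2 - 698 * a ^ 2 * b ^ 2 * c * d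
    + 1537 * a ^ 2 * b ^ 2 * d ^ 2 - 363 * a ^ 2 * b * c ^ 3 - 228 * a ^ 2 * b * c ^ 2 * d
    - 106 * a ^ 2 * b * d ^ 3 + 1232 * a ^ 2 * c ^ 4 - 858 * a ^ 2 * c ^ 3 * d
    - 1029 * a ^ 2 * d ^ 4 + 910 * a * b ^ 5 + 1632 * a * b ^ 4 * c + 623 * a * b ^ 4 * d
    + 52 * a * b ^ 3 * c ^ 2 - 332 * a * b ^ 3 * c * d - 1082 * a * b ^ 3 * d ^ 2
    + 258 * a * b ^ 2 * c ^ 3 - 671 * a * b ^ 2 * c ^ 2 * d - 1223 * a * b ^ 2 * d ^ 3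
    + 1627 * a * b * c ^ 4 - 1544 * a * b * c ^ 3 * d - 1487 * a * b * d ^ 4 - 1383 * a * c ^ 5
    - 1576 * a * c ^ 4 * d - 753 * a * d ^ 5 + 910 * b ^ 5 * c - 910 * b ^ 5 * d
    + 631 * b ^ 4 * c ^ 2 + 88 * b ^ 4 * c * d - 1629 * b ^ 4 * d ^ 2 + 958 * b ^ 3 * c ^ 3
    - 224 * b ^ 3 * c ^ 2 * d + 455 * b ^ 3 * d ^ 3 - 1698 * b ^ 2 * c ^ 4
    + 225 * b ^ 2 * c ^ 3 * d - 455 * b ^ 2 * d ^ 4 + 187 * b * c ^ 5 - 859 * b * c ^ 4 * d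
    - 455 * b * d ^ 5 + 1091 * c ^ 6 + 80 * c ^ 5 * d - 455 * d ^ 6) * h.eq₁ + (-526 * a ^ 6
    - 1379 * a ^ 5 * b - 499 * a ^ 5 * c + 1008 * a ^ 5 * d + 581 * a ^ 4 * b ^ 2
    - 421 * a ^ 4 * b * c + 896 * a ^ 4 * b * d - 1542 * a ^ 4 * c ^ 2 + 499 * a ^ 4 * c * d
    + 8 * a ^ 4 * d ^ 2 - 39 * a ^ 3 * b ^ 3 + 1379 * a ^ 3 * b ^ 2 * c - 1369 * a ^ 3 * b ^ 2 * d
    - 1083 * a ^ 3 * b * c ^ 2 - 1318 * a ^ 3 * b * c * d + 5 * a ^ 3 * c ^ 3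
    + 59 * a ^ 3 * c ^ 2 * d + 547 * a ^ 3 * d ^ 3 + 1200 * a ^ 2 * b ^ 4
    - 1448 * a ^ 2 * b ^ 3 * c + 563 * a ^ 2 * b ^ 3 * d + 1408 * a ^ 2 * b ^ 2 * c ^ 2
    - 372 * a ^ 2 * b ^ 2 * c * d - 359 * a ^ 2 * b * c ^ 3 + 639 * a ^ 2 * c ^ 4
    - 5 * a ^ 2 * c ^ 3 * d - 310 * a ^ 2 * d ^ 4 - 198 * a * b ^ 5 - 1660 * a * b ^ 4 * c
    - 352 * a * b ^ 4 * d - 1548 * a * b ^ 3 * c ^ 2 - 1274 * a * b ^ 2 * c ^ 3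
    + 1095 * a * b * c ^ 4 + 1269 * a * c ^ 5 + 1086 * a * c ^ 4 * d - 753 * a * d ^ 5
    + 30 * b ^ 6 + 555 * b ^ 5 * c - 1307 * b ^ 5 * d + 1268 * b ^ 3 * c ^ 3 + 456 * b ^ 2 * c ^ 4
    + 1269 * b * c ^ 5 - 1724 * c ^ 6 - 1269 * c ^ 5 * d - 455 * d ^ 6) * h.eq₂ + (-1075 * a ^ 6
    + 1246 * a ^ 5 * b - 1483 * a ^ 5 * c - 106 * a ^ 5 * d + 743 * a ^ 4 * b ^ 2
    + 718 * a ^ 4 * b * c + 1416 * a ^ 4 * b * d - 482 * a ^ 4 * c * d + 1490 * a ^ 4 * d ^ 2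
    - 686 * a ^ 3 * b ^ 3 - 1276 * a ^ 3 * b ^ 2 * c + 1652 * a ^ 3 * b ^ 2 * d
    - 589 * a ^ 3 * b * c ^ 2 - 899 * a ^ 3 * b * c * d + 241 * a ^ 3 * c ^ 3
    - 1103 * a ^ 3 * d ^ 3 + 1054 * a ^ 2 * b ^ 4 + 1421 * a ^ 2 * b ^ 3 * c
    + 1478 * a ^ 2 * b ^ 3 * d + 1660 * a ^ 2 * b ^ 2 * c ^ 2 + 1193 * a ^ 2 * b ^ 2 * c * d
    - 1657 * a ^ 2 * d ^ 4 - 5 * a * b ^ 5 - 1349 * a * b ^ 4 * c - 998 * a * d ^ 5) * h.eq₃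
    - (a ^ 8 * b + 2 * a ^ 8 * c + a ^ 8 * d + a ^ 7 * b * c - a ^ 7 * b * d + a ^ 7 * c * d
    - a ^ 7 * d ^ 2 + 2 * a ^ 6 * b ^ 3 + a ^ 6 * b ^ 2 * c - 3 * a ^ 6 * b ^ 2 * d
    - a ^ 6 * b * c * d - 6 * a ^ 6 * b * d ^ 2 - a ^ 6 * c ^ 3 + 2 * a ^ 6 * c ^ 2 * d
    - 3 * a ^ 6 * c * d ^ 2 - 3 * a ^ 6 * d ^ 3 + 3 * a ^ 5 * b ^ 3 * c - 3 * a ^ 5 * b ^ 3 * d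
    - 6 * a ^ 5 * b ^ 2 * c * d + 2 * a ^ 5 * b ^ 2 * d ^ 2 - 4 * a ^ 5 * b * c ^ 3
    + 2 * a ^ 5 * b * c ^ 2 * d + 4 * a ^ 5 * b * d ^ 3 + a ^ 5 * c ^ 4 + 2 * a ^ 5 * c ^ 3 * d
    - 3 * a ^ 5 * c ^ 2 * d ^ 2 - 2 * a ^ 5 * c * d ^ 3 + a ^ 5 * d ^ 4 + 2 * a ^ 4 * b ^ 4 * c
    - 3 * a ^ 4 * b ^ 4 * d + a ^ 4 * b ^ 3 * c ^ 2 - 11 * a ^ 4 * b ^ 3 * c * d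
    + 2 * a ^ 4 * b ^ 3 * d ^ 2 - 4 * a ^ 4 * b ^ 2 * c ^ 3 - 8 * a ^ 4 * b ^ 2 * c ^ 2 * d
    + 9 * a ^ 4 * b ^ 2 * c * d ^ 2 - a ^ 4 * b ^ 2 * d ^ 3 - a ^ 4 * b * c ^ 4
    + a ^ 4 * b * c ^ 3 * d + 5 * a ^ 4 * b * d ^ 4 + a ^ 4 * c ^ 5 - a ^ 4 * c ^ 4 * d
    + a ^ 4 * c ^ 3 * d ^ 2 - a ^ 4 * c ^ 2 * d ^ 3 + 2 * a ^ 4 * c * d ^ 4 + 5 * a ^ 4 * d ^ 5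
    + 2 * a ^ 3 * b ^ 6 + 2 * a ^ 3 * b ^ 5 * c - 3 * a ^ 3 * b ^ 5 * d
    - 2 * a ^ 3 * b ^ 4 * c * d - 4 * a ^ 3 * b ^ 3 * c ^ 3 - 3 * a ^ 3 * b ^ 3 * c ^ 2 * d
    + 6 * a ^ 3 * b ^ 3 * c * d ^ 2 - 2 * a ^ 3 * b ^ 3 * d ^ 3 - 5 * a ^ 3 * b ^ 2 * c ^ 4
    - a ^ 3 * b ^ 2 * c ^ 3 * d + 9 * a ^ 3 * b ^ 2 * c ^ 2 * d ^ 2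
    - 5 * a ^ 3 * b ^ 2 * c * d ^ 3 + 5 * a ^ 3 * b ^ 2 * d ^ 4 + 3 * a ^ 3 * b * c ^ 5
    - 4 * a ^ 3 * b * c ^ 4 * d + 5 * a ^ 3 * b * c ^ 3 * d ^ 2 - 5 * a ^ 3 * b * c ^ 2 * d ^ 3
    + a ^ 3 * b * c * d ^ 4 - 4 * a ^ 3 * c ^ 5 * d + 2 * a ^ 3 * c ^ 4 * d ^ 2
    + a ^ 3 * c ^ 3 * d ^ 3 + 4 * a ^ 3 * c ^ 2 * d ^ 4 - 2 * a ^ 3 * c * d ^ 5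
    - 2 * a ^ 3 * d ^ 6 + 2 * a ^ 2 * b ^ 7 + 3 * a ^ 2 * b ^ 6 * c - 3 * a ^ 2 * b ^ 6 * d
    + 2 * a ^ 2 * b ^ 5 * c ^ 2 - 5 * a ^ 2 * b ^ 5 * c * d + 2 * a ^ 2 * b ^ 5 * d ^ 2
    - a ^ 2 * b ^ 4 * c ^ 2 * d - 2 * a ^ 2 * b ^ 4 * c * d ^ 2 + 3 * a ^ 2 * b ^ 4 * d ^ 3
    - 5 * a ^ 2 * b ^ 3 * c ^ 4 + 2 * a ^ 2 * b ^ 3 * c ^ 3 * d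
    + 4 * a ^ 2 * b ^ 3 * c ^ 2 * d ^ 2 + 2 * a ^ 2 * b ^ 3 * c * d ^ 3 + a ^ 2 * b ^ 3 * d ^ 4
    + 2 * a ^ 2 * b ^ 2 * c ^ 4 * d + 4 * a ^ 2 * b ^ 2 * c ^ 3 * d ^ 2
    - 2 * a ^ 2 * b ^ 2 * c ^ 2 * d ^ 3 + 4 * a ^ 2 * b ^ 2 * c * d ^ 4 + a ^ 2 * b ^ 2 * d ^ 5
    + a ^ 2 * b * c ^ 6 - 6 * a ^ 2 * b * c ^ 5 * d + 4 * a ^ 2 * b * c ^ 4 * d ^ 2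
    - 3 * a ^ 2 * b * c ^ 3 * d ^ 3 + 5 * a ^ 2 * b * c ^ 2 * d ^ 4 - 2 * a ^ 2 * b * c * d ^ 5
    - a ^ 2 * c ^ 6 * d + 2 * a ^ 2 * c ^ 5 * d ^ 2 - 2 * a ^ 2 * c ^ 4 * d ^ 3
    + a ^ 2 * c ^ 3 * d ^ 4 - a ^ 2 * c ^ 2 * d ^ 5 - a ^ 2 * c * d ^ 6 - 3 * a ^ 2 * d ^ 7
    + a * b ^ 8 + 3 * a * b ^ 7 * c - 2 * a * b ^ 7 * d + 2 * a * b ^ 6 * c ^ 2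
    - 5 * a * b ^ 6 * c * d + a * b ^ 6 * d ^ 2 + 2 * a * b ^ 5 * c ^ 3
    - 4 * a * b ^ 5 * c ^ 2 * d + 2 * a * b ^ 5 * c * d ^ 2 - a * b ^ 5 * d ^ 3
    - 2 * a * b ^ 4 * c ^ 3 * d + a * b ^ 4 * c ^ 2 * d ^ 2 - 2 * a * b ^ 4 * d ^ 4
    - 4 * a * b ^ 3 * c ^ 5 + a * b ^ 3 * c ^ 4 * d + 3 * a * b ^ 3 * c ^ 3 * d ^ 2
    - a * b ^ 3 * c ^ 2 * d ^ 3 - 2 * a * b ^ 3 * c * d ^ 4 - a * b ^ 2 * c ^ 5 * d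
    + 2 * a * b ^ 2 * c ^ 4 * d ^ 2 - 2 * a * b ^ 2 * c ^ 3 * d ^ 3
    + 2 * a * b ^ 2 * c ^ 2 * d ^ 4 - 2 * a * b ^ 2 * c * d ^ 5 + 2 * a * b ^ 2 * d ^ 6
    - 3 * a * b * c ^ 6 * d + 4 * a * b * c ^ 5 * d ^ 2 + 4 * a * b * c ^ 3 * d ^ 4
    - 3 * a * b * c ^ 2 * d ^ 5 + a * b * c * d ^ 6 + a * b * d ^ 7 + a * c ^ 8 + a * c ^ 7 * d
    + a * c ^ 6 * d ^ 2 - a * c ^ 5 * d ^ 3 - 2 * a * c ^ 3 * d ^ 5 + a * c ^ 2 * d ^ 6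
    + a * c * d ^ 7 - 2 * a * d ^ 8 + b ^ 8 * c - b ^ 8 * d + b ^ 7 * c ^ 2 - 2 * b ^ 7 * c * d
    + b ^ 6 * c ^ 3 - 2 * b ^ 6 * c ^ 2 * d + 2 * b ^ 6 * c * d ^ 2 - 2 * b ^ 5 * c ^ 3 * d
    + b ^ 5 * c * d ^ 3 - 2 * b ^ 4 * c ^ 4 * d + b ^ 4 * c ^ 3 * d ^ 2 + b ^ 4 * c ^ 2 * d ^ 3
    - 2 * b ^ 4 * c * d ^ 4 + b ^ 3 * c ^ 6 + b ^ 3 * c ^ 5 * d + b ^ 3 * c ^ 4 * d ^ 2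
    - b ^ 3 * c ^ 3 * d ^ 3 - b ^ 3 * c ^ 2 * d ^ 4 + b ^ 3 * c * d ^ 5 - b ^ 2 * c ^ 6 * d
    + b ^ 2 * c ^ 5 * d ^ 2 + b ^ 2 * c ^ 3 * d ^ 4 - b ^ 2 * c ^ 2 * d ^ 5 + b ^ 2 * c * d ^ 6
    + b * c ^ 8 + b * c ^ 6 * d ^ 2 - b * c ^ 5 * d ^ 3 - b * c ^ 3 * d ^ 5 + b * c ^ 2 * d ^ 6
    - c ^ 9 - c ^ 8 * d + c ^ 7 * d ^ 2) * hp

/-- This value of `t` and the next four, 792, -753, -362 and -250, equal `-4v / (1 + 2v)` modulo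
3449 for the nonzero ratios `v = 858, -70, 1600, 1427, -376` that occur when `x₀ = 0`. -/
theorem GCrit.pow_nine_eq_zero_of_neg_922 {k : Type*} [CommRing k] (hp : (3449 : k) = 0) {a b c d : k}
    (h : GCrit (-922) a b c d) : c ^ 9 = 0 := by
  linear_combination (633 * a ^ 6 + 111 * a ^ 5 * b - 242 * a ^ 5 * c + 401 * a ^ 5 * d
    - 835 * a ^ 4 * b ^ 2 + 328 * a ^ 4 * b * c - 367 * a ^ 4 * b * d + 1478 * a ^ 4 * c ^ 2
    + 956 * a ^ 4 * c * d + 1288 * a ^ 4 * d ^ 2 - 386 * a ^ 3 * b ^ 3 - 87 * a ^ 3 * b ^ 2 * c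
    + a ^ 3 * b ^ 2 * d + 1693 * a ^ 3 * b * c ^ 2 + 115 * a ^ 3 * b * c * d
    - 1297 * a ^ 3 * b * d ^ 2 + 1049 * a ^ 3 * c ^ 3 + 1039 * a ^ 3 * c ^ 2 * d
    - 1661 * a ^ 3 * c * d ^ 2 + 1535 * a ^ 3 * d ^ 3 - 881 * a ^ 2 * b ^ 4
    - 1518 * a ^ 2 * b ^ 3 * c - 1502 * a ^ 2 * b ^ 3 * d + 1284 * a ^ 2 * b ^ 2 * c ^ 2
    + 509 * a ^ 2 * b ^ 2 * c * d + 1687 * a ^ 2 * b ^ 2 * d ^ 2 + 1242 * a ^ 2 * b * c ^ 3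
    + 858 * a ^ 2 * b * c ^ 2 * d - 1315 * a ^ 2 * b * c * d ^ 2 - 1526 * a ^ 2 * b * d ^ 3
    - 1101 * a ^ 2 * c ^ 4 + 994 * a ^ 2 * c ^ 3 * d - 64 * a ^ 2 * c ^ 2 * d ^ 2
    + 729 * a ^ 2 * c * d ^ 3 + 642 * a ^ 2 * d ^ 4 + 232 * a * b ^ 5 - 1222 * a * b ^ 4 * c
    - 959 * a * b ^ 4 * d - 1642 * a * b ^ 3 * c ^ 2 - 894 * a * b ^ 3 * c * d
    + 876 * a * b ^ 3 * d ^ 2 - 540 * a * b ^ 2 * c ^ 3 - 1076 * a * b ^ 2 * c ^ 2 * d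
    + 1174 * a * b ^ 2 * c * d ^ 2 + 465 * a * b ^ 2 * d ^ 3 - 690 * a * b * c ^ 4
    - 245 * a * b * c ^ 3 * d - 189 * a * b * c ^ 2 * d ^ 2 + 1128 * a * b * c * d ^ 3
    - 510 * a * b * d ^ 4 + 1669 * a * c ^ 5 + 919 * a * c ^ 4 * d + 23 * a * c ^ 3 * d ^ 2
    + 328 * a * c ^ 2 * d ^ 3 - 334 * a * c * d ^ 4 + 1583 * a * d ^ 5 + 849 * b ^ 6
    + 1250 * b ^ 5 * c + 1433 * b ^ 5 * d - 630 * b ^ 4 * c ^ 2 + 1015 * b ^ 4 * c * d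
    - 548 * b ^ 4 * d ^ 2 - 1570 * b ^ 3 * c ^ 3 + 546 * b ^ 3 * c ^ 2 * d
    - 204 * b ^ 3 * c * d ^ 2 + 1572 * b ^ 3 * d ^ 3 + 970 * b ^ 2 * c ^ 4
    + 1114 * b ^ 2 * c ^ 3 * d - 594 * b ^ 2 * c ^ 2 * d ^ 2 - 1233 * b ^ 2 * c * d ^ 3
    + 1651 * b ^ 2 * d ^ 4 + 432 * b * c ^ 5 - 1660 * b * c ^ 4 * d + 328 * b * c ^ 3 * d ^ 2
    - 458 * b * c ^ 2 * d ^ 3 + 1108 * b * c * d ^ 4 - 622 * b * d ^ 5 + 1126 * c ^ 6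
    + 854 * c ^ 5 * d + 786 * c ^ 4 * d ^ 2 + 786 * c ^ 3 * d ^ 3 + 786 * c ^ 2 * d ^ 4
    - 311 * c * d ^ 5) * h.eq₀ + (-1659 * a ^ 6 - 1021 * a ^ 5 * b + 1427 * a ^ 5 * c
    - 1336 * a ^ 5 * d + 1088 * a ^ 4 * b ^ 2 + 1030 * a ^ 4 * b * c + 93 * a ^ 4 * b * d
    - 758 * a ^ 4 * c ^ 2 + 1705 * a ^ 4 * c * d - 166 * a ^ 4 * d ^ 2 + 1428 * a ^ 3 * b ^ 3
    + 994 * a ^ 3 * b ^ 2 * c + 185 * a ^ 3 * b ^ 2 * d - 295 * a ^ 3 * b * c ^ 2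
    - 648 * a ^ 3 * b * c * d - 714 * a ^ 3 * b * d ^ 2 + 1030 * a ^ 3 * c ^ 3
    - 459 * a ^ 3 * c ^ 2 * d - 949 * a ^ 3 * d ^ 3 - 1152 * a ^ 2 * b ^ 4
    + 463 * a ^ 2 * b ^ 3 * c - 131 * a ^ 2 * b ^ 3 * d - 458 * a ^ 2 * b ^ 2 * c ^ 2
    - 1192 * a ^ 2 * b ^ 2 * c * d + 261 * a ^ 2 * b ^ 2 * d ^ 2 + 1067 * a ^ 2 * b * c ^ 3
    - 1045 * a ^ 2 * b * c ^ 2 * d + 916 * a ^ 2 * b * d ^ 3 - 259 * a ^ 2 * c ^ 4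
    + 602 * a ^ 2 * c ^ 3 * d - 14 * a ^ 2 * d ^ 4 + 1510 * a * b ^ 5 - 1029 * a * b ^ 4 * c
    - 1456 * a * b ^ 4 * d + 570 * a * b ^ 3 * c ^ 2 + 20 * a * b ^ 3 * c * d
    + 409 * a * b ^ 3 * d ^ 2 + 1020 * a * b ^ 2 * c ^ 3 - 472 * a * b ^ 2 * c ^ 2 * d
    + 522 * a * b ^ 2 * d ^ 3 - 913 * a * b * c ^ 4 + 736 * a * b * c ^ 3 * d
    - 973 * a * b * d ^ 4 + 1059 * a * c ^ 5 + 166 * a * c ^ 4 * d - 724 * a * d ^ 5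
    + 1510 * b ^ 5 * c - 1510 * b ^ 5 * d + 123 * b ^ 4 * c ^ 2 + 634 * b ^ 4 * c * d
    + 1182 * b ^ 4 * d ^ 2 - 169 * b ^ 3 * c ^ 3 - 1044 * b ^ 3 * c ^ 2 * d - 701 * b ^ 3 * d ^ 3
    - 1067 * b ^ 2 * c ^ 4 + 583 * b ^ 2 * c ^ 3 * d + 1651 * b ^ 2 * d ^ 4 + 165 * b * c ^ 5
    - 811 * b * c ^ 4 * d - 311 * b * d ^ 5 - 1718 * c ^ 6 - 1069 * c ^ 5 * d
    - 311 * d ^ 6) * h.eq₁ + (-785 * a ^ 6 + 244 * a ^ 5 * b - 112 * a ^ 5 * c + 1294 * a ^ 5 * d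
    + 669 * a ^ 4 * b ^ 2 - 198 * a ^ 4 * b * c - 996 * a ^ 4 * b * d + 225 * a ^ 4 * c ^ 2
    + 112 * a ^ 4 * c * d + 32 * a ^ 4 * d ^ 2 - 174 * a ^ 3 * b ^ 3 + 1179 * a ^ 3 * b ^ 2 * c
    - 48 * a ^ 3 * b ^ 2 * d - 321 * a ^ 3 * b * c ^ 2 + 205 * a ^ 3 * b * c * d
    - 372 * a ^ 3 * c ^ 3 - 282 * a ^ 3 * c ^ 2 * d - 1459 * a ^ 3 * d ^ 3 + 16 * a ^ 2 * b ^ 4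
    - 1438 * a ^ 2 * b ^ 3 * c - 1472 * a ^ 2 * b ^ 3 * d + 1454 * a ^ 2 * b ^ 2 * c ^ 2
    - 1641 * a ^ 2 * b ^ 2 * c * d + 1324 * a ^ 2 * b * c ^ 3 - 1238 * a ^ 2 * c ^ 4
    + 372 * a ^ 2 * c ^ 3 * d - 393 * a ^ 2 * d ^ 4 - 1061 * a * b ^ 5 + 101 * a * b ^ 4 * c
    + 1176 * a * b ^ 4 * d - 1396 * a * b ^ 3 * c ^ 2 - 1085 * a * b ^ 2 * c ^ 3
    - 799 * a * b * c ^ 4 + 1001 * a * c ^ 5 - 771 * a * c ^ 4 * d - 724 * a * d ^ 5 - 420 * b ^ 6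
    + 1104 * b ^ 5 * c + 1360 * b ^ 5 * d + 1570 * b ^ 3 * c ^ 3 + 439 * b ^ 2 * c ^ 4
    + 1001 * b * c ^ 5 - 377 * c ^ 6 - 1001 * c ^ 5 * d - 311 * d ^ 6) * h.eq₂ + (88 * a ^ 6
    + 1610 * a ^ 5 * b + 1416 * a ^ 5 * c + 1014 * a ^ 5 * d + 1655 * a ^ 4 * b ^ 2
    - 618 * a ^ 4 * b * c + 984 * a ^ 4 * b * d + 860 * a ^ 4 * c * d - 192 * a ^ 4 * d ^ 2
    - 1354 * a ^ 3 * b ^ 3 + 657 * a ^ 3 * b ^ 2 * c + 789 * a ^ 3 * b ^ 2 * d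
    + 1246 * a ^ 3 * b * c ^ 2 - 1437 * a ^ 3 * b * c * d - 182 * a ^ 3 * c ^ 3
    + 413 * a ^ 3 * d ^ 3 + 1005 * a ^ 2 * b ^ 4 - 33 * a ^ 2 * b ^ 3 * c
    + 186 * a ^ 2 * b ^ 3 * d - 132 * a ^ 2 * b ^ 2 * c ^ 2 - 837 * a ^ 2 * b ^ 2 * c * d
    - 277 * a ^ 2 * d ^ 4 - 1426 * a * b ^ 5 - 162 * a * b ^ 4 * c - 1046 * a * d ^ 5) * h.eq₃
    - (-a ^ 8 * b - a ^ 8 * c + a ^ 8 * d - 2 * a ^ 7 * b ^ 2 - 2 * a ^ 7 * b * c + a ^ 7 * c ^ 2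
    + a ^ 7 * c * d - 2 * a ^ 6 * b ^ 3 - 2 * a ^ 6 * b ^ 2 * c - a ^ 6 * b ^ 2 * d
    + 2 * a ^ 6 * b * c ^ 2 + 2 * a ^ 6 * b * c * d - 208 * a ^ 6 * c ^ 3 + a ^ 6 * c ^ 2 * d
    - 2 * a ^ 6 * c * d ^ 2 - 2 * a ^ 5 * b ^ 4 - a ^ 5 * b ^ 3 * c - 4 * a ^ 5 * b ^ 3 * d
    + 3 * a ^ 5 * b ^ 2 * c ^ 2 - 2 * a ^ 5 * b ^ 2 * c * d + 3 * a ^ 5 * b ^ 2 * d ^ 2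
    + 71 * a ^ 5 * b * c ^ 3 - 2 * a ^ 5 * b * c ^ 2 * d - 3 * a ^ 5 * b * c * d ^ 2
    + 2 * a ^ 5 * b * d ^ 3 - 30 * a ^ 5 * c ^ 4 + 346 * a ^ 5 * c ^ 3 * d
    - 4 * a ^ 5 * c ^ 2 * d ^ 2 + 3 * a ^ 5 * c * d ^ 3 + 2 * a ^ 5 * d ^ 4
    - 4 * a ^ 4 * b ^ 4 * c - 4 * a ^ 4 * b ^ 4 * d - a ^ 4 * b ^ 3 * c ^ 2
    - 3 * a ^ 4 * b ^ 3 * c * d + 5 * a ^ 4 * b ^ 3 * d ^ 2 + 184 * a ^ 4 * b ^ 2 * c ^ 3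
    - 6 * a ^ 4 * b ^ 2 * c ^ 2 * d + 2 * a ^ 4 * b ^ 2 * c * d ^ 2 + 2 * a ^ 4 * b ^ 2 * d ^ 3
    - 52 * a ^ 4 * b * c ^ 4 - 270 * a ^ 4 * b * c ^ 3 * d - 6 * a ^ 4 * b * c ^ 2 * d ^ 2
    + 4 * a ^ 4 * b * c * d ^ 3 + 3 * a ^ 4 * b * d ^ 4 + 62 * a ^ 4 * c ^ 5
    + 32 * a ^ 4 * c ^ 4 * d + 5 * a ^ 4 * c ^ 3 * d ^ 2 + 3 * a ^ 4 * c ^ 2 * d ^ 3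
    + 2 * a ^ 4 * c * d ^ 4 + 2 * a ^ 3 * b ^ 6 + 3 * a ^ 3 * b ^ 5 * d
    - 6 * a ^ 3 * b ^ 4 * c ^ 2 + a ^ 3 * b ^ 4 * c * d + 4 * a ^ 3 * b ^ 4 * d ^ 2
    - 47 * a ^ 3 * b ^ 3 * c ^ 3 - 2 * a ^ 3 * b ^ 3 * c ^ 2 * d + 9 * a ^ 3 * b ^ 3 * c * d ^ 2
    - 4 * a ^ 3 * b ^ 3 * d ^ 3 + 318 * a ^ 3 * b ^ 2 * c ^ 4 - 17 * a ^ 3 * b ^ 2 * c ^ 3 * d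
    - a ^ 3 * b ^ 2 * c ^ 2 * d ^ 2 + 3 * a ^ 3 * b ^ 2 * d ^ 4 - 85 * a ^ 3 * b * c ^ 5
    + 54 * a ^ 3 * b * c ^ 4 * d - 2 * a ^ 3 * b * c ^ 3 * d ^ 2 + 7 * a ^ 3 * b * c ^ 2 * d ^ 3
    - 3 * a ^ 3 * b * c * d ^ 4 + 2 * a ^ 3 * b * d ^ 5 - 97 * a ^ 3 * c ^ 6
    - 75 * a ^ 3 * c ^ 5 * d - a ^ 3 * c ^ 4 * d ^ 2 - 389 * a ^ 3 * c ^ 3 * d ^ 3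
    - a ^ 3 * c ^ 2 * d ^ 4 + a ^ 3 * c * d ^ 5 + 4 * a ^ 2 * b ^ 6 * c
    - 2 * a ^ 2 * b ^ 5 * c ^ 2 - a ^ 2 * b ^ 5 * c * d + a ^ 2 * b ^ 5 * d ^ 2
    + a ^ 2 * b ^ 4 * c ^ 3 + 5 * a ^ 2 * b ^ 4 * c ^ 2 * d + 5 * a ^ 2 * b ^ 4 * c * d ^ 2
    + a ^ 2 * b ^ 4 * d ^ 3 - 386 * a ^ 2 * b ^ 3 * c ^ 4 - 393 * a ^ 2 * b ^ 3 * c ^ 3 * d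
    + 6 * a ^ 2 * b ^ 3 * c ^ 2 * d ^ 2 - 3 * a ^ 2 * b ^ 3 * c * d ^ 3 + a ^ 2 * b ^ 3 * d ^ 4
    + 390 * a ^ 2 * b ^ 2 * c ^ 5 - 440 * a ^ 2 * b ^ 2 * c ^ 4 * d
    + a ^ 2 * b ^ 2 * c ^ 2 * d ^ 3 - 2 * a ^ 2 * b ^ 2 * d ^ 5 + 358 * a ^ 2 * b * c ^ 6
    - 2 * a ^ 2 * b * c ^ 5 * d + 2 * a ^ 2 * b * c ^ 3 * d ^ 3 - a ^ 2 * b * c ^ 2 * d ^ 4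
    + a ^ 2 * b * c * d ^ 5 - a ^ 2 * b * d ^ 6 - 331 * a ^ 2 * c ^ 7 + 97 * a ^ 2 * c ^ 6 * d
    - 106 * a ^ 2 * c ^ 3 * d ^ 4 - a ^ 2 * c * d ^ 6 - a ^ 2 * d ^ 7 + a * b ^ 8 + a * b ^ 7 * c
    + 4 * a * b ^ 6 * c ^ 2 - 3 * a * b ^ 6 * c * d - 3 * a * b ^ 6 * d ^ 2
    - 285 * a * b ^ 5 * c ^ 3 - 2 * a * b ^ 5 * d ^ 3 + 25 * a * b ^ 4 * c ^ 4
    + 320 * a * b ^ 4 * c ^ 3 * d - a * b ^ 4 * c ^ 2 * d ^ 2 - 2 * a * b ^ 4 * c * d ^ 3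
    - a * b ^ 4 * d ^ 4 - 373 * a * b ^ 3 * c ^ 5 + 2 * a * b ^ 3 * c ^ 4 * d
    - 2 * a * b ^ 3 * c ^ 2 * d ^ 3 + 3 * a * b ^ 3 * c * d ^ 4 - 4 * a * b ^ 3 * d ^ 5
    - 289 * a * b ^ 2 * c ^ 6 - 3 * a * b ^ 2 * c ^ 5 * d + a * b ^ 2 * c ^ 4 * d ^ 2
    - a * b ^ 2 * c ^ 3 * d ^ 3 + 3 * a * b ^ 2 * c ^ 2 * d ^ 4 - 3 * a * b ^ 2 * c * d ^ 5
    + a * b ^ 2 * d ^ 6 - 213 * a * b * c ^ 7 - 4 * a * b * c ^ 6 * d + 4 * a * b * c ^ 5 * d ^ 2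
    - a * b * c ^ 2 * d ^ 5 - a * b * c * d ^ 6 + a * b * d ^ 7 + 268 * a * c ^ 8
    - 207 * a * c ^ 7 * d - a * c ^ 5 * d ^ 3 - a * c ^ 4 * d ^ 4 - 195 * a * c ^ 3 * d ^ 5
    + a * c * d ^ 7 - 2 * a * d ^ 8 + b ^ 8 * c - b ^ 8 * d + b ^ 7 * c ^ 2 - 112 * b ^ 6 * c ^ 3
    - 3 * b ^ 6 * c ^ 2 * d - b ^ 6 * c * d ^ 2 + b ^ 6 * d ^ 3 + 295 * b ^ 5 * c ^ 4
    + 365 * b ^ 5 * c ^ 3 * d - b ^ 5 * c ^ 2 * d ^ 2 - b ^ 4 * c ^ 3 * d ^ 2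
    + b ^ 4 * c ^ 2 * d ^ 3 + 420 * b ^ 3 * c ^ 6 - b ^ 3 * c ^ 5 * d - b ^ 3 * c ^ 4 * d ^ 2
    + 2 * b ^ 3 * c ^ 2 * d ^ 4 - 3 * b ^ 3 * c * d ^ 5 + 118 * b ^ 2 * c ^ 7
    - 2 * b ^ 2 * c ^ 6 * d + 2 * b ^ 2 * c ^ 5 * d ^ 2 + b ^ 2 * c ^ 3 * d ^ 4
    - 3 * b ^ 2 * c ^ 2 * d ^ 5 + 2 * b ^ 2 * c * d ^ 6 + 268 * b * c ^ 8 + 2 * b * c ^ 6 * d ^ 2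
    - b * c ^ 5 * d ^ 3 - b * c ^ 3 * d ^ 5 + b * c ^ 2 * d ^ 6 - 101 * c ^ 9 - 268 * c ^ 8 * d
    - 83 * c ^ 3 * d ^ 6) * hp

theorem GCrit.pow_nine_eq_zero_of_792 {k : Type*} [CommRing k] (hp : (3449 : k) = 0) {a b c d : k}
    (h : GCrit (792) a b c d) : c ^ 9 = 0 := by
  linear_combination (1464 * a ^ 6 - 577 * a ^ 5 * b - 1376 * a ^ 5 * c - 1387 * a ^ 5 * d
    - 610 * a ^ 4 * b ^ 2 - 713 * a ^ 4 * b * c + 525 * a ^ 4 * b * d - 1071 * a ^ 4 * c ^ 2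
    - 1324 * a ^ 4 * c * d - 394 * a ^ 4 * d ^ 2 - 680 * a ^ 3 * b ^ 3 - 1412 * a ^ 3 * b ^ 2 * c
    + 1311 * a ^ 3 * b ^ 2 * d - 770 * a ^ 3 * b * c ^ 2 - 870 * a ^ 3 * b * c * d
    - 1316 * a ^ 3 * b * d ^ 2 - 613 * a ^ 3 * c ^ 3 + 95 * a ^ 3 * c ^ 2 * d
    - 1121 * a ^ 3 * c * d ^ 2 + 551 * a ^ 3 * d ^ 3 + 925 * a ^ 2 * b ^ 4
    - 445 * a ^ 2 * b ^ 3 * c + 1125 * a ^ 2 * b ^ 3 * d - 40 * a ^ 2 * b ^ 2 * c ^ 2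
    + 1094 * a ^ 2 * b ^ 2 * c * d - 696 * a ^ 2 * b ^ 2 * d ^ 2 - 1662 * a ^ 2 * b * c ^ 3
    - 416 * a ^ 2 * b * c ^ 2 * d + 408 * a ^ 2 * b * c * d ^ 2 - 1124 * a ^ 2 * b * d ^ 3
    + 1434 * a ^ 2 * c ^ 4 + 870 * a ^ 2 * c ^ 3 * d + 791 * a ^ 2 * c ^ 2 * d ^ 2
    - 818 * a ^ 2 * c * d ^ 3 - 186 * a ^ 2 * d ^ 4 + 711 * a * b ^ 5 + 1345 * a * b ^ 4 * c
    + 279 * a * b ^ 4 * d - 393 * a * b ^ 3 * c ^ 2 - 668 * a * b ^ 3 * c * d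
    + 1107 * a * b ^ 3 * d ^ 2 - 78 * a * b ^ 2 * c ^ 3 - 1103 * a * b ^ 2 * c ^ 2 * d
    - 991 * a * b ^ 2 * c * d ^ 2 - 292 * a * b ^ 2 * d ^ 3 - 1506 * a * b * c ^ 4
    + 995 * a * b * c ^ 3 * d - 716 * a * b * c ^ 2 * d ^ 2 - 332 * a * b * c * d ^ 3
    + 1010 * a * b * d ^ 4 - 106 * a * c ^ 5 - 794 * a * c ^ 4 * d - 309 * a * c ^ 3 * d ^ 2
    - 91 * a * c ^ 2 * d ^ 3 - 1493 * a * c * d ^ 4 + 767 * a * d ^ 5 - 1164 * b ^ 6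
    - 1244 * b ^ 5 * c + 346 * b ^ 5 * d + 890 * b ^ 4 * c ^ 2 - 1376 * b ^ 4 * c * d
    + 457 * b ^ 4 * d ^ 2 + 768 * b ^ 3 * c ^ 3 + 351 * b ^ 3 * c ^ 2 * d + 83 * b ^ 3 * c * d ^ 2
    - 109 * b ^ 3 * d ^ 3 - 1262 * b ^ 2 * c ^ 4 - 832 * b ^ 2 * c ^ 3 * d
    + 1087 * b ^ 2 * c ^ 2 * d ^ 2 - 912 * b ^ 2 * c * d ^ 3 - 1560 * b ^ 2 * d ^ 4
    + 1363 * b * c ^ 5 - 316 * b * c ^ 4 * d + 1552 * b * c ^ 3 * d ^ 2 - 118 * b * c ^ 2 * d ^ 3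
    - 456 * b * c * d ^ 4 - 894 * b * d ^ 5 + 1301 * c ^ 6 - 1595 * c ^ 5 * d
    + 1670 * c ^ 4 * d ^ 2 + 1670 * c ^ 3 * d ^ 3 + 1670 * c ^ 2 * d ^ 4
    - 447 * c * d ^ 5) * h.eq₀ + (17 * a ^ 6 + 1238 * a ^ 5 * b + 1505 * a ^ 5 * c
    + 29 * a ^ 5 * d + 1577 * a ^ 4 * b ^ 2 + 335 * a ^ 4 * b * c - 1418 * a ^ 4 * b * d
    + 48 * a ^ 4 * c ^ 2 + 641 * a ^ 4 * c * d - 1219 * a ^ 4 * d ^ 2 + 1021 * a ^ 3 * b ^ 3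
    + 439 * a ^ 3 * b ^ 2 * c - 558 * a ^ 3 * b ^ 2 * d + 1320 * a ^ 3 * b * c ^ 2
    + 145 * a ^ 3 * b * c * d - 507 * a ^ 3 * b * d ^ 2 + 831 * a ^ 3 * c ^ 3
    + 791 * a ^ 3 * c ^ 2 * d + 648 * a ^ 3 * d ^ 3 + 824 * a ^ 2 * b ^ 4
    - 935 * a ^ 2 * b ^ 3 * c - 1235 * a ^ 2 * b ^ 3 * d - 1387 * a ^ 2 * b ^ 2 * c ^ 2
    - 839 * a ^ 2 * b ^ 2 * c * d - 1499 * a ^ 2 * b ^ 2 * d ^ 2 + 1334 * a ^ 2 * b * c ^ 3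
    - 891 * a ^ 2 * b * c ^ 2 * d + 1465 * a ^ 2 * b * d ^ 3 - 656 * a ^ 2 * c ^ 4
    + 1020 * a ^ 2 * c ^ 3 * d + 1391 * a ^ 2 * d ^ 4 - 1002 * a * b ^ 5 + 862 * a * b ^ 4 * c
    - 434 * a * b ^ 4 * d - 114 * a * b ^ 3 * c ^ 2 + 1606 * a * b ^ 3 * c * d
    - 487 * a * b ^ 3 * d ^ 2 - 715 * a * b ^ 2 * c ^ 3 - 925 * a * b ^ 2 * c ^ 2 * d
    - 1095 * a * b ^ 2 * d ^ 3 + 642 * a * b * c ^ 4 - 716 * a * b * c ^ 3 * d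
    - 43 * a * b * d ^ 4 - 1633 * a * c ^ 5 - 739 * a * c ^ 4 * d + 711 * a * d ^ 5
    - 1002 * b ^ 5 * c + 1002 * b ^ 5 * d + 38 * b ^ 4 * c ^ 2 + 69 * b ^ 4 * c * d
    + 895 * b ^ 4 * d ^ 2 + 51 * b ^ 3 * c ^ 3 - 659 * b ^ 3 * c ^ 2 * d + 557 * b ^ 3 * d ^ 3
    + 294 * b ^ 2 * c ^ 4 - 168 * b ^ 2 * c ^ 3 * d - 1560 * b ^ 2 * d ^ 4 - 1388 * b * c ^ 5
    - 279 * b * c ^ 4 * d - 447 * b * d ^ 5 + 1409 * c ^ 6 + 1035 * c ^ 5 * d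
    - 447 * d ^ 6) * h.eq₁ + (38 * a ^ 6 - 624 * a ^ 5 * b + 639 * a ^ 5 * c - 1364 * a ^ 5 * d
    - 1709 * a ^ 4 * b ^ 2 - 339 * a ^ 4 * b * c + 320 * a ^ 4 * b * d + 1505 * a ^ 4 * c ^ 2
    - 639 * a ^ 4 * c * d + 1269 * a ^ 4 * d ^ 2 + 616 * a ^ 3 * b ^ 3 - 95 * a ^ 3 * b ^ 2 * c
    + 291 * a ^ 3 * b ^ 2 * d + 354 * a ^ 3 * b * c ^ 2 + 1207 * a ^ 3 * b * c * d
    + 86 * a ^ 3 * c ^ 3 - 886 * a ^ 3 * c ^ 2 * d + 358 * a ^ 3 * d ^ 3 + 754 * a ^ 2 * b ^ 4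
    + 634 * a ^ 2 * b ^ 3 * c + 873 * a ^ 2 * b ^ 3 * d + 258 * a ^ 2 * b ^ 2 * c ^ 2
    + 763 * a ^ 2 * b ^ 2 * c * d + 1675 * a ^ 2 * b * c ^ 3 + 936 * a ^ 2 * c ^ 4
    - 86 * a ^ 2 * c ^ 3 * d - 178 * a ^ 2 * d ^ 4 - 469 * a * b ^ 5 - 32 * a * b ^ 4 * c
    + 1395 * a * b ^ 4 * d + 1578 * a * b ^ 3 * c ^ 2 - 906 * a * b ^ 2 * c ^ 3
    + 706 * a * b * c ^ 4 - 1219 * a * c ^ 5 + 1064 * a * c ^ 4 * d + 711 * a * d ^ 5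
    - 281 * b ^ 6 - 1117 * b ^ 5 * c - b ^ 5 * d + 1679 * b ^ 3 * c ^ 3 - 230 * b ^ 2 * c ^ 4
    - 1219 * b * c ^ 5 - 179 * c ^ 6 + 1219 * c ^ 5 * d - 447 * d ^ 6) * h.eq₂ + (-987 * a ^ 6
    + 1316 * a ^ 5 * b - 371 * a ^ 5 * c - 51 * a ^ 5 * d - 1007 * a ^ 4 * b ^ 2
    - 492 * a ^ 4 * b * c - 751 * a ^ 4 * b * d - 1160 * a ^ 4 * c * d + 498 * a ^ 4 * d ^ 2
    + 1675 * a ^ 3 * b ^ 3 - 1180 * a ^ 3 * b ^ 2 * c + 1151 * a ^ 3 * b ^ 2 * d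
    - 675 * a ^ 3 * b * c ^ 2 + 347 * a ^ 3 * b * c * d - 1626 * a ^ 3 * c ^ 3
    + 1373 * a ^ 3 * d ^ 3 - 144 * a ^ 2 * b ^ 4 + 708 * a ^ 2 * b ^ 3 * c
    - 76 * a ^ 2 * b ^ 3 * d - 1311 * a ^ 2 * b ^ 2 * c ^ 2 - 482 * a ^ 2 * b ^ 2 * c * d
    - 982 * a ^ 2 * d ^ 4 + 1285 * a * b ^ 5 + 368 * a * b ^ 4 * c + 149 * a * d ^ 5) * h.eq₃
    - (2 * a ^ 9 + a ^ 8 * b + a ^ 8 * c - 3 * a ^ 8 * d - a ^ 7 * b ^ 2 + a ^ 7 * b * c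
    - 4 * a ^ 7 * b * d - 5 * a ^ 7 * c * d + a ^ 7 * d ^ 2 - 2 * a ^ 6 * b ^ 3
    - 2 * a ^ 6 * b ^ 2 * c + 3 * a ^ 6 * b ^ 2 * d - 4 * a ^ 6 * b * c * d
    + 2 * a ^ 6 * b * d ^ 2 - 9 * a ^ 6 * c ^ 3 - a ^ 6 * c ^ 2 * d + 3 * a ^ 6 * c * d ^ 2
    - a ^ 6 * d ^ 3 + a ^ 5 * b ^ 4 - 2 * a ^ 5 * b ^ 3 * c + 2 * a ^ 5 * b ^ 3 * d
    + 4 * a ^ 5 * b ^ 2 * c * d - 4 * a ^ 5 * b ^ 2 * d ^ 2 + 143 * a ^ 5 * b * c ^ 3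
    - 3 * a ^ 5 * b * c ^ 2 * d + 2 * a ^ 5 * b * d ^ 3 - 144 * a ^ 5 * c ^ 4
    + 315 * a ^ 5 * c ^ 3 * d + a ^ 5 * c ^ 2 * d ^ 2 + a ^ 5 * c * d ^ 3 - a ^ 5 * d ^ 4
    + 2 * a ^ 4 * b ^ 5 + a ^ 4 * b ^ 4 * c + a ^ 4 * b ^ 4 * d - a ^ 4 * b ^ 3 * c ^ 2
    + 5 * a ^ 4 * b ^ 3 * c * d - 3 * a ^ 4 * b ^ 3 * d ^ 2 + 392 * a ^ 4 * b ^ 2 * c ^ 3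
    - a ^ 4 * b ^ 2 * c ^ 2 * d - 4 * a ^ 4 * b ^ 2 * c * d ^ 2 + 79 * a ^ 4 * b * c ^ 4
    - 74 * a ^ 4 * b * c ^ 3 * d + a ^ 4 * b * c ^ 2 * d ^ 2 + a ^ 4 * b * c * d ^ 3
    + a ^ 4 * b * d ^ 4 - 344 * a ^ 4 * c ^ 5 + 145 * a ^ 4 * c ^ 4 * d
    - 292 * a ^ 4 * c ^ 3 * d ^ 2 - 3 * a ^ 4 * c * d ^ 4 + 2 * a ^ 4 * d ^ 5 - a ^ 3 * b ^ 6
    - a ^ 3 * b ^ 5 * d + 3 * a ^ 3 * b ^ 4 * c ^ 2 - a ^ 3 * b ^ 4 * c * d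
    - 2 * a ^ 3 * b ^ 4 * d ^ 2 - 140 * a ^ 3 * b ^ 3 * c ^ 3 + 2 * a ^ 3 * b ^ 3 * c ^ 2 * d
    - 6 * a ^ 3 * b ^ 3 * c * d ^ 2 + 4 * a ^ 3 * b ^ 3 * d ^ 3 + 20 * a ^ 3 * b ^ 2 * c ^ 4
    - 68 * a ^ 3 * b ^ 2 * c ^ 3 * d - a ^ 3 * b ^ 2 * c ^ 2 * d ^ 2 - a ^ 3 * b ^ 2 * c * d ^ 3
    + a ^ 3 * b ^ 2 * d ^ 4 - 80 * a ^ 3 * b * c ^ 5 - 278 * a ^ 3 * b * c ^ 4 * d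
    + 2 * a ^ 3 * b * c ^ 3 * d ^ 2 - 3 * a ^ 3 * b * c ^ 2 * d ^ 3 + a ^ 3 * b * c * d ^ 4
    - a ^ 3 * b * d ^ 5 - 19 * a ^ 3 * c ^ 6 + 202 * a ^ 3 * c ^ 5 * d
    - 83 * a ^ 3 * c ^ 3 * d ^ 3 + a ^ 3 * c ^ 2 * d ^ 4 + a ^ 3 * c * d ^ 5 + a ^ 3 * d ^ 6
    - a ^ 2 * b ^ 7 - 4 * a ^ 2 * b ^ 6 * c + 2 * a ^ 2 * b ^ 6 * d - 3 * a ^ 2 * b ^ 5 * d ^ 2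
    - 169 * a ^ 2 * b ^ 4 * c ^ 3 - 4 * a ^ 2 * b ^ 4 * c ^ 2 * d + a ^ 2 * b ^ 4 * c * d ^ 2
    - 147 * a ^ 2 * b ^ 3 * c ^ 4 - 202 * a ^ 2 * b ^ 3 * c ^ 3 * d
    + 2 * a ^ 2 * b ^ 3 * c * d ^ 3 - 61 * a ^ 2 * b ^ 2 * c ^ 5 - 173 * a ^ 2 * b ^ 2 * c ^ 4 * d
    + 3 * a ^ 2 * b ^ 2 * c ^ 3 * d ^ 2 - 3 * a ^ 2 * b ^ 2 * c ^ 2 * d ^ 3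
    - 384 * a ^ 2 * b * c ^ 6 + a ^ 2 * b * c ^ 5 * d + 3 * a ^ 2 * b * c ^ 4 * d ^ 2
    - a ^ 2 * b * c ^ 3 * d ^ 3 + 2 * a ^ 2 * b * c ^ 2 * d ^ 4 - 2 * a ^ 2 * b * d ^ 6
    - 213 * a ^ 2 * c ^ 7 + 19 * a ^ 2 * c ^ 6 * d + a ^ 2 * c ^ 5 * d ^ 2 + a ^ 2 * c ^ 4 * d ^ 3
    + 41 * a ^ 2 * c ^ 3 * d ^ 4 - a ^ 2 * c * d ^ 6 - a ^ 2 * d ^ 7 - a * b ^ 8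
    - 2 * a * b ^ 7 * c + a * b ^ 7 * d - 3 * a * b ^ 6 * c ^ 2 + 7 * a * b ^ 6 * c * d
    - a * b ^ 6 * d ^ 2 + 109 * a * b ^ 5 * c ^ 3 - 2 * a * b ^ 5 * c ^ 2 * d
    + a * b ^ 5 * c * d ^ 2 + a * b ^ 5 * d ^ 3 + 9 * a * b ^ 4 * c ^ 4
    - 325 * a * b ^ 4 * c ^ 3 * d + 3 * a * b ^ 4 * c ^ 2 * d ^ 2 - 2 * a * b ^ 4 * c * d ^ 3
    - 364 * a * b ^ 3 * c ^ 5 - a * b ^ 3 * c ^ 4 * d + 3 * a * b ^ 3 * c ^ 3 * d ^ 2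
    - 2 * a * b ^ 3 * c ^ 2 * d ^ 3 - a * b ^ 3 * c * d ^ 4 + 3 * a * b ^ 3 * d ^ 5
    + 207 * a * b ^ 2 * c ^ 6 + 2 * a * b ^ 2 * c ^ 5 * d + 4 * a * b ^ 2 * c ^ 4 * d ^ 2
    - 2 * a * b ^ 2 * c ^ 3 * d ^ 3 + 2 * a * b ^ 2 * c * d ^ 5 + a * b ^ 2 * d ^ 6
    - 160 * a * b * c ^ 7 - a * b * c ^ 6 * d + 2 * a * b * c ^ 5 * d ^ 2 - a * b * c ^ 4 * d ^ 3
    - a * b * c ^ 3 * d ^ 4 - a * b * c ^ 2 * d ^ 5 + a * b * d ^ 7 + 280 * a * c ^ 8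
    - 246 * a * c ^ 7 * d + a * c ^ 6 * d ^ 2 - a * c ^ 5 * d ^ 3 - 2 * a * c ^ 4 * d ^ 4
    - 165 * a * c ^ 3 * d ^ 5 - a * c ^ 2 * d ^ 6 + a * c * d ^ 7 - b ^ 8 * c + b ^ 8 * d
    - b ^ 7 * c ^ 2 + 2 * b ^ 7 * c * d + 64 * b ^ 6 * c ^ 3 + 2 * b ^ 6 * c ^ 2 * d
    - b ^ 6 * c * d ^ 2 + 257 * b ^ 5 * c ^ 4 - b ^ 5 * c ^ 3 * d + b ^ 5 * c ^ 2 * d ^ 2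
    - b ^ 5 * c * d ^ 3 - b ^ 5 * d ^ 4 - b ^ 4 * c ^ 5 - 2 * b ^ 4 * c ^ 4 * d
    + 2 * b ^ 4 * c ^ 3 * d ^ 2 - b ^ 4 * c ^ 2 * d ^ 3 - 384 * b ^ 3 * c ^ 6 + b ^ 3 * c ^ 5 * d
    + b ^ 3 * c ^ 4 * d ^ 2 - 2 * b ^ 3 * c ^ 3 * d ^ 3 + 2 * b ^ 3 * c * d ^ 5
    + 53 * b ^ 2 * c ^ 7 + 2 * b ^ 2 * c ^ 5 * d ^ 2 - 2 * b ^ 2 * c ^ 4 * d ^ 3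
    + b ^ 2 * c ^ 3 * d ^ 4 + 280 * b * c ^ 8 - 2 * b * c ^ 7 * d + b * c ^ 6 * d ^ 2
    - 2 * b * c ^ 5 * d ^ 3 - b * c ^ 3 * d ^ 5 + b * c ^ 2 * d ^ 6 + 41 * c ^ 9 - 280 * c ^ 8 * d
    + c ^ 7 * d ^ 2 - c ^ 6 * d ^ 3 + 103 * c ^ 3 * d ^ 6) * hp

theorem GCrit.pow_nine_eq_zero_of_neg_753 {k : Type*} [CommRing k] (hp : (3449 : k) = 0) {a b c d : k}
    (h : GCrit (-753) a b c d) : c ^ 9 = 0 := by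
  linear_combination (-107 * a ^ 6 - 970 * a ^ 5 * b + 755 * a ^ 5 * c + 1019 * a ^ 5 * d
    - 1371 * a ^ 4 * b ^ 2 + 57 * a ^ 4 * b * c + 159 * a ^ 4 * b * d - 1273 * a ^ 4 * c ^ 2
    - 280 * a ^ 4 * c * d - 139 * a ^ 4 * d ^ 2 - 127 * a ^ 3 * b ^ 3 - 11 * a ^ 3 * b ^ 2 * c
    + 1465 * a ^ 3 * b ^ 2 * d + 918 * a ^ 3 * b * c ^ 2 + 1445 * a ^ 3 * b * c * d
    + 1546 * a ^ 3 * b * d ^ 2 - 226 * a ^ 3 * c ^ 3 - 1329 * a ^ 3 * c ^ 2 * d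
    - 303 * a ^ 3 * c * d ^ 2 + 512 * a ^ 3 * d ^ 3 + 696 * a ^ 2 * b ^ 4
    - 1589 * a ^ 2 * b ^ 3 * c + 124 * a ^ 2 * b ^ 3 * d - 705 * a ^ 2 * b ^ 2 * c ^ 2
    - 1570 * a ^ 2 * b ^ 2 * c * d + 30 * a ^ 2 * b ^ 2 * d ^ 2 - 1064 * a ^ 2 * b * c ^ 3
    - 1676 * a ^ 2 * b * c ^ 2 * d - 183 * a ^ 2 * b * c * d ^ 2 - 1527 * a ^ 2 * b * d ^ 3
    + 1253 * a ^ 2 * c ^ 4 + 1073 * a ^ 2 * c ^ 3 * d + 877 * a ^ 2 * c ^ 2 * d ^ 2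
    + 116 * a ^ 2 * c * d ^ 3 + 25 * a ^ 2 * d ^ 4 + 1416 * a * b ^ 5 + 503 * a * b ^ 4 * c
    - 1650 * a * b ^ 4 * d + 1005 * a * b ^ 3 * c ^ 2 + 1032 * a * b ^ 3 * c * d
    - 1200 * a * b ^ 3 * d ^ 2 + 453 * a * b ^ 2 * c ^ 3 + 126 * a * b ^ 2 * c ^ 2 * d
    - 1403 * a * b ^ 2 * c * d ^ 2 + 476 * a * b ^ 2 * d ^ 3 + 409 * a * b * c ^ 4
    - 553 * a * b * c ^ 3 * d - 1032 * a * b * c ^ 2 * d ^ 2 - 354 * a * b * c * d ^ 3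
    - 1227 * a * b * d ^ 4 - 760 * a * c ^ 5 + 219 * a * c ^ 4 * d + 460 * a * c ^ 3 * d ^ 2
    - 1455 * a * c ^ 2 * d ^ 3 - 134 * a * c * d ^ 4 - 770 * a * d ^ 5 - 735 * b ^ 6
    - 1693 * b ^ 5 * c - 194 * b ^ 5 * d - 557 * b ^ 4 * c ^ 2 + 318 * b ^ 4 * c * d
    - 1564 * b ^ 4 * d ^ 2 - 1530 * b ^ 3 * c ^ 3 + 499 * b ^ 3 * c ^ 2 * d
    - 295 * b ^ 3 * c * d ^ 2 - 767 * b ^ 3 * d ^ 3 + 591 * b ^ 2 * c ^ 4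
    + 306 * b ^ 2 * c ^ 3 * d + 631 * b ^ 2 * c ^ 2 * d ^ 2 - 1666 * b ^ 2 * c * d ^ 3
    + 478 * b ^ 2 * d ^ 4 - 964 * b * c ^ 5 + 1402 * b * c ^ 4 * d + 1019 * b * c ^ 3 * d ^ 2
    - 322 * b * c ^ 2 * d ^ 3 - 833 * b * c * d ^ 4 + 893 * b * d ^ 5 - 1405 * c ^ 6
    + 955 * c ^ 5 * d + 1341 * c ^ 4 * d ^ 2 + 1341 * c ^ 3 * d ^ 3 + 1341 * c ^ 2 * d ^ 4
    - 1278 * c * d ^ 5) * h.eq₀ + (161 * a ^ 6 + 1073 * a ^ 5 * b - 960 * a ^ 5 * c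
    + 1552 * a ^ 5 * d + 804 * a ^ 4 * b ^ 2 - 778 * a ^ 4 * b * c + 1083 * a ^ 4 * b * d
    + 1438 * a ^ 4 * c ^ 2 - 725 * a ^ 4 * c * d - 671 * a ^ 4 * d ^ 2 + 1353 * a ^ 3 * b ^ 3
    - 604 * a ^ 3 * b ^ 2 * c - 1687 * a ^ 3 * b ^ 2 * d - 825 * a ^ 3 * b * c ^ 2
    + 349 * a ^ 3 * b * c * d + 83 * a ^ 3 * b * d ^ 2 + 282 * a ^ 3 * c ^ 3
    - 1204 * a ^ 3 * c ^ 2 * d + 1065 * a ^ 3 * d ^ 3 + 803 * a ^ 2 * b ^ 4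
    - 1315 * a ^ 2 * b ^ 3 * c - 1380 * a ^ 2 * b ^ 3 * d + 1360 * a ^ 2 * b ^ 2 * c ^ 2
    - 457 * a ^ 2 * b ^ 2 * c * d + 917 * a ^ 2 * b ^ 2 * d ^ 2 - 88 * a ^ 2 * b * c ^ 3
    + 156 * a ^ 2 * b * c ^ 2 * d - 91 * a ^ 2 * b * d ^ 3 + 456 * a ^ 2 * c ^ 4
    - 1587 * a ^ 2 * c ^ 3 * d - 1237 * a ^ 2 * d ^ 4 + 1178 * a * b ^ 5 + 1672 * a * b ^ 4 * c
    - 255 * a * b ^ 4 * d - 1397 * a * b ^ 3 * c ^ 2 - 29 * a * b ^ 3 * c * d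
    - 565 * a * b ^ 3 * d ^ 2 + 524 * a * b ^ 2 * c ^ 3 + 1343 * a * b ^ 2 * c ^ 2 * d
    - 1349 * a * b ^ 2 * d ^ 3 + 390 * a * b * c ^ 4 - 1341 * a * b * c ^ 3 * d
    + 1018 * a * b * d ^ 4 + 356 * a * c ^ 5 - 113 * a * c ^ 4 * d - 746 * a * d ^ 5
    + 1178 * b ^ 5 * c - 1178 * b ^ 5 * d + 869 * b ^ 4 * c ^ 2 + 1243 * b ^ 4 * c * d
    + 159 * b ^ 4 * d ^ 2 + 266 * b ^ 3 * c ^ 3 + 934 * b ^ 3 * c ^ 2 * d - 352 * b ^ 3 * d ^ 3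
    - 932 * b ^ 2 * c ^ 4 + 583 * b ^ 2 * c ^ 3 * d + 478 * b ^ 2 * d ^ 4 + 815 * b * c ^ 5
    - 1719 * b * c ^ 4 * d - 1278 * b * d ^ 5 + 113 * c ^ 6 + 1403 * c ^ 5 * d
    - 1278 * d ^ 6) * h.eq₁ + (907 * a ^ 6 + 497 * a ^ 5 * b + 885 * a ^ 5 * c + 1462 * a ^ 5 * d
    - 911 * a ^ 4 * b ^ 2 + 1458 * a ^ 4 * b * c + 1006 * a ^ 4 * b * d + 1258 * a ^ 4 * c ^ 2
    - 885 * a ^ 4 * c * d - 272 * a ^ 4 * d ^ 2 - 161 * a ^ 3 * b ^ 3 + 1516 * a ^ 3 * b ^ 2 * c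
    - 1187 * a ^ 3 * b ^ 2 * d + 1045 * a ^ 3 * b * c ^ 2 - 782 * a ^ 3 * b * c * d
    + 1032 * a ^ 3 * c ^ 3 - 1620 * a ^ 3 * c ^ 2 * d - 125 * a ^ 3 * d ^ 3 + 286 * a ^ 2 * b ^ 4
    - 543 * a ^ 2 * b ^ 3 * c - 1458 * a ^ 2 * b ^ 3 * d - 490 * a ^ 2 * b ^ 2 * c ^ 2
    - 204 * a ^ 2 * b ^ 2 * c * d - 1190 * a ^ 2 * b * c ^ 3 + 938 * a ^ 2 * c ^ 4
    - 1032 * a ^ 2 * c ^ 3 * d - 314 * a ^ 2 * d ^ 4 - 317 * a * b ^ 5 - 126 * a * b ^ 4 * c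
    - 243 * a * b ^ 4 * d - 1230 * a * b ^ 3 * c ^ 2 + 946 * a * b ^ 2 * c ^ 3
    - 19 * a * b * c ^ 4 - 1017 * a * c ^ 5 + 537 * a * c ^ 4 * d - 746 * a * d ^ 5 - 1621 * b ^ 6
    + 690 * b ^ 5 * c + 1605 * b ^ 5 * d - 518 * b ^ 3 * c ^ 3 - 957 * b ^ 2 * c ^ 4
    - 1017 * b * c ^ 5 - 201 * c ^ 6 + 1017 * c ^ 5 * d - 1278 * d ^ 6) * h.eq₂ + (640 * a ^ 6
    + 1513 * a ^ 5 * b - 876 * a ^ 5 * c + 1186 * a ^ 5 * d + 1047 * a ^ 4 * b ^ 2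
    - 1219 * a ^ 4 * b * c + 1359 * a ^ 4 * b * d + 693 * a ^ 4 * c * d - 248 * a ^ 4 * d ^ 2
    - 1307 * a ^ 3 * b ^ 3 + 951 * a ^ 3 * b ^ 2 * c - 103 * a ^ 3 * b ^ 2 * d
    - 307 * a ^ 3 * b * c ^ 2 + 993 * a ^ 3 * b * c * d - 170 * a ^ 3 * c ^ 3
    + 1027 * a ^ 3 * d ^ 3 - 944 * a ^ 2 * b ^ 4 + 842 * a ^ 2 * b ^ 3 * c
    + 1177 * a ^ 2 * b ^ 3 * d - 1120 * a ^ 2 * b ^ 2 * c ^ 2 - 1350 * a ^ 2 * b ^ 2 * c * d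
    + 418 * a ^ 2 * d ^ 4 + 707 * a * b ^ 5 - 1409 * a * b ^ 4 * c + 426 * a * d ^ 5) * h.eq₃
    - (-a ^ 8 * b + a ^ 8 * c + a ^ 8 * d - 3 * a ^ 7 * b ^ 2 + a ^ 7 * b * c + a ^ 7 * b * d
    - 3 * a ^ 7 * d ^ 2 - 2 * a ^ 6 * b ^ 3 - a ^ 6 * b ^ 2 * c + 3 * a ^ 6 * b ^ 2 * d
    + 3 * a ^ 6 * b * c ^ 2 + a ^ 6 * b * c * d - 2 * a ^ 6 * b * d ^ 2 + 199 * a ^ 6 * c ^ 3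
    - 5 * a ^ 6 * c ^ 2 * d - 3 * a ^ 6 * c * d ^ 2 + 3 * a ^ 6 * d ^ 3 + 2 * a ^ 5 * b ^ 4
    - 4 * a ^ 5 * b ^ 3 * c + 2 * a ^ 5 * b ^ 3 * d + 2 * a ^ 5 * b ^ 2 * c ^ 2
    - a ^ 5 * b ^ 2 * c * d + 109 * a ^ 5 * b * c ^ 3 - 9 * a ^ 5 * b * c ^ 2 * d
    - a ^ 5 * b * c * d ^ 2 + a ^ 5 * b * d ^ 3 + 196 * a ^ 5 * c ^ 4 + 317 * a ^ 5 * c ^ 3 * d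
    + 5 * a ^ 5 * c ^ 2 * d ^ 2 + 4 * a ^ 4 * b ^ 5 + a ^ 4 * b ^ 4 * c - 5 * a ^ 4 * b ^ 4 * d
    - a ^ 4 * b ^ 3 * d ^ 2 - 198 * a ^ 4 * b ^ 2 * c ^ 3 - 5 * a ^ 4 * b ^ 2 * c ^ 2 * d
    + 3 * a ^ 4 * b ^ 2 * c * d ^ 2 - 3 * a ^ 4 * b ^ 2 * d ^ 3 + 321 * a ^ 4 * b * c ^ 4
    + 214 * a ^ 4 * b * c ^ 3 * d + 3 * a ^ 4 * b * c ^ 2 * d ^ 2 - 5 * a ^ 4 * b * c * d ^ 3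
    + a ^ 4 * b * d ^ 4 + 276 * a ^ 4 * c ^ 5 - 197 * a ^ 4 * c ^ 4 * d
    - 54 * a ^ 4 * c ^ 3 * d ^ 2 - 2 * a ^ 4 * c ^ 2 * d ^ 3 - a ^ 4 * c * d ^ 4 - a ^ 4 * d ^ 5
    + a ^ 3 * b ^ 6 + 3 * a ^ 3 * b ^ 5 * c - 7 * a ^ 3 * b ^ 5 * d - a ^ 3 * b ^ 4 * c ^ 2
    - 4 * a ^ 3 * b ^ 4 * c * d + a ^ 3 * b ^ 4 * d ^ 2 - 37 * a ^ 3 * b ^ 3 * c ^ 3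
    + 3 * a ^ 3 * b ^ 3 * c ^ 2 * d + 2 * a ^ 3 * b ^ 3 * c * d ^ 2 - 3 * a ^ 3 * b ^ 3 * d ^ 3
    + 333 * a ^ 3 * b ^ 2 * c ^ 4 - 263 * a ^ 3 * b ^ 2 * c ^ 3 * d
    + 3 * a ^ 3 * b ^ 2 * c ^ 2 * d ^ 2 - 3 * a ^ 3 * b ^ 2 * c * d ^ 3
    + 2 * a ^ 3 * b ^ 2 * d ^ 4 + 229 * a ^ 3 * b * c ^ 5 - 174 * a ^ 3 * b * c ^ 4 * d
    + 7 * a ^ 3 * b * c ^ 3 * d ^ 2 - 2 * a ^ 3 * b * c ^ 2 * d ^ 3 + a ^ 3 * b * c * d ^ 4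
    + a ^ 3 * b * d ^ 5 + 224 * a ^ 3 * c ^ 6 - 354 * a ^ 3 * c ^ 5 * d
    + 3 * a ^ 3 * c ^ 4 * d ^ 2 - 30 * a ^ 3 * c ^ 3 * d ^ 3 + a ^ 3 * c ^ 2 * d ^ 4
    - a ^ 3 * c * d ^ 5 + 2 * a ^ 3 * d ^ 6 - a ^ 2 * b ^ 7 - a ^ 2 * b ^ 6 * d
    + 3 * a ^ 2 * b ^ 5 * c ^ 2 - 8 * a ^ 2 * b ^ 5 * c * d + a ^ 2 * b ^ 5 * d ^ 2
    + 61 * a ^ 2 * b ^ 4 * c ^ 3 + 3 * a ^ 2 * b ^ 4 * c ^ 2 * d + a ^ 2 * b ^ 4 * d ^ 3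
    - 119 * a ^ 2 * b ^ 3 * c ^ 4 - 317 * a ^ 2 * b ^ 3 * c ^ 3 * d
    - 6 * a ^ 2 * b ^ 3 * c ^ 2 * d ^ 2 + a ^ 2 * b ^ 3 * c * d ^ 3 + 3 * a ^ 2 * b ^ 3 * d ^ 4
    - 108 * a ^ 2 * b ^ 2 * c ^ 5 - 45 * a ^ 2 * b ^ 2 * c ^ 4 * d
    + 2 * a ^ 2 * b ^ 2 * c ^ 3 * d ^ 2 - 4 * a ^ 2 * b ^ 2 * c ^ 2 * d ^ 3
    + a ^ 2 * b ^ 2 * c * d ^ 4 - a ^ 2 * b ^ 2 * d ^ 5 - 263 * a ^ 2 * b * c ^ 6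
    + 2 * a ^ 2 * b * c ^ 5 * d + 5 * a ^ 2 * b * c ^ 4 * d ^ 2 - 2 * a ^ 2 * b * c ^ 3 * d ^ 3
    + 3 * a ^ 2 * b * c ^ 2 * d ^ 4 - a ^ 2 * b * c * d ^ 5 + 2 * a ^ 2 * b * d ^ 6
    + 204 * a ^ 2 * c ^ 7 - 222 * a ^ 2 * c ^ 6 * d - a ^ 2 * c ^ 5 * d ^ 2
    - a ^ 2 * c ^ 4 * d ^ 3 - 67 * a ^ 2 * c ^ 3 * d ^ 4 - 2 * a ^ 2 * c ^ 2 * d ^ 5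
    + 2 * a ^ 2 * c * d ^ 6 + 2 * a ^ 2 * d ^ 7 - a * b ^ 7 * c + 2 * a * b ^ 7 * d
    - a * b ^ 6 * c ^ 2 + a * b ^ 6 * c * d - a * b ^ 6 * d ^ 2 - 69 * a * b ^ 5 * c ^ 3
    - a * b ^ 5 * c ^ 2 * d + 2 * a * b ^ 5 * d ^ 3 - 29 * a * b ^ 4 * c ^ 4
    - 50 * a * b ^ 4 * c ^ 3 * d - 3 * a * b ^ 4 * c ^ 2 * d ^ 2 + 2 * a * b ^ 4 * d ^ 4
    - 270 * a * b ^ 3 * c ^ 5 + 3 * a * b ^ 3 * c ^ 4 * d - 2 * a * b ^ 3 * c ^ 3 * d ^ 2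
    - a * b ^ 3 * c ^ 2 * d ^ 3 + 3 * a * b ^ 3 * c * d ^ 4 + 205 * a * b ^ 2 * c ^ 6
    + 3 * a * b ^ 2 * c ^ 5 * d - a * b ^ 2 * c ^ 3 * d ^ 3 + 2 * a * b ^ 2 * c ^ 2 * d ^ 4
    - a * b ^ 2 * d ^ 6 - 6 * a * b * c ^ 7 + 6 * a * b * c ^ 6 * d - a * b * c ^ 5 * d ^ 2
    - 3 * a * b * c ^ 4 * d ^ 3 + a * b * c ^ 3 * d ^ 4 - 3 * a * b * c ^ 2 * d ^ 5
    + 2 * a * b * c * d ^ 6 + a * b * d ^ 7 - 223 * a * c ^ 8 + 120 * a * c ^ 7 * d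
    - 2 * a * c ^ 6 * d ^ 2 - a * c ^ 5 * d ^ 3 - a * c ^ 4 * d ^ 4 - 166 * a * c ^ 3 * d ^ 5
    + a * c ^ 2 * d ^ 6 + 2 * a * c * d ^ 7 + 3 * b ^ 7 * c * d - b ^ 7 * d ^ 2
    - 355 * b ^ 6 * c ^ 3 + b ^ 6 * c ^ 2 * d - b ^ 6 * c * d ^ 2 + b ^ 6 * d ^ 3
    + 150 * b ^ 5 * c ^ 4 + 353 * b ^ 5 * c ^ 3 * d - 2 * b ^ 5 * c ^ 2 * d ^ 2
    + b ^ 4 * c ^ 4 * d - 2 * b ^ 4 * c ^ 3 * d ^ 2 + b ^ 4 * c * d ^ 4 - b ^ 4 * d ^ 5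
    - 114 * b ^ 3 * c ^ 6 + 3 * b ^ 3 * c ^ 5 * d - b ^ 3 * c ^ 4 * d ^ 2 - b ^ 3 * c ^ 3 * d ^ 3
    + 2 * b ^ 3 * c ^ 2 * d ^ 4 - b ^ 3 * c * d ^ 5 - b ^ 3 * d ^ 6 - 210 * b ^ 2 * c ^ 7
    + 2 * b ^ 2 * c ^ 6 * d - b ^ 2 * c ^ 5 * d ^ 2 + b ^ 2 * c ^ 3 * d ^ 4
    - b ^ 2 * c ^ 2 * d ^ 5 + b ^ 2 * d ^ 7 - 223 * b * c ^ 8 + 2 * b * c ^ 7 * d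
    - 2 * b * c ^ 6 * d ^ 2 - b * c ^ 5 * d ^ 3 - b * c ^ 3 * d ^ 5 + b * c ^ 2 * d ^ 6
    + b * c * d ^ 7 - 44 * c ^ 9 + 223 * c ^ 8 * d - c ^ 7 * d ^ 2 - 279 * c ^ 3 * d ^ 6) * hp

theorem GCrit.pow_nine_eq_zero_of_neg_362 {k : Type*} [CommRing k] (hp : (3449 : k) = 0) {a b c d : k}
    (h : GCrit (-362) a b c d) : c ^ 9 = 0 := by
  linear_combination (-1221 * a ^ 6 + 938 * a ^ 5 * b - 745 * a ^ 5 * c - 1200 * a ^ 5 * d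
    + 763 * a ^ 4 * b ^ 2 - 1240 * a ^ 4 * b * c + 1192 * a ^ 4 * b * d - 434 * a ^ 4 * c ^ 2
    - 1125 * a ^ 4 * c * d + 900 * a ^ 4 * d ^ 2 - 1599 * a ^ 3 * b ^ 3 + 1522 * a ^ 3 * b ^ 2 * c
    - 1199 * a ^ 3 * b ^ 2 * d + 1159 * a ^ 3 * b * c ^ 2 - 800 * a ^ 3 * b * c * d
    + 1385 * a ^ 3 * b * d ^ 2 - 1100 * a ^ 3 * c ^ 3 - 1662 * a ^ 3 * c ^ 2 * d
    + 298 * a ^ 3 * c * d ^ 2 - 537 * a ^ 3 * d ^ 3 - 178 * a ^ 2 * b ^ 4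
    - 1375 * a ^ 2 * b ^ 3 * c - 1242 * a ^ 2 * b ^ 3 * d + 667 * a ^ 2 * b ^ 2 * c ^ 2
    - 514 * a ^ 2 * b ^ 2 * c * d - 373 * a ^ 2 * b ^ 2 * d ^ 2 - 224 * a ^ 2 * b * c ^ 3
    - 578 * a ^ 2 * b * c ^ 2 * d - 1096 * a ^ 2 * b * c * d ^ 2 - 811 * a ^ 2 * b * d ^ 3
    - 671 * a ^ 2 * c ^ 4 - 1602 * a ^ 2 * c ^ 3 * d - 116 * a ^ 2 * c ^ 2 * d ^ 2
    - 1496 * a ^ 2 * c * d ^ 3 + 645 * a ^ 2 * d ^ 4 + 871 * a * b ^ 5 - 650 * a * b ^ 4 * c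
    + 1526 * a * b ^ 4 * d - 248 * a * b ^ 3 * c ^ 2 + 1549 * a * b ^ 3 * c * d
    - 1107 * a * b ^ 3 * d ^ 2 - 629 * a * b ^ 2 * c ^ 3 - 921 * a * b ^ 2 * c ^ 2 * d
    - 202 * a * b ^ 2 * c * d ^ 2 - 437 * a * b ^ 2 * d ^ 3 - 384 * a * b * c ^ 4
    - 653 * a * b * c ^ 3 * d + 1599 * a * b * c ^ 2 * d ^ 2 - 1081 * a * b * c * d ^ 3
    - 903 * a * b * d ^ 4 - 1540 * a * c ^ 5 - 1066 * a * c ^ 4 * d + 524 * a * c ^ 3 * d ^ 2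
    + 958 * a * c ^ 2 * d ^ 3 - 971 * a * c * d ^ 4 + 1427 * a * d ^ 5 + 496 * b ^ 6
    - 607 * b ^ 5 * c + 1008 * b ^ 5 * d + 1275 * b ^ 4 * c ^ 2 - 1324 * b ^ 4 * c * d
    - 171 * b ^ 4 * d ^ 2 - 877 * b ^ 3 * c ^ 3 - 623 * b ^ 3 * c ^ 2 * d
    + 1649 * b ^ 3 * c * d ^ 2 - 217 * b ^ 3 * d ^ 3 - 371 * b ^ 2 * c ^ 4
    + 948 * b ^ 2 * c ^ 3 * d - 932 * b ^ 2 * c ^ 2 * d ^ 2 + 296 * b ^ 2 * c * d ^ 3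
    - 1422 * b ^ 2 * d ^ 4 + 1357 * b * c ^ 5 - 1333 * b * c ^ 4 * d - 1565 * b * c ^ 3 * d ^ 2
    + 268 * b * c ^ 2 * d ^ 3 + 148 * b * c * d ^ 4 - 674 * b * d ^ 5 + 1022 * c ^ 6
    - 691 * c ^ 5 * d + 1616 * c ^ 4 * d ^ 2 + 1616 * c ^ 3 * d ^ 3 + 1616 * c ^ 2 * d ^ 4
    - 337 * c * d ^ 5) * h.eq₀ + (1117 * a ^ 6 - 1508 * a ^ 5 * b + 1466 * a ^ 5 * c
    + 1589 * a ^ 5 * d + 797 * a ^ 4 * b ^ 2 + 1253 * a ^ 4 * b * c + 492 * a ^ 4 * b * d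
    + 1507 * a ^ 4 * c ^ 2 - 66 * a ^ 4 * c * d - 1188 * a ^ 4 * d ^ 2 - 1479 * a ^ 3 * b ^ 3
    + 1101 * a ^ 3 * b ^ 2 * c + 1699 * a ^ 3 * b ^ 2 * d + 858 * a ^ 3 * b * c ^ 2
    - 1343 * a ^ 3 * b * c * d - 1083 * a ^ 3 * b * d ^ 2 - 554 * a ^ 3 * c ^ 3
    - 530 * a ^ 3 * c ^ 2 * d - 1564 * a ^ 3 * d ^ 3 + 733 * a ^ 2 * b ^ 4
    + 605 * a ^ 2 * b ^ 3 * c - 255 * a ^ 2 * b ^ 3 * d + 666 * a ^ 2 * b ^ 2 * c ^ 2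
    - 536 * a ^ 2 * b ^ 2 * c * d - 1040 * a ^ 2 * b ^ 2 * d ^ 2 + 867 * a ^ 2 * b * c ^ 3
    + 634 * a ^ 2 * b * c ^ 2 * d - 413 * a ^ 2 * b * d ^ 3 + 701 * a ^ 2 * c ^ 4
    - 1500 * a ^ 2 * c ^ 3 * d + 313 * a ^ 2 * d ^ 4 - 914 * a * b ^ 5 - 1723 * a * b ^ 4 * c
    + 274 * a * b ^ 4 * d + 1711 * a * b ^ 3 * c ^ 2 - 1510 * a * b ^ 3 * c * d
    - 950 * a * b ^ 3 * d ^ 2 - 1641 * a * b ^ 2 * c ^ 3 - 937 * a * b ^ 2 * c ^ 2 * d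
    + 542 * a * b ^ 2 * d ^ 3 + 1132 * a * b * c ^ 4 + 1310 * a * b * c ^ 3 * d
    + 257 * a * b * d ^ 4 - 702 * a * c ^ 5 + 463 * a * c ^ 4 * d - 816 * a * d ^ 5
    - 914 * b ^ 5 * c + 914 * b ^ 5 * d + 993 * b ^ 4 * c ^ 2 - 730 * b ^ 4 * c * d
    + 651 * b ^ 4 * d ^ 2 - 871 * b ^ 3 * c ^ 3 + 336 * b ^ 3 * c ^ 2 * d + 531 * b ^ 3 * d ^ 3
    + 20 * b ^ 2 * c ^ 4 + 488 * b ^ 2 * c ^ 3 * d - 1422 * b ^ 2 * d ^ 4 - 1442 * b * c ^ 5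
    - 900 * b * c ^ 4 * d - 337 * b * d ^ 5 + 912 * c ^ 6 + 133 * c ^ 5 * d - 337 * d ^ 6) * h.eq₁
    + (-1579 * a ^ 6 - 1425 * a ^ 5 * b - 1367 * a ^ 5 * c - 237 * a ^ 5 * d
    - 1258 * a ^ 4 * b ^ 2 - 541 * a ^ 4 * b * c - 342 * a ^ 4 * b * d - 1635 * a ^ 4 * c ^ 2
    + 1367 * a ^ 4 * c * d + 230 * a ^ 4 * d ^ 2 - 1398 * a ^ 3 * b ^ 3 - 1724 * a ^ 3 * b ^ 2 * c
    - 501 * a ^ 3 * b ^ 2 * d + 146 * a ^ 3 * b * c ^ 2 - 945 * a ^ 3 * b * c * d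
    - 427 * a ^ 3 * c ^ 3 + 1478 * a ^ 3 * c ^ 2 * d - 282 * a ^ 3 * d ^ 3 - 1401 * a ^ 2 * b ^ 4
    + 643 * a ^ 2 * b ^ 3 * c + 1069 * a ^ 2 * b ^ 3 * d - 904 * a ^ 2 * b ^ 2 * c ^ 2
    - 599 * a ^ 2 * b ^ 2 * c * d - 662 * a ^ 2 * b * c ^ 3 + 706 * a ^ 2 * c ^ 4
    + 427 * a ^ 2 * c ^ 3 * d - 624 * a ^ 2 * d ^ 4 - 1382 * a * b ^ 5 + 1073 * a * b ^ 4 * c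
    - 788 * a * b ^ 4 * d - 1549 * a * b ^ 3 * c ^ 2 + 1532 * a * b ^ 2 * c ^ 3
    - 1189 * a * b * c ^ 4 - 1275 * a * c ^ 5 - 427 * a * c ^ 4 * d - 816 * a * d ^ 5
    + 1332 * b ^ 6 + 1574 * b ^ 5 * c - 1327 * b ^ 5 * d + 1616 * b ^ 3 * c ^ 3
    + 1554 * b ^ 2 * c ^ 4 - 1275 * b * c ^ 5 - 957 * c ^ 6 + 1275 * c ^ 5 * d
    - 337 * d ^ 6) * h.eq₂ + (1552 * a ^ 6 - 1091 * a ^ 5 * b + 1354 * a ^ 5 * c - 413 * a ^ 5 * d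
    - 1123 * a ^ 4 * b ^ 2 + 326 * a ^ 4 * b * c + 648 * a ^ 4 * b * d - 1452 * a ^ 4 * c * d
    + 1261 * a ^ 4 * d ^ 2 - 170 * a ^ 3 * b ^ 3 - 524 * a ^ 3 * b ^ 2 * c
    - 173 * a ^ 3 * b ^ 2 * d - 913 * a ^ 3 * b * c ^ 2 - 513 * a ^ 3 * b * c * d
    - 1261 * a ^ 3 * c ^ 3 - 1073 * a ^ 3 * d ^ 3 + 1296 * a ^ 2 * b ^ 4 + 579 * a ^ 2 * b ^ 3 * c
    - 1045 * a ^ 2 * b ^ 3 * d + 1232 * a ^ 2 * b ^ 2 * c ^ 2 + 928 * a ^ 2 * b ^ 2 * c * d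
    + 860 * a ^ 2 * d ^ 4 + 1658 * a * b ^ 5 - 642 * a * b ^ 4 * c + 1262 * a * d ^ 5) * h.eq₃
    - (-2 * a ^ 9 - 2 * a ^ 8 * b - 3 * a ^ 8 * c - 6 * a ^ 7 * b * c + 5 * a ^ 7 * b * d
    - 2 * a ^ 7 * c ^ 2 + 2 * a ^ 7 * c * d + a ^ 7 * d ^ 2 - a ^ 6 * b ^ 3
    - 2 * a ^ 6 * b * c ^ 2 + 5 * a ^ 6 * b * c * d - 2 * a ^ 6 * b * d ^ 2 - 168 * a ^ 6 * c ^ 3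
    + a ^ 6 * c * d ^ 2 + 2 * a ^ 6 * d ^ 3 - 4 * a ^ 5 * b ^ 4 - a ^ 5 * b ^ 3 * c
    + 2 * a ^ 5 * b ^ 3 * d + 2 * a ^ 5 * b ^ 2 * c ^ 2 - 2 * a ^ 5 * b ^ 2 * c * d
    - 150 * a ^ 5 * b * c ^ 3 + a ^ 5 * b * c ^ 2 * d - a ^ 5 * b * c * d ^ 2
    - 5 * a ^ 5 * b * d ^ 3 - 145 * a ^ 5 * c ^ 4 - 27 * a ^ 5 * c ^ 3 * d + a ^ 5 * c ^ 2 * d ^ 2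
    + a ^ 5 * c * d ^ 3 + a ^ 5 * d ^ 4 - 2 * a ^ 4 * b ^ 5 - 5 * a ^ 4 * b ^ 4 * c
    + 6 * a ^ 4 * b ^ 4 * d + a ^ 4 * b ^ 3 * c ^ 2 + a ^ 4 * b ^ 3 * c * d
    - 2 * a ^ 4 * b ^ 3 * d ^ 2 - 131 * a ^ 4 * b ^ 2 * c ^ 3 - 8 * a ^ 4 * b ^ 2 * c ^ 2 * d
    + a ^ 4 * b ^ 2 * c * d ^ 2 - 3 * a ^ 4 * b ^ 2 * d ^ 3 - 57 * a ^ 4 * b * c ^ 4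
    - 41 * a ^ 4 * b * c ^ 3 * d + 2 * a ^ 4 * b * c ^ 2 * d ^ 2 - 3 * a ^ 4 * b * c * d ^ 3
    + 2 * a ^ 4 * b * d ^ 4 - 175 * a ^ 4 * c ^ 5 + 141 * a ^ 4 * c ^ 4 * d
    + 30 * a ^ 4 * c ^ 3 * d ^ 2 - a ^ 4 * c ^ 2 * d ^ 3 - a ^ 4 * c * d ^ 4 + 2 * a ^ 4 * d ^ 5
    - 2 * a ^ 3 * b ^ 6 - 4 * a ^ 3 * b ^ 5 * c + 6 * a ^ 3 * b ^ 5 * d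
    - 2 * a ^ 3 * b ^ 4 * c ^ 2 + 5 * a ^ 3 * b ^ 4 * c * d - 3 * a ^ 3 * b ^ 4 * d ^ 2
    - 148 * a ^ 3 * b ^ 3 * c ^ 3 - 3 * a ^ 3 * b ^ 3 * c ^ 2 * d + 2 * a ^ 3 * b ^ 3 * c * d ^ 2
    - 183 * a ^ 3 * b ^ 2 * c ^ 4 - 56 * a ^ 3 * b ^ 2 * c ^ 3 * d
    + 5 * a ^ 3 * b ^ 2 * c ^ 2 * d ^ 2 - a ^ 3 * b ^ 2 * c * d ^ 3 - a ^ 3 * b ^ 2 * d ^ 4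
    + 14 * a ^ 3 * b * c ^ 5 - 105 * a ^ 3 * b * c ^ 4 * d + 4 * a ^ 3 * b * c ^ 3 * d ^ 2
    - 4 * a ^ 3 * b * c ^ 2 * d ^ 3 + 3 * a ^ 3 * b * c * d ^ 4 - 46 * a ^ 3 * c ^ 6
    + 157 * a ^ 3 * c ^ 5 * d + 7 * a ^ 3 * c ^ 4 * d ^ 2 - 31 * a ^ 3 * c ^ 3 * d ^ 3
    + 3 * a ^ 3 * c ^ 2 * d ^ 4 - 3 * a ^ 3 * d ^ 6 + a ^ 2 * b ^ 7 - a ^ 2 * b ^ 6 * c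
    + a ^ 2 * b ^ 6 * d - a ^ 2 * b ^ 5 * c ^ 2 + 5 * a ^ 2 * b ^ 5 * c * d
    - 4 * a ^ 2 * b ^ 5 * d ^ 2 - 147 * a ^ 2 * b ^ 4 * c ^ 3 - a ^ 2 * b ^ 4 * c ^ 2 * d
    - a ^ 2 * b ^ 4 * c * d ^ 2 + 3 * a ^ 2 * b ^ 4 * d ^ 3 + 67 * a ^ 2 * b ^ 3 * c ^ 4
    + 111 * a ^ 2 * b ^ 3 * c ^ 3 * d + 3 * a ^ 2 * b ^ 3 * c ^ 2 * d ^ 2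
    + a ^ 2 * b ^ 3 * c * d ^ 3 - 3 * a ^ 2 * b ^ 3 * d ^ 4 - 97 * a ^ 2 * b ^ 2 * c ^ 5
    - 64 * a ^ 2 * b ^ 2 * c ^ 4 * d + a ^ 2 * b ^ 2 * c ^ 3 * d ^ 2
    + a ^ 2 * b ^ 2 * c ^ 2 * d ^ 3 + 2 * a ^ 2 * b ^ 2 * d ^ 5 - 72 * a ^ 2 * b * c ^ 6
    + 6 * a ^ 2 * b * c ^ 4 * d ^ 2 + 2 * a ^ 2 * b * c ^ 3 * d ^ 3 + a ^ 2 * b * c ^ 2 * d ^ 4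
    + a ^ 2 * b * d ^ 6 + 75 * a ^ 2 * c ^ 7 + 47 * a ^ 2 * c ^ 6 * d + 3 * a ^ 2 * c ^ 5 * d ^ 2
    - a ^ 2 * c ^ 4 * d ^ 3 - 67 * a ^ 2 * c ^ 3 * d ^ 4 - 2 * a ^ 2 * c ^ 2 * d ^ 5
    + a ^ 2 * c * d ^ 6 + a ^ 2 * d ^ 7 - 2 * a * b ^ 7 * d + a * b ^ 6 * c ^ 2
    - a * b ^ 6 * d ^ 2 - 146 * a * b ^ 5 * c ^ 3 - 2 * a * b ^ 5 * c ^ 2 * d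
    + a * b ^ 5 * c * d ^ 2 + 3 * a * b ^ 5 * d ^ 3 + 115 * a * b ^ 4 * c ^ 4
    - 85 * a * b ^ 4 * c ^ 3 * d + a * b ^ 4 * c ^ 2 * d ^ 2 - 165 * a * b ^ 3 * c ^ 5
    + a * b ^ 3 * c ^ 4 * d + 2 * a * b ^ 3 * c ^ 3 * d ^ 2 - 4 * a * b ^ 3 * c * d ^ 4
    + 2 * a * b ^ 3 * d ^ 5 + 161 * a * b ^ 2 * c ^ 6 - a * b ^ 2 * c ^ 4 * d ^ 2
    + a * b ^ 2 * c ^ 3 * d ^ 3 + 2 * a * b ^ 2 * c * d ^ 5 - 125 * a * b * c ^ 7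
    + a * b * c ^ 6 * d + 3 * a * b * c ^ 5 * d ^ 2 + a * b * c ^ 4 * d ^ 3
    - 2 * a * b * c ^ 2 * d ^ 5 + a * b * c * d ^ 6 + a * b * d ^ 7 - 134 * a * c ^ 8
    - 46 * a * c ^ 7 * d - a * c ^ 5 * d ^ 3 - 2 * a * c ^ 4 * d ^ 4 - 88 * a * c ^ 3 * d ^ 5
    - a * c ^ 2 * d ^ 6 + a * c * d ^ 7 + 2 * a * d ^ 8 + b ^ 7 * c ^ 2 - 2 * b ^ 7 * c * d
    + b ^ 7 * d ^ 2 + 140 * b ^ 6 * c ^ 3 + 167 * b ^ 5 * c ^ 4 - 142 * b ^ 5 * c ^ 3 * d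
    + b ^ 5 * c ^ 2 * d ^ 2 - b ^ 5 * d ^ 4 - b ^ 4 * c ^ 5 - b ^ 4 * c ^ 4 * d
    + 2 * b ^ 4 * c ^ 3 * d ^ 2 - 2 * b ^ 4 * c ^ 2 * d ^ 3 + 171 * b ^ 3 * c ^ 6
    - 2 * b ^ 3 * c ^ 4 * d ^ 2 + b ^ 3 * c ^ 3 * d ^ 3 - b ^ 3 * c ^ 2 * d ^ 4
    + 2 * b ^ 3 * c * d ^ 5 + 164 * b ^ 2 * c ^ 7 + b ^ 2 * c ^ 5 * d ^ 2
    + 2 * b ^ 2 * c ^ 4 * d ^ 3 - b ^ 2 * c ^ 3 * d ^ 4 - 134 * b * c ^ 8 - b * c ^ 7 * d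
    + b * c ^ 6 * d ^ 2 - b * c ^ 5 * d ^ 3 - b * c ^ 4 * d ^ 4 - b * c ^ 3 * d ^ 5
    + b * c ^ 2 * d ^ 6 - 101 * c ^ 9 + 134 * c ^ 8 * d + c ^ 7 * d ^ 2 - c ^ 6 * d ^ 3
    - 35 * c ^ 3 * d ^ 6) * hp

theorem GCrit.pow_nine_eq_zero_of_neg_250 {k : Type*} [CommRing k] (hp : (3449 : k) = 0) {a b c d : k}
    (h : GCrit (-250) a b c d) : c ^ 9 = 0 := by
  linear_combination (664 * a ^ 6 + 1488 * a ^ 5 * b - 612 * a ^ 5 * c + 1143 * a ^ 5 * d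
    - 1344 * a ^ 4 * b ^ 2 + 1471 * a ^ 4 * b * c - 1273 * a ^ 4 * b * d - 1145 * a ^ 4 * c ^ 2
    + 474 * a ^ 4 * c * d - 779 * a ^ 4 * d ^ 2 - 1562 * a ^ 3 * b ^ 3 + 526 * a ^ 3 * b ^ 2 * c
    - 1491 * a ^ 3 * b ^ 2 * d - 876 * a ^ 3 * b * c ^ 2 - 439 * a ^ 3 * b * c * d
    + 1197 * a ^ 3 * b * d ^ 2 - 941 * a ^ 3 * c ^ 3 - 1252 * a ^ 3 * c ^ 2 * d
    - 838 * a ^ 3 * c * d ^ 2 + 736 * a ^ 3 * d ^ 3 + 15 * a ^ 2 * b ^ 4 - 418 * a ^ 2 * b ^ 3 * c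
    + 1709 * a ^ 2 * b ^ 3 * d + 419 * a ^ 2 * b ^ 2 * c ^ 2 + 362 * a ^ 2 * b ^ 2 * c * d
    - 1086 * a ^ 2 * b ^ 2 * d ^ 2 - 1116 * a ^ 2 * b * c ^ 3 + 1226 * a ^ 2 * b * c ^ 2 * d
    + 880 * a ^ 2 * b * c * d ^ 2 - 1086 * a ^ 2 * b * d ^ 3 - 597 * a ^ 2 * c ^ 4
    - 86 * a ^ 2 * c ^ 3 * d + 811 * a ^ 2 * c ^ 2 * d ^ 2 - 15 * a ^ 2 * c * d ^ 3
    - 1106 * a ^ 2 * d ^ 4 - 1287 * a * b ^ 5 + 674 * a * b ^ 4 * c + 1202 * a * b ^ 4 * d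
    - 759 * a * b ^ 3 * c ^ 2 + 13 * a * b ^ 3 * c * d + 945 * a * b ^ 3 * d ^ 2
    + 157 * a * b ^ 2 * c ^ 3 + 1669 * a * b ^ 2 * c ^ 2 * d - 155 * a * b ^ 2 * c * d ^ 2
    + 842 * a * b ^ 2 * d ^ 3 - 1585 * a * b * c ^ 4 - 775 * a * b * c ^ 3 * d
    + 1476 * a * b * c ^ 2 * d ^ 2 - 254 * a * b * c * d ^ 3 + 283 * a * b * d ^ 4
    + 902 * a * c ^ 5 - 461 * a * c ^ 4 * d + 303 * a * c ^ 3 * d ^ 2 - 571 * a * c ^ 2 * d ^ 3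
    - 402 * a * c * d ^ 4 + 36 * a * d ^ 5 + 251 * b ^ 6 + 961 * b ^ 5 * c - 131 * b ^ 5 * d
    - 1129 * b ^ 4 * c ^ 2 + 1202 * b ^ 4 * c * d + 100 * b ^ 4 * d ^ 2 + 301 * b ^ 3 * c ^ 3
    - 1578 * b ^ 3 * c ^ 2 * d - 1109 * b ^ 3 * c * d ^ 2 + 437 * b ^ 3 * d ^ 3
    + 1147 * b ^ 2 * c ^ 4 + 1589 * b ^ 2 * c ^ 3 * d + 78 * b ^ 2 * c ^ 2 * d ^ 2
    - 377 * b ^ 2 * c * d ^ 3 - 744 * b ^ 2 * d ^ 4 + 399 * b * c ^ 5 + 1278 * b * c ^ 4 * d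
    + 461 * b * c ^ 3 * d ^ 2 - 1482 * b * c ^ 2 * d ^ 3 + 1536 * b * c * d ^ 4 + 12 * b * d ^ 5
    + 174 * c ^ 6 + 1448 * c ^ 5 * d - 1506 * c ^ 4 * d ^ 2 - 1506 * c ^ 3 * d ^ 3
    - 1506 * c ^ 2 * d ^ 4 + 6 * c * d ^ 5) * h.eq₀ + (927 * a ^ 6 + 544 * a ^ 5 * b
    + 212 * a ^ 5 * c + 893 * a ^ 5 * d + 1530 * a ^ 4 * b ^ 2 + 1391 * a ^ 4 * b * c
    + 1336 * a ^ 4 * b * d - 250 * a ^ 4 * c ^ 2 - 334 * a ^ 4 * c * d - 791 * a ^ 4 * d ^ 2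
    + 1258 * a ^ 3 * b ^ 3 + 1143 * a ^ 3 * b ^ 2 * c + 150 * a ^ 3 * b ^ 2 * d
    - 1311 * a ^ 3 * b * c ^ 2 + 1683 * a ^ 3 * b * c * d - 1147 * a ^ 3 * b * d ^ 2
    - 793 * a ^ 3 * c ^ 3 - 1490 * a ^ 3 * c ^ 2 * d + 624 * a ^ 3 * d ^ 3 - 1072 * a ^ 2 * b ^ 4
    + 198 * a ^ 2 * b ^ 3 * c - 564 * a ^ 2 * b ^ 3 * d - 342 * a ^ 2 * b ^ 2 * c ^ 2
    - 1134 * a ^ 2 * b ^ 2 * c * d - 1648 * a ^ 2 * b ^ 2 * d ^ 2 + 709 * a ^ 2 * b * c ^ 3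
    - 35 * a ^ 2 * b * c ^ 2 * d - 624 * a ^ 2 * b * d ^ 3 - 1016 * a ^ 2 * c ^ 4
    - 1066 * a ^ 2 * c ^ 3 * d + 1189 * a ^ 2 * d ^ 4 - 1364 * a * b ^ 5 + 893 * a * b ^ 4 * c
    + 55 * a * b ^ 4 * d - 545 * a * b ^ 3 * c ^ 2 - 1175 * a * b ^ 3 * c * d
    - 1516 * a * b ^ 3 * d ^ 2 + 1281 * a * b ^ 2 * c ^ 3 - 727 * a * b ^ 2 * c ^ 2 * d
    + 997 * a * b ^ 2 * d ^ 3 - 1346 * a * b * c ^ 4 - 802 * a * b * c ^ 3 * d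
    - 857 * a * b * d ^ 4 + 537 * a * c ^ 5 + 1596 * a * c ^ 4 * d + 1052 * a * d ^ 5
    - 1364 * b ^ 5 * c + 1364 * b ^ 5 * d - 1484 * b ^ 4 * c ^ 2 + 1224 * b ^ 4 * c * d
    + 1624 * b ^ 4 * d ^ 2 - 926 * b ^ 3 * c ^ 3 + 177 * b ^ 3 * c ^ 2 * d + 1193 * b ^ 3 * d ^ 3
    - 390 * b ^ 2 * c ^ 4 - 1257 * b ^ 2 * c ^ 3 * d - 744 * b ^ 2 * d ^ 4 + 98 * b * c ^ 5
    - 1333 * b * c ^ 4 * d + 6 * b * d ^ 5 - 147 * c ^ 6 + 1111 * c ^ 5 * d + 6 * d ^ 6) * h.eq₁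
    + (-1324 * a ^ 6 - 44 * a ^ 5 * b - 500 * a ^ 5 * c + 547 * a ^ 5 * d - 1623 * a ^ 4 * b ^ 2
    + 190 * a ^ 4 * b * c - 14 * a ^ 4 * b * d + 1395 * a ^ 4 * c ^ 2 + 500 * a ^ 4 * c * d
    + 158 * a ^ 4 * d ^ 2 + 556 * a ^ 3 * b ^ 3 - 1075 * a ^ 3 * b ^ 2 * c
    + 1290 * a ^ 3 * b ^ 2 * d - 852 * a ^ 3 * b * c ^ 2 - 1174 * a ^ 3 * b * c * d
    - 491 * a ^ 3 * c ^ 3 + 355 * a ^ 3 * c ^ 2 * d + 949 * a ^ 3 * d ^ 3 + 687 * a ^ 2 * b ^ 4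
    + 1721 * a ^ 2 * b ^ 3 * c + 1091 * a ^ 2 * b ^ 3 * d + 839 * a ^ 2 * b ^ 2 * c ^ 2
    - 1549 * a ^ 2 * b ^ 2 * c * d - 117 * a ^ 2 * b * c ^ 3 - 65 * a ^ 2 * c ^ 4
    + 491 * a ^ 2 * c ^ 3 * d - 1474 * a ^ 2 * d ^ 4 - 1669 * a * b ^ 5 + 1146 * a * b ^ 4 * c
    + 118 * a * b ^ 4 * d - 253 * a * b ^ 3 * c ^ 2 + 42 * a * b ^ 2 * c ^ 3 - 783 * a * b * c ^ 4
    - 616 * a * c ^ 5 - 1269 * a * c ^ 4 * d + 1052 * a * d ^ 5 - 972 * b ^ 6 - 1693 * b ^ 5 * c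
    - 791 * b ^ 5 * d - 1397 * b ^ 3 * c ^ 3 - 718 * b ^ 2 * c ^ 4 - 616 * b * c ^ 5 + 917 * c ^ 6
    + 616 * c ^ 5 * d + 6 * d ^ 6) * h.eq₂ + (-1190 * a ^ 6 - 1244 * a ^ 5 * b - 1283 * a ^ 5 * c
    - 894 * a ^ 5 * d - 980 * a ^ 4 * b ^ 2 + 141 * a ^ 4 * b * c - 255 * a ^ 4 * b * d
    + 1240 * a ^ 4 * c * d + 122 * a ^ 4 * d ^ 2 - 231 * a ^ 3 * b ^ 3 + 1579 * a ^ 3 * b ^ 2 * c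
    + 609 * a ^ 3 * b ^ 2 * d + 525 * a ^ 3 * b * c ^ 2 + 1320 * a ^ 3 * b * c * d
    + 1098 * a ^ 3 * c ^ 3 + 1155 * a ^ 3 * d ^ 3 + 371 * a ^ 2 * b ^ 4 - 1482 * a ^ 2 * b ^ 3 * c
    + 1123 * a ^ 2 * b ^ 3 * d + 1699 * a ^ 2 * b ^ 2 * c ^ 2 - 912 * a ^ 2 * b ^ 2 * c * d
    + 809 * a ^ 2 * d ^ 4 + 607 * a * b ^ 5 + 1222 * a * b ^ 4 * c - 2 * a * d ^ 5) * h.eq₃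
    - (a ^ 9 + 3 * a ^ 8 * b + a ^ 8 * c + 2 * a ^ 8 * d + a ^ 7 * b ^ 2 + 6 * a ^ 7 * b * c
    - a ^ 7 * b * d + 2 * a ^ 7 * c * d - 3 * a ^ 7 * d ^ 2 - a ^ 6 * b ^ 3
    + 5 * a ^ 6 * b ^ 2 * c - 2 * a ^ 6 * b ^ 2 * d + 2 * a ^ 6 * b * c ^ 2
    - 4 * a ^ 6 * b * c * d - 3 * a ^ 6 * b * d ^ 2 - 99 * a ^ 6 * c ^ 3 - a ^ 6 * c ^ 2 * d
    - 5 * a ^ 6 * c * d ^ 2 - a ^ 5 * b ^ 4 + 3 * a ^ 5 * b ^ 3 * d + 2 * a ^ 5 * b ^ 2 * c ^ 2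
    - 7 * a ^ 5 * b ^ 2 * c * d - 8 * a ^ 5 * b * c ^ 3 - a ^ 5 * b * c ^ 2 * d
    - 3 * a ^ 5 * b * c * d ^ 2 - a ^ 5 * b * d ^ 3 - 40 * a ^ 5 * c ^ 4 + 40 * a ^ 5 * c ^ 3 * d
    + 2 * a ^ 5 * c ^ 2 * d ^ 2 + a ^ 5 * c * d ^ 3 - 5 * a ^ 5 * d ^ 4 - 2 * a ^ 4 * b ^ 5
    + a ^ 4 * b ^ 4 * c + 5 * a ^ 4 * b ^ 4 * d - a ^ 4 * b ^ 3 * c ^ 2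
    - 2 * a ^ 4 * b ^ 3 * c * d - 2 * a ^ 4 * b ^ 3 * d ^ 2 - 122 * a ^ 4 * b ^ 2 * c ^ 3
    + 3 * a ^ 4 * b ^ 2 * c * d ^ 2 + 6 * a ^ 4 * b * c ^ 4 + 2 * a ^ 4 * b * c ^ 3 * d
    + 4 * a ^ 4 * b * c ^ 2 * d ^ 2 + a ^ 4 * b * c * d ^ 3 - 3 * a ^ 4 * b * d ^ 4
    + 101 * a ^ 4 * c ^ 5 + 39 * a ^ 4 * c ^ 4 * d + 14 * a ^ 4 * c ^ 3 * d ^ 2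
    - a ^ 4 * c * d ^ 4 + 2 * a ^ 4 * d ^ 5 - 2 * a ^ 3 * b ^ 6 - a ^ 3 * b ^ 5 * c
    + 5 * a ^ 3 * b ^ 5 * d - 2 * a ^ 3 * b ^ 4 * c ^ 2 + a ^ 3 * b ^ 4 * c * d
    - 4 * a ^ 3 * b ^ 4 * d ^ 2 + 38 * a ^ 3 * b ^ 3 * c ^ 3 - 3 * a ^ 3 * b ^ 3 * c ^ 2 * d
    - 2 * a ^ 3 * b ^ 3 * c * d ^ 2 + 3 * a ^ 3 * b ^ 3 * d ^ 3 - 82 * a ^ 3 * b ^ 2 * c ^ 4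
    + 99 * a ^ 3 * b ^ 2 * c ^ 3 * d + 2 * a ^ 3 * b ^ 2 * c ^ 2 * d ^ 2
    + a ^ 3 * b ^ 2 * c * d ^ 3 - a ^ 3 * b ^ 2 * d ^ 4 - 66 * a ^ 3 * b * c ^ 5
    - 80 * a ^ 3 * b * c ^ 4 * d + 4 * a ^ 3 * b * c ^ 3 * d ^ 2 - 4 * a ^ 3 * b * c ^ 2 * d ^ 3
    + 2 * a ^ 3 * b * c * d ^ 4 + 4 * a ^ 3 * b * d ^ 5 - 35 * a ^ 3 * c ^ 6
    + 29 * a ^ 3 * c ^ 5 * d + 67 * a ^ 3 * c ^ 3 * d ^ 3 - 3 * a ^ 3 * c ^ 2 * d ^ 4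
    + 3 * a ^ 3 * c * d ^ 5 + a ^ 3 * d ^ 6 - 2 * a ^ 2 * b ^ 7 - 4 * a ^ 2 * b ^ 6 * c
    + 4 * a ^ 2 * b ^ 6 * d - 2 * a ^ 2 * b ^ 5 * c ^ 2 + 7 * a ^ 2 * b ^ 5 * c * d
    - 3 * a ^ 2 * b ^ 5 * d ^ 2 + 47 * a ^ 2 * b ^ 4 * c ^ 3 - 3 * a ^ 2 * b ^ 4 * c * d ^ 2
    + a ^ 2 * b ^ 4 * d ^ 3 + 124 * a ^ 2 * b ^ 3 * c ^ 4 + 83 * a ^ 2 * b ^ 3 * c ^ 3 * d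
    - a ^ 2 * b ^ 3 * c ^ 2 * d ^ 2 + 2 * a ^ 2 * b ^ 3 * c * d ^ 3 - a ^ 2 * b ^ 3 * d ^ 4
    + 59 * a ^ 2 * b ^ 2 * c ^ 5 - 111 * a ^ 2 * b ^ 2 * c ^ 4 * d + a ^ 2 * b ^ 2 * c ^ 3 * d ^ 2
    - a ^ 2 * b ^ 2 * c ^ 2 * d ^ 3 - 3 * a ^ 2 * b ^ 2 * c * d ^ 4 + 2 * a ^ 2 * b ^ 2 * d ^ 5
    - 8 * a ^ 2 * b * c ^ 6 + 5 * a ^ 2 * b * c ^ 5 * d + 2 * a ^ 2 * b * c ^ 4 * d ^ 2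
    - 6 * a ^ 2 * b * c ^ 3 * d ^ 3 + 2 * a ^ 2 * b * c ^ 2 * d ^ 4 + 2 * a ^ 2 * b * c * d ^ 5
    - 3 * a ^ 2 * b * d ^ 6 - 4 * a ^ 2 * c ^ 7 + 37 * a ^ 2 * c ^ 6 * d
    - 4 * a ^ 2 * c ^ 5 * d ^ 2 - a ^ 2 * c ^ 4 * d ^ 3 - 107 * a ^ 2 * c ^ 3 * d ^ 4
    + 2 * a ^ 2 * c ^ 2 * d ^ 5 - a ^ 2 * c * d ^ 6 + 2 * a ^ 2 * d ^ 7 - a * b ^ 8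
    - a * b ^ 7 * c + a * b ^ 7 * d - 2 * a * b ^ 6 * c ^ 2 + 4 * a * b ^ 6 * c * d
    - 2 * a * b ^ 6 * d ^ 2 - 124 * a * b ^ 5 * c ^ 3 + 5 * a * b ^ 5 * c ^ 2 * d
    - 4 * a * b ^ 5 * c * d ^ 2 + a * b ^ 5 * d ^ 3 + 81 * a * b ^ 4 * c ^ 4
    + 12 * a * b ^ 4 * c ^ 3 * d - 2 * a * b ^ 4 * c ^ 2 * d ^ 2 + 4 * a * b ^ 4 * c * d ^ 3
    - a * b ^ 4 * d ^ 4 - 18 * a * b ^ 3 * c ^ 5 + 3 * a * b ^ 3 * c ^ 4 * d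
    - a * b ^ 3 * c ^ 3 * d ^ 2 + 2 * a * b ^ 3 * c ^ 2 * d ^ 3 - 3 * a * b ^ 3 * c * d ^ 4
    + 2 * a * b ^ 3 * d ^ 5 + 3 * a * b ^ 2 * c ^ 6 + 2 * a * b ^ 2 * c ^ 5 * d
    - 5 * a * b ^ 2 * c ^ 3 * d ^ 3 + 3 * a * b ^ 2 * c ^ 2 * d ^ 4 + a * b ^ 2 * c * d ^ 5
    - 56 * a * b * c ^ 7 + 2 * a * b * c ^ 6 * d - 5 * a * b * c ^ 5 * d ^ 2
    - 4 * a * b * c ^ 4 * d ^ 3 + 3 * a * b * c ^ 3 * d ^ 4 + a * b * c ^ 2 * d ^ 5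
    - 2 * a * b * c * d ^ 6 - 45 * a * c ^ 8 - 93 * a * c ^ 7 * d - 3 * a * c ^ 6 * d ^ 2
    + 2 * a * c ^ 5 * d ^ 3 + 2 * a * c ^ 4 * d ^ 4 + 79 * a * c ^ 3 * d ^ 5 - b ^ 8 * c
    + b ^ 8 * d - b ^ 7 * c ^ 2 + b ^ 7 * c * d + b ^ 7 * d ^ 2 - 72 * b ^ 6 * c ^ 3
    + 2 * b ^ 6 * c ^ 2 * d - 125 * b ^ 5 * c ^ 4 - 56 * b ^ 5 * c ^ 3 * d - b ^ 5 * c ^ 2 * d ^ 2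
    - b ^ 5 * d ^ 4 + b ^ 4 * c ^ 4 * d - b ^ 4 * c ^ 3 * d ^ 2 + b ^ 4 * c ^ 2 * d ^ 3
    - b ^ 4 * c * d ^ 4 - 102 * b ^ 3 * c ^ 6 + b ^ 3 * c ^ 5 * d + b ^ 3 * c * d ^ 5
    - 52 * b ^ 2 * c ^ 7 - b ^ 2 * c ^ 5 * d ^ 2 + 2 * b ^ 2 * c ^ 3 * d ^ 4
    - b ^ 2 * c ^ 2 * d ^ 5 - 45 * b * c ^ 8 - 2 * b * c ^ 6 * d ^ 2 + b * c ^ 5 * d ^ 3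
    + b * c ^ 4 * d ^ 4 + 67 * c ^ 9 + 45 * c ^ 8 * d - c ^ 7 * d ^ 2 + c ^ 6 * d ^ 3) * hp

/-- The values 484, 1587 and 48 of `t` come from the nonzero ratios `v = -1505, 1444, -1656` that
occur when `x₀ ≠ 0`. -/
theorem GCrit.pow_nine_eq_zero_of_484 {k : Type*} [CommRing k] (hp : (3449 : k) = 0) {a b c d : k}
    (h : GCrit (484) a b c d) : c ^ 9 = 0 := by
  linear_combination (928 * a ^ 6 + 462 * a ^ 5 * b - 1673 * a ^ 5 * c - 1195 * a ^ 5 * d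
    + 1096 * a ^ 4 * b ^ 2 - 581 * a ^ 4 * b * c - 908 * a ^ 4 * b * d + 207 * a ^ 4 * c ^ 2
    + 588 * a ^ 4 * c * d + 1346 * a ^ 4 * d ^ 2 + 906 * a ^ 3 * b ^ 3 - 899 * a ^ 3 * b ^ 2 * c
    - 820 * a ^ 3 * b ^ 2 * d + 1375 * a ^ 3 * b * c ^ 2 + 1698 * a ^ 3 * b * c * d
    - 1220 * a ^ 3 * b * d ^ 2 + 1028 * a ^ 3 * c ^ 3 - 1497 * a ^ 3 * c ^ 2 * d
    - 227 * a ^ 3 * c * d ^ 2 - 1674 * a ^ 3 * d ^ 3 - 1440 * a ^ 2 * b ^ 4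
    - 691 * a ^ 2 * b ^ 3 * c + 1518 * a ^ 2 * b ^ 3 * d + 123 * a ^ 2 * b ^ 2 * c ^ 2
    + 1133 * a ^ 2 * b ^ 2 * c * d + 1615 * a ^ 2 * b ^ 2 * d ^ 2 - 10 * a ^ 2 * b * c ^ 3
    + 1251 * a ^ 2 * b * c ^ 2 * d - 1186 * a ^ 2 * b * c * d ^ 2 + 160 * a ^ 2 * b * d ^ 3
    - 1013 * a ^ 2 * c ^ 4 + 556 * a ^ 2 * c ^ 3 * d + 515 * a ^ 2 * c ^ 2 * d ^ 2
    - 704 * a ^ 2 * c * d ^ 3 + 1334 * a ^ 2 * d ^ 4 - 456 * a * b ^ 5 + 484 * a * b ^ 4 * c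
    - 1626 * a * b ^ 4 * d + 1555 * a * b ^ 3 * c ^ 2 - 241 * a * b ^ 3 * c * d
    + 360 * a * b ^ 3 * d ^ 2 + 225 * a * b ^ 2 * c ^ 3 - 761 * a * b ^ 2 * c ^ 2 * d
    - 163 * a * b ^ 2 * c * d ^ 2 - 176 * a * b ^ 2 * d ^ 3 - 653 * a * b * c ^ 4
    - 349 * a * b * c ^ 3 * d - 1137 * a * b * c ^ 2 * d ^ 2 - 1435 * a * b * c * d ^ 3
    + 1224 * a * b * d ^ 4 + 37 * a * c ^ 5 - 506 * a * c ^ 4 * d - 783 * a * c ^ 3 * d ^ 2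
    + 159 * a * c ^ 2 * d ^ 3 + 1427 * a * c * d ^ 4 - 1224 * a * d ^ 5 - 1353 * b ^ 6
    + 416 * b ^ 5 * c + 5 * b ^ 5 * d - 458 * b ^ 4 * c ^ 2 + 282 * b ^ 4 * c * d
    - 1208 * b ^ 4 * d ^ 2 - 128 * b ^ 3 * c ^ 3 + 1692 * b ^ 3 * c ^ 2 * d
    + 186 * b ^ 3 * c * d ^ 2 - 471 * b ^ 3 * d ^ 3 - 256 * b ^ 2 * c ^ 4
    - 434 * b ^ 2 * c ^ 3 * d + 797 * b ^ 2 * c ^ 2 * d ^ 2 - 1569 * b ^ 2 * c * d ^ 3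
    - 1286 * b ^ 2 * d ^ 4 - 783 * b * c ^ 5 + 1096 * b * c ^ 4 * d - 1287 * b * c ^ 3 * d ^ 2
    + 673 * b * c ^ 2 * d ^ 3 + 940 * b * c * d ^ 4 - 408 * b * d ^ 5 + 1676 * c ^ 6
    + 228 * c ^ 5 * d + 1489 * c ^ 4 * d ^ 2 + 1489 * c ^ 3 * d ^ 3 + 1489 * c ^ 2 * d ^ 4
    - 204 * c * d ^ 5) * h.eq₀ + (1347 * a ^ 6 - 613 * a ^ 5 * b - 883 * a ^ 5 * c
    + 1389 * a ^ 5 * d - 1024 * a ^ 4 * b ^ 2 - 1218 * a ^ 4 * b * c - 346 * a ^ 4 * b * d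
    - 998 * a ^ 4 * c ^ 2 - 1019 * a ^ 4 * c * d - 309 * a ^ 4 * d ^ 2 + 1445 * a ^ 3 * b ^ 3
    - 484 * a ^ 3 * b ^ 2 * c + 1608 * a ^ 3 * b ^ 2 * d - 883 * a ^ 3 * b * c ^ 2
    - 99 * a ^ 3 * b * c * d + 616 * a ^ 3 * b * d ^ 2 - 502 * a ^ 3 * c ^ 3
    + 1187 * a ^ 3 * c ^ 2 * d + 118 * a ^ 3 * d ^ 3 + 1130 * a ^ 2 * b ^ 4
    - 634 * a ^ 2 * b ^ 3 * c + 742 * a ^ 2 * b ^ 3 * d - 805 * a ^ 2 * b ^ 2 * c ^ 2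
    + 1336 * a ^ 2 * b ^ 2 * c * d - 230 * a ^ 2 * b ^ 2 * d ^ 2 - 523 * a ^ 2 * b * c ^ 3
    - 1371 * a ^ 2 * b * c ^ 2 * d + 167 * a ^ 2 * b * d ^ 3 - 356 * a ^ 2 * c ^ 4
    + 237 * a ^ 2 * c ^ 3 * d + 985 * a ^ 2 * d ^ 4 - 1147 * a * b ^ 5 + 585 * a * b ^ 4 * c
    - 263 * a * b ^ 4 * d + 1593 * a * b ^ 3 * c ^ 2 + 1522 * a * b ^ 3 * c * d
    - 210 * a * b ^ 3 * d ^ 2 + 359 * a * b ^ 2 * c ^ 3 + 898 * a * b ^ 2 * c ^ 2 * d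
    - 149 * a * b ^ 2 * d ^ 3 - 1007 * a * b * c ^ 4 + 1655 * a * b * c ^ 3 * d
    - 939 * a * b * d ^ 4 + 394 * a * c ^ 5 - 649 * a * c ^ 4 * d + 1706 * a * d ^ 5
    - 1147 * b ^ 5 * c + 1147 * b ^ 5 * d - 545 * b ^ 4 * c ^ 2 + 1552 * b ^ 4 * c * d
    + 140 * b ^ 4 * d ^ 2 - 1698 * b ^ 3 * c ^ 3 + 1606 * b ^ 3 * c ^ 2 * d + 407 * b ^ 3 * d ^ 3
    + 419 * b ^ 2 * c ^ 4 + 678 * b ^ 2 * c ^ 3 * d - 1286 * b ^ 2 * d ^ 4 - 1574 * b * c ^ 5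
    + 1628 * b * c ^ 4 * d - 204 * b * d ^ 5 + 1488 * c ^ 6 - 835 * c ^ 5 * d
    - 204 * d ^ 6) * h.eq₁ + (-218 * a ^ 6 - 541 * a ^ 5 * b - 15 * a ^ 5 * c - 1204 * a ^ 5 * d
    + 1031 * a ^ 4 * b ^ 2 + 1314 * a ^ 4 * b * c + 1433 * a ^ 4 * b * d - 692 * a ^ 4 * c ^ 2
    + 15 * a ^ 4 * c * d - 1517 * a ^ 4 * d ^ 2 - 774 * a ^ 3 * b ^ 3 + 864 * a ^ 3 * b ^ 2 * c
    + 775 * a ^ 3 * b ^ 2 * d - 301 * a ^ 3 * b * c ^ 2 + 1451 * a ^ 3 * b * c * d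
    + 1123 * a ^ 3 * c ^ 3 + 1449 * a ^ 3 * c ^ 2 * d - 338 * a ^ 3 * d ^ 3 + 1496 * a ^ 2 * b ^ 4
    + 178 * a ^ 2 * b ^ 3 * c - 1042 * a ^ 2 * b ^ 3 * d + 422 * a ^ 2 * b ^ 2 * c ^ 2
    - 314 * a ^ 2 * b ^ 2 * c * d + 327 * a ^ 2 * b * c ^ 3 + 1528 * a ^ 2 * c ^ 4
    - 1123 * a ^ 2 * c ^ 3 * d + 843 * a ^ 2 * d ^ 4 - 583 * a * b ^ 5 - 1430 * a * b ^ 4 * c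
    - 1466 * a * b ^ 4 * d - 1195 * a * b ^ 3 * c ^ 2 + 87 * a * b ^ 2 * c ^ 3
    - 140 * a * b * c ^ 4 - 1353 * a * c ^ 5 - 1100 * a * c ^ 4 * d + 1706 * a * d ^ 5
    + 198 * b ^ 6 - 1422 * b ^ 5 * c - 880 * b ^ 5 * d + 1240 * b ^ 3 * c ^ 3
    - 1668 * b ^ 2 * c ^ 4 - 1353 * b * c ^ 5 + 322 * c ^ 6 + 1353 * c ^ 5 * d
    - 204 * d ^ 6) * h.eq₂ + (1392 * a ^ 6 + 1605 * a ^ 5 * b - 1665 * a ^ 5 * c - 682 * a ^ 5 * d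
    + 190 * a ^ 4 * b ^ 2 + 271 * a ^ 4 * b * c + 911 * a ^ 4 * b * d + 1199 * a ^ 4 * c * d
    + 758 * a ^ 4 * d ^ 2 - 1096 * a ^ 3 * b ^ 3 - 1282 * a ^ 3 * b ^ 2 * c
    + 875 * a ^ 3 * b ^ 2 * d + 1680 * a ^ 3 * b * c ^ 2 - 1517 * a ^ 3 * b * c * d
    - 68 * a ^ 3 * c ^ 3 + 1672 * a ^ 3 * d ^ 3 - 1065 * a ^ 2 * b ^ 4 - 1141 * a ^ 2 * b ^ 3 * c
    + 1022 * a ^ 2 * b ^ 3 * d + 723 * a ^ 2 * b ^ 2 * c ^ 2 + 1587 * a ^ 2 * b ^ 2 * c * d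
    + 241 * a ^ 2 * d ^ 4 + 1007 * a * b ^ 5 + 1243 * a * b ^ 4 * c + 68 * a * d ^ 5) * h.eq₃
    - (a ^ 9 - a ^ 8 * c - 3 * a ^ 8 * d - 2 * a ^ 7 * b * c - 3 * a ^ 7 * b * d - a ^ 7 * c ^ 2
    + a ^ 7 * c * d + 2 * a ^ 7 * d ^ 2 + 3 * a ^ 6 * b ^ 3 - 2 * a ^ 6 * b ^ 2 * c
    - 2 * a ^ 6 * b ^ 2 * d - 2 * a ^ 6 * b * c ^ 2 + 3 * a ^ 6 * b * c * d - a ^ 6 * b * d ^ 2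
    + 31 * a ^ 6 * c ^ 3 + a ^ 6 * c * d ^ 2 + a ^ 5 * b ^ 4 + 2 * a ^ 5 * b ^ 3 * c
    - a ^ 5 * b ^ 3 * d - 2 * a ^ 5 * b ^ 2 * c ^ 2 + 5 * a ^ 5 * b ^ 2 * c * d
    + a ^ 5 * b ^ 2 * d ^ 2 + 75 * a ^ 5 * b * c ^ 3 + 4 * a ^ 5 * b * c ^ 2 * d
    - 2 * a ^ 5 * b * c * d ^ 2 + a ^ 5 * b * d ^ 3 + 2 * a ^ 5 * c ^ 4 + 169 * a ^ 5 * c ^ 3 * d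
    - 6 * a ^ 5 * c * d ^ 3 + a ^ 5 * d ^ 4 - a ^ 4 * b ^ 5 + 3 * a ^ 4 * b ^ 4 * c
    - 5 * a ^ 4 * b ^ 4 * d + 2 * a ^ 4 * b ^ 3 * c ^ 2 - a ^ 4 * b ^ 3 * c * d
    - 145 * a ^ 4 * b ^ 2 * c ^ 3 + 5 * a ^ 4 * b ^ 2 * c ^ 2 * d - 7 * a ^ 4 * b ^ 2 * c * d ^ 2
    - 184 * a ^ 4 * b * c ^ 4 - 200 * a ^ 4 * b * c ^ 3 * d - 7 * a ^ 4 * b * c ^ 2 * d ^ 2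
    - 3 * a ^ 4 * b * c * d ^ 3 + 8 * a ^ 4 * b * d ^ 4 + 96 * a ^ 4 * c ^ 5
    - 4 * a ^ 4 * c ^ 4 * d + 211 * a ^ 4 * c ^ 3 * d ^ 2 - a ^ 4 * c ^ 2 * d ^ 3
    + 10 * a ^ 4 * c * d ^ 4 - a ^ 4 * d ^ 5 - 2 * a ^ 3 * b ^ 6 - 2 * a ^ 3 * b ^ 5 * c
    - a ^ 3 * b ^ 5 * d + a ^ 3 * b ^ 4 * c ^ 2 - 3 * a ^ 3 * b ^ 4 * c * d
    + 2 * a ^ 3 * b ^ 4 * d ^ 2 + 109 * a ^ 3 * b ^ 3 * c ^ 3 + 4 * a ^ 3 * b ^ 3 * c ^ 2 * d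
    - a ^ 3 * b ^ 3 * c * d ^ 2 - 5 * a ^ 3 * b ^ 3 * d ^ 3 - 122 * a ^ 3 * b ^ 2 * c ^ 4
    - 106 * a ^ 3 * b ^ 2 * c ^ 3 * d - 7 * a ^ 3 * b ^ 2 * c ^ 2 * d ^ 2
    - 5 * a ^ 3 * b ^ 2 * c * d ^ 3 + 38 * a ^ 3 * b * c ^ 5 - 202 * a ^ 3 * b * c ^ 4 * d
    - 3 * a ^ 3 * b * c ^ 3 * d ^ 2 + 2 * a ^ 3 * b * c ^ 2 * d ^ 3 + 7 * a ^ 3 * b * c * d ^ 4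
    - 4 * a ^ 3 * b * d ^ 5 - 155 * a ^ 3 * c ^ 6 - 202 * a ^ 3 * c ^ 5 * d
    + 3 * a ^ 3 * c ^ 4 * d ^ 2 + 48 * a ^ 3 * c ^ 3 * d ^ 3 + 4 * a ^ 3 * c ^ 2 * d ^ 4
    - 4 * a ^ 3 * c * d ^ 5 + 2 * a ^ 3 * d ^ 6 - a ^ 2 * b ^ 7 - 5 * a ^ 2 * b ^ 6 * c
    + 3 * a ^ 2 * b ^ 6 * d - 3 * a ^ 2 * b ^ 5 * c ^ 2 + 3 * a ^ 2 * b ^ 5 * c * d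
    + a ^ 2 * b ^ 5 * d ^ 2 - 208 * a ^ 2 * b ^ 4 * c ^ 3 + 2 * a ^ 2 * b ^ 4 * c ^ 2 * d
    - a ^ 2 * b ^ 4 * c * d ^ 2 - 2 * a ^ 2 * b ^ 4 * d ^ 3 - 26 * a ^ 2 * b ^ 3 * c ^ 4
    + 147 * a ^ 2 * b ^ 3 * c ^ 3 * d - 5 * a ^ 2 * b ^ 3 * c ^ 2 * d ^ 2
    - 4 * a ^ 2 * b ^ 3 * c * d ^ 3 + 2 * a ^ 2 * b ^ 3 * d ^ 4 - 63 * a ^ 2 * b ^ 2 * c ^ 5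
    + 47 * a ^ 2 * b ^ 2 * c ^ 4 * d - 4 * a ^ 2 * b ^ 2 * c ^ 3 * d ^ 2
    + 2 * a ^ 2 * b ^ 2 * c ^ 2 * d ^ 3 + 7 * a ^ 2 * b ^ 2 * c * d ^ 4 - 47 * a ^ 2 * b * c ^ 6
    + 7 * a ^ 2 * b * c ^ 5 * d - 2 * a ^ 2 * b * c ^ 4 * d ^ 2 + 5 * a ^ 2 * b * c ^ 3 * d ^ 3
    + 6 * a ^ 2 * b * c ^ 2 * d ^ 4 - 5 * a ^ 2 * b * c * d ^ 5 - a ^ 2 * b * d ^ 6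
    - 211 * a ^ 2 * c ^ 7 + 155 * a ^ 2 * c ^ 6 * d + a ^ 2 * c ^ 5 * d ^ 2
    + a ^ 2 * c ^ 4 * d ^ 3 - 117 * a ^ 2 * c ^ 3 * d ^ 4 - 4 * a ^ 2 * c ^ 2 * d ^ 5
    - a ^ 2 * c * d ^ 6 + 2 * a ^ 2 * d ^ 7 - a * b ^ 8 - 2 * a * b ^ 7 * c + a * b ^ 7 * d
    - 2 * a * b ^ 6 * c ^ 2 + 5 * a * b ^ 6 * c * d + a * b ^ 6 * d ^ 2 + 81 * a * b ^ 5 * c ^ 3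
    + 5 * a * b ^ 5 * c ^ 2 * d - 2 * a * b ^ 5 * c * d ^ 2 + 2 * a * b ^ 5 * d ^ 3
    + 199 * a * b ^ 4 * c ^ 4 + 208 * a * b ^ 4 * c ^ 3 * d - 4 * a * b ^ 4 * c ^ 2 * d ^ 2
    + 2 * a * b ^ 4 * c * d ^ 3 + 165 * a * b ^ 3 * c ^ 5 + 2 * a * b ^ 3 * c ^ 4 * d
    - 2 * a * b ^ 3 * c ^ 3 * d ^ 2 - 3 * a * b ^ 3 * c ^ 2 * d ^ 3 + a * b ^ 3 * c * d ^ 4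
    + 3 * a * b ^ 3 * d ^ 5 - 15 * a * b ^ 2 * c ^ 6 + 8 * a * b ^ 2 * c ^ 5 * d
    - 4 * a * b ^ 2 * c ^ 4 * d ^ 2 + 2 * a * b ^ 2 * c ^ 3 * d ^ 3
    + 3 * a * b ^ 2 * c ^ 2 * d ^ 4 + a * b ^ 2 * d ^ 6 + 22 * a * b * c ^ 7
    + 2 * a * b * c ^ 6 * d - 3 * a * b * c ^ 5 * d ^ 2 + 3 * a * b * c ^ 4 * d ^ 3
    - 5 * a * b * c ^ 2 * d ^ 5 + 190 * a * c ^ 8 + 150 * a * c ^ 7 * d + a * c ^ 6 * d ^ 2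
    - a * c ^ 5 * d ^ 3 - 2 * a * c ^ 4 * d ^ 4 - 241 * a * c ^ 3 * d ^ 5 - b ^ 8 * c + b ^ 8 * d
    - b ^ 7 * c ^ 2 + 2 * b ^ 7 * c * d - 29 * b ^ 6 * c ^ 3 + 3 * b ^ 6 * c ^ 2 * d
    - b ^ 6 * c * d ^ 2 + 199 * b ^ 5 * c ^ 4 + 125 * b ^ 5 * c ^ 3 * d
    - 2 * b ^ 5 * c ^ 2 * d ^ 2 + b ^ 5 * c * d ^ 3 - b ^ 5 * d ^ 4 - 2 * b ^ 4 * c ^ 5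
    + 3 * b ^ 4 * c ^ 4 * d - 2 * b ^ 4 * c ^ 3 * d ^ 2 - 173 * b ^ 3 * c ^ 6
    + 2 * b ^ 3 * c ^ 5 * d - 3 * b ^ 3 * c ^ 4 * d ^ 2 + b ^ 3 * c ^ 2 * d ^ 4
    + b ^ 3 * c * d ^ 5 + 233 * b ^ 2 * c ^ 7 + 3 * b ^ 2 * c ^ 6 * d - 2 * b ^ 2 * c ^ 5 * d ^ 2
    + b ^ 2 * c ^ 4 * d ^ 3 - b ^ 2 * c ^ 2 * d ^ 5 + 190 * b * c ^ 8 - 2 * b * c ^ 7 * d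
    - b * c ^ 6 * d ^ 2 + b * c ^ 5 * d ^ 3 - b * c ^ 4 * d ^ 4 - b * c ^ 3 * d ^ 5
    + b * c ^ 2 * d ^ 6 - 45 * c ^ 9 - 190 * c ^ 8 * d + c ^ 7 * d ^ 2 - c ^ 6 * d ^ 3
    + 29 * c ^ 3 * d ^ 6) * hp

theorem GCrit.pow_nine_eq_zero_of_1587 {k : Type*} [CommRing k] (hp : (3449 : k) = 0) {a b c d : k}
    (h : GCrit (1587) a b c d) : c ^ 9 = 0 := by
  linear_combination (847 * a ^ 6 + 1290 * a ^ 5 * b + 369 * a ^ 5 * c - 1490 * a ^ 5 * d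
    - 242 * a ^ 4 * b ^ 2 - 830 * a ^ 4 * b * c - 1554 * a ^ 4 * b * d - 850 * a ^ 4 * c ^ 2
    + 644 * a ^ 4 * c * d - 1128 * a ^ 4 * d ^ 2 + 992 * a ^ 3 * b ^ 3 - 1360 * a ^ 3 * b ^ 2 * c
    - 1371 * a ^ 3 * b ^ 2 * d - 1663 * a ^ 3 * b * c ^ 2 + 122 * a ^ 3 * b * c * d
    - 791 * a ^ 3 * b * d ^ 2 + 1092 * a ^ 3 * c ^ 3 + 458 * a ^ 3 * c ^ 2 * d
    + 1077 * a ^ 3 * c * d ^ 2 - 1711 * a ^ 3 * d ^ 3 - 109 * a ^ 2 * b ^ 4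
    + 1084 * a ^ 2 * b ^ 3 * c + 1055 * a ^ 2 * b ^ 3 * d - 693 * a ^ 2 * b ^ 2 * c ^ 2
    + 479 * a ^ 2 * b ^ 2 * c * d - 834 * a ^ 2 * b ^ 2 * d ^ 2 - 1503 * a ^ 2 * b * c ^ 3
    + 826 * a ^ 2 * b * c ^ 2 * d - 913 * a ^ 2 * b * c * d ^ 2 + 1511 * a ^ 2 * b * d ^ 3
    + 1215 * a ^ 2 * c ^ 4 + 1517 * a ^ 2 * c ^ 3 * d + 432 * a ^ 2 * c ^ 2 * d ^ 2
    + 1556 * a ^ 2 * c * d ^ 3 + 1722 * a ^ 2 * d ^ 4 - 534 * a * b ^ 5 + 298 * a * b ^ 4 * c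
    + 1323 * a * b ^ 4 * d - 1611 * a * b ^ 3 * c ^ 2 - 486 * a * b ^ 3 * c * d
    - 1071 * a * b ^ 3 * d ^ 2 + 1068 * a * b ^ 2 * c ^ 3 + 158 * a * b ^ 2 * c ^ 2 * d
    + 853 * a * b ^ 2 * c * d ^ 2 - 1052 * a * b ^ 2 * d ^ 3 + 380 * a * b * c ^ 4
    + 714 * a * b * c ^ 3 * d + 28 * a * b * c ^ 2 * d ^ 2 + 1285 * a * b * c * d ^ 3
    + 1579 * a * b * d ^ 4 - 472 * a * c ^ 5 - 1272 * a * c ^ 4 * d - 775 * a * c ^ 3 * d ^ 2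
    - 1289 * a * c ^ 2 * d ^ 3 + 1435 * a * c * d ^ 4 + 1638 * a * d ^ 5 - 1519 * b ^ 6
    + 876 * b ^ 5 * c - 942 * b ^ 5 * d + 623 * b ^ 4 * c ^ 2 + 676 * b ^ 4 * c * d
    + 485 * b ^ 4 * d ^ 2 - 1555 * b ^ 3 * c ^ 3 - 540 * b ^ 3 * c ^ 2 * d
    + 906 * b ^ 3 * c * d ^ 2 + 257 * b ^ 3 * d ^ 3 + 1441 * b ^ 2 * c ^ 4
    - 24 * b ^ 2 * c ^ 3 * d + 100 * b ^ 2 * c ^ 2 * d ^ 2 - 976 * b ^ 2 * c * d ^ 3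
    + 1336 * b ^ 2 * d ^ 4 + 49 * b * c ^ 5 - 1146 * b * c ^ 4 * d + 1349 * b * c ^ 3 * d ^ 2
    - 504 * b * c ^ 2 * d ^ 3 - 488 * b * c * d ^ 4 + 546 * b * d ^ 5 - 1525 * c ^ 6
    + 983 * c ^ 5 * d - 1596 * c ^ 4 * d ^ 2 - 1596 * c ^ 3 * d ^ 3 - 1596 * c ^ 2 * d ^ 4
    + 273 * c * d ^ 5) * h.eq₀ + (1488 * a ^ 6 - 808 * a ^ 5 * b + 931 * a ^ 5 * c
    - 657 * a ^ 5 * d + 621 * a ^ 4 * b ^ 2 + 674 * a ^ 4 * b * c + 812 * a ^ 4 * b * d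
    - 745 * a ^ 4 * c ^ 2 + 1011 * a ^ 4 * c * d - 16 * a ^ 4 * d ^ 2 + 262 * a ^ 3 * b ^ 3
    + 331 * a ^ 3 * b ^ 2 * c + 1189 * a ^ 3 * b ^ 2 * d - 415 * a ^ 3 * b * c ^ 2
    + 738 * a ^ 3 * b * c * d - 1649 * a ^ 3 * b * d ^ 2 - 11 * a ^ 3 * c ^ 3
    - 1554 * a ^ 3 * c ^ 2 * d - 1570 * a ^ 3 * d ^ 3 - 1177 * a ^ 2 * b ^ 4
    + 499 * a ^ 2 * b ^ 3 * c - 1289 * a ^ 2 * b ^ 3 * d + 1501 * a ^ 2 * b ^ 2 * c ^ 2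
    - 794 * a ^ 2 * b ^ 2 * c * d + 369 * a ^ 2 * b ^ 2 * d ^ 2 + 473 * a ^ 2 * b * c ^ 3
    - 296 * a ^ 2 * b * c ^ 2 * d - 1394 * a ^ 2 * b * d ^ 3 + 1600 * a ^ 2 * c ^ 4
    - 574 * a ^ 2 * c ^ 3 * d - 1448 * a ^ 2 * d ^ 4 + 800 * a * b ^ 5 - 1112 * a * b ^ 4 * c
    + 754 * a * b ^ 4 * d - 1118 * a * b ^ 3 * c ^ 2 - 297 * a * b ^ 3 * c * d
    + 1039 * a * b ^ 3 * d ^ 2 + 681 * a * b ^ 2 * c ^ 3 - 719 * a * b ^ 2 * c ^ 2 * d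
    + 786 * a * b ^ 2 * d ^ 3 + 246 * a * b * c ^ 4 + 1536 * a * b * c ^ 3 * d
    + 359 * a * b * d ^ 4 - 1612 * a * c ^ 5 - 279 * a * c ^ 4 * d + 665 * a * d ^ 5
    + 800 * b ^ 5 * c - 800 * b ^ 5 * d + 65 * b ^ 4 * c ^ 2 - 316 * b ^ 4 * c * d
    - 549 * b ^ 4 * d ^ 2 + 189 * b ^ 3 * c ^ 3 - 737 * b ^ 3 * c ^ 2 * d - 533 * b ^ 3 * d ^ 3
    + 1358 * b ^ 2 * c ^ 4 + 1562 * b ^ 2 * c ^ 3 * d + 1336 * b ^ 2 * d ^ 4 + 1085 * b * c ^ 5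
    - 810 * b * c ^ 4 * d + 273 * b * d ^ 5 + 1063 * c ^ 6 + 570 * c ^ 5 * d
    + 273 * d ^ 6) * h.eq₁ + (944 * a ^ 6 + 1682 * a ^ 5 * b - 1109 * a ^ 5 * c + 606 * a ^ 5 * d
    - 881 * a ^ 4 * b ^ 2 - 449 * a ^ 4 * b * c - 744 * a ^ 4 * b * d + 1457 * a ^ 4 * c ^ 2
    + 1109 * a ^ 4 * c * d - 224 * a ^ 4 * d ^ 2 + 931 * a ^ 3 * b ^ 3 + 327 * a ^ 3 * b ^ 2 * c
    + 799 * a ^ 3 * b ^ 2 * d - 1090 * a ^ 3 * b * c ^ 2 - 1315 * a ^ 3 * b * c * d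
    + 284 * a ^ 3 * c ^ 3 + 1125 * a ^ 3 * c ^ 2 * d + 1009 * a ^ 3 * d ^ 3 + 1156 * a ^ 2 * b ^ 4
    + 1212 * a ^ 2 * b ^ 3 * c + 900 * a ^ 2 * b ^ 3 * d - 968 * a ^ 2 * b ^ 2 * c ^ 2
    - 1503 * a ^ 2 * b ^ 2 * c * d - 93 * a ^ 2 * b * c ^ 3 + 1654 * a ^ 2 * c ^ 4
    - 284 * a ^ 2 * c ^ 3 * d - 873 * a ^ 2 * d ^ 4 - 263 * a * b ^ 5 + 519 * a * b ^ 4 * c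
    + 1370 * a * b ^ 4 * d - 343 * a * b ^ 3 * c ^ 2 + 500 * a * b ^ 2 * c ^ 3
    - 591 * a * b * c ^ 4 + 300 * a * c ^ 5 - 150 * a * c ^ 4 * d + 665 * a * d ^ 5 - 81 * b ^ 6
    + 513 * b ^ 5 * c + 1693 * b ^ 5 * d + 741 * b ^ 3 * c ^ 3 + 1204 * b ^ 2 * c ^ 4
    + 300 * b * c ^ 5 + 1434 * c ^ 6 - 300 * c ^ 5 * d + 273 * d ^ 6) * h.eq₂ + (-1078 * a ^ 6
    + 311 * a ^ 5 * b - 432 * a ^ 5 * c + 1458 * a ^ 5 * d + 547 * a ^ 4 * b ^ 2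
    - 1407 * a ^ 4 * b * c + 781 * a ^ 4 * b * d + 1632 * a ^ 4 * c * d - 53 * a ^ 4 * d ^ 2
    + 939 * a ^ 3 * b ^ 3 - 1054 * a ^ 3 * b ^ 2 * c - 26 * a ^ 3 * b ^ 2 * d
    - 1315 * a ^ 3 * b * c ^ 2 + 1153 * a ^ 3 * b * c * d + 967 * a ^ 3 * c ^ 3
    - 1619 * a ^ 3 * d ^ 3 - 521 * a ^ 2 * b ^ 4 - 1212 * a ^ 2 * b ^ 3 * c
    - 1059 * a ^ 2 * b ^ 3 * d + 375 * a ^ 2 * b ^ 2 * c ^ 2 + 515 * a ^ 2 * b ^ 2 * c * d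
    + 1383 * a ^ 2 * d ^ 4 - 972 * a * b ^ 5 + 1604 * a * b ^ 4 * c - 91 * a * d ^ 5) * h.eq₃
    - (2 * a ^ 9 + 4 * a ^ 8 * b + 3 * a ^ 8 * c - 4 * a ^ 8 * d + 2 * a ^ 7 * b ^ 2
    + 4 * a ^ 7 * b * c - 9 * a ^ 7 * b * d + a ^ 7 * c ^ 2 - 5 * a ^ 7 * c * d
    + 2 * a ^ 6 * b ^ 3 + a ^ 6 * b ^ 2 * c - 6 * a ^ 6 * b ^ 2 * d - 8 * a ^ 6 * b * c * d
    + a ^ 6 * b * d ^ 2 - 433 * a ^ 6 * c ^ 3 - a ^ 6 * c ^ 2 * d + a ^ 6 * c * d ^ 2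
    - 2 * a ^ 6 * d ^ 3 + 3 * a ^ 5 * b ^ 3 * c - 2 * a ^ 5 * b ^ 3 * d
    - 2 * a ^ 5 * b ^ 2 * c ^ 2 - 4 * a ^ 5 * b ^ 2 * c * d + a ^ 5 * b ^ 2 * d ^ 2
    - 775 * a ^ 5 * b * c ^ 3 + 2 * a ^ 5 * b * c ^ 2 * d - a ^ 5 * b * c * d ^ 2
    + 5 * a ^ 5 * b * d ^ 3 + 512 * a ^ 5 * c ^ 4 - 278 * a ^ 5 * c ^ 3 * d
    + a ^ 5 * c ^ 2 * d ^ 2 + 6 * a ^ 5 * d ^ 4 + a ^ 4 * b ^ 5 + 3 * a ^ 4 * b ^ 4 * c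
    + 3 * a ^ 4 * b ^ 4 * d - 2 * a ^ 4 * b ^ 3 * c ^ 2 - 3 * a ^ 4 * b ^ 3 * c * d
    - 2 * a ^ 4 * b ^ 3 * d ^ 2 + 404 * a ^ 4 * b ^ 2 * c ^ 3 + a ^ 4 * b ^ 2 * c ^ 2 * d
    + a ^ 4 * b ^ 2 * c * d ^ 2 + 4 * a ^ 4 * b ^ 2 * d ^ 3 + 208 * a ^ 4 * b * c ^ 4
    + 348 * a ^ 4 * b * c ^ 3 * d - a ^ 4 * b * c ^ 2 * d ^ 2 + 3 * a ^ 4 * b * c * d ^ 3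
    + 3 * a ^ 4 * b * d ^ 4 - 668 * a ^ 4 * c ^ 5 - 514 * a ^ 4 * c ^ 4 * d
    + 100 * a ^ 4 * c ^ 3 * d ^ 2 - 2 * a ^ 4 * c ^ 2 * d ^ 3 + 4 * a ^ 4 * c * d ^ 4
    + 2 * a ^ 4 * d ^ 5 - a ^ 3 * b ^ 6 + 3 * a ^ 3 * b ^ 5 * c + 2 * a ^ 3 * b ^ 5 * d
    - 5 * a ^ 3 * b ^ 4 * d ^ 2 - 431 * a ^ 3 * b ^ 3 * c ^ 3 - 3 * a ^ 3 * b ^ 3 * c ^ 2 * d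
    + a ^ 3 * b ^ 3 * c * d ^ 2 + a ^ 3 * b ^ 3 * d ^ 3 - 147 * a ^ 3 * b ^ 2 * c ^ 4
    - 363 * a ^ 3 * b ^ 2 * c ^ 3 * d + 4 * a ^ 3 * b ^ 2 * d ^ 4 + 504 * a ^ 3 * b * c ^ 5
    + 602 * a ^ 3 * b * c ^ 4 * d - 2 * a ^ 3 * b * c ^ 3 * d ^ 2 + a ^ 3 * b * c * d ^ 4
    + a ^ 3 * b * d ^ 5 - 132 * a ^ 3 * c ^ 6 - 520 * a ^ 3 * c ^ 5 * d - a ^ 3 * c ^ 4 * d ^ 2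
    - 466 * a ^ 3 * c ^ 3 * d ^ 3 - 6 * a ^ 3 * d ^ 6 - 2 * a ^ 2 * b ^ 7 + a ^ 2 * b ^ 6 * c
    + a ^ 2 * b ^ 6 * d + 2 * a ^ 2 * b ^ 5 * c ^ 2 + a ^ 2 * b ^ 5 * c * d
    - 2 * a ^ 2 * b ^ 5 * d ^ 2 - 534 * a ^ 2 * b ^ 4 * c ^ 3 + a ^ 2 * b ^ 4 * c ^ 2 * d
    - 4 * a ^ 2 * b ^ 4 * c * d ^ 2 - 554 * a ^ 2 * b ^ 3 * c ^ 4
    - 412 * a ^ 2 * b ^ 3 * c ^ 3 * d + 4 * a ^ 2 * b ^ 3 * c ^ 2 * d ^ 2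
    - 4 * a ^ 2 * b ^ 3 * c * d ^ 3 + 449 * a ^ 2 * b ^ 2 * c ^ 5
    + 687 * a ^ 2 * b ^ 2 * c ^ 4 * d - 2 * a ^ 2 * b ^ 2 * c ^ 3 * d ^ 2
    + a ^ 2 * b ^ 2 * c ^ 2 * d ^ 3 + 3 * a ^ 2 * b ^ 2 * c * d ^ 4 - 2 * a ^ 2 * b ^ 2 * d ^ 5
    + 43 * a ^ 2 * b * c ^ 6 - 4 * a ^ 2 * b * c ^ 5 * d - a ^ 2 * b * c ^ 4 * d ^ 2
    - 2 * a ^ 2 * b * c ^ 3 * d ^ 3 - a ^ 2 * b * c ^ 2 * d ^ 4 + a ^ 2 * b * c * d ^ 5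
    - 3 * a ^ 2 * b * d ^ 6 - 761 * a ^ 2 * c ^ 7 + 132 * a ^ 2 * c ^ 6 * d
    - a ^ 2 * c ^ 5 * d ^ 2 + a ^ 2 * c ^ 4 * d ^ 3 + 403 * a ^ 2 * c ^ 3 * d ^ 4
    + a ^ 2 * c ^ 2 * d ^ 5 - 3 * a ^ 2 * c * d ^ 6 + 2 * a ^ 2 * d ^ 7 - 2 * a * b ^ 7 * c
    + 3 * a * b ^ 7 * d + a * b ^ 6 * c ^ 2 - a * b ^ 6 * c * d + 121 * a * b ^ 5 * c ^ 3
    - a * b ^ 5 * c ^ 2 * d - a * b ^ 5 * c * d ^ 2 - 239 * a * b ^ 4 * c ^ 4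
    - 628 * a * b ^ 4 * c ^ 3 * d + a * b ^ 4 * c ^ 2 * d ^ 2 + a * b ^ 4 * c * d ^ 3
    + 160 * a * b ^ 3 * c ^ 5 - 3 * a * b ^ 3 * c ^ 4 * d + 2 * a * b ^ 3 * c ^ 3 * d ^ 2
    - 3 * a * b ^ 3 * c ^ 2 * d ^ 3 + 4 * a * b ^ 3 * c * d ^ 4 - 3 * a * b ^ 3 * d ^ 5
    - 228 * a * b ^ 2 * c ^ 6 - 6 * a * b ^ 2 * c ^ 5 * d + a * b ^ 2 * c ^ 4 * d ^ 2
    - 3 * a * b ^ 2 * c ^ 3 * d ^ 3 + 2 * a * b ^ 2 * c ^ 2 * d ^ 4 - 2 * a * b ^ 2 * c * d ^ 5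
    - a * b ^ 2 * d ^ 6 + 271 * a * b * c ^ 7 + a * b * c ^ 5 * d ^ 2 - a * b * c ^ 4 * d ^ 3
    + a * b * c ^ 3 * d ^ 4 + 2 * a * b * c ^ 2 * d ^ 5 - 2 * a * b * c * d ^ 6 - 138 * a * c ^ 8
    + 70 * a * c ^ 7 * d - a * c ^ 6 * d ^ 2 + a * c ^ 5 * d ^ 3 + 2 * a * c ^ 4 * d ^ 4
    - 304 * a * c ^ 3 * d ^ 5 + b ^ 7 * c * d - b ^ 7 * d ^ 2 + 38 * b ^ 6 * c ^ 3
    - 2 * b ^ 6 * c ^ 2 * d - 235 * b ^ 5 * c ^ 4 - 778 * b ^ 5 * c ^ 3 * d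
    + b ^ 5 * c ^ 2 * d ^ 2 - b ^ 5 * c * d ^ 3 + b ^ 5 * d ^ 4 + b ^ 4 * c ^ 5
    - b ^ 4 * c ^ 4 * d + b ^ 4 * c ^ 3 * d ^ 2 - b ^ 4 * c ^ 2 * d ^ 3 + b ^ 4 * c * d ^ 4
    - 339 * b ^ 3 * c ^ 6 - 2 * b ^ 3 * c ^ 5 * d - 2 * b ^ 3 * c ^ 3 * d ^ 3
    + 2 * b ^ 3 * c ^ 2 * d ^ 4 - 2 * b ^ 3 * c * d ^ 5 - 553 * b ^ 2 * c ^ 7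
    - 2 * b ^ 2 * c ^ 6 * d + b ^ 2 * c ^ 5 * d ^ 2 - b ^ 2 * c ^ 4 * d ^ 3
    + b ^ 2 * c ^ 3 * d ^ 4 - 138 * b * c ^ 8 - b * c ^ 6 * d ^ 2 + b * c ^ 4 * d ^ 4
    + b * c ^ 3 * d ^ 5 - b * c ^ 2 * d ^ 6 - 659 * c ^ 9 + 138 * c ^ 8 * d - c ^ 7 * d ^ 2
    + c ^ 6 * d ^ 3 - 126 * c ^ 3 * d ^ 6) * hp

theorem GCrit.pow_nine_eq_zero_of_48 {k : Type*} [CommRing k] (hp : (3449 : k) = 0) {a b c d : k}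
    (h : GCrit (48) a b c d) : c ^ 9 = 0 := by
  linear_combination (-405 * a ^ 6 + 1425 * a ^ 5 * b - 474 * a ^ 5 * c + 176 * a ^ 5 * d
    - 304 * a ^ 4 * b ^ 2 - 1530 * a ^ 4 * b * c - 720 * a ^ 4 * b * d + 405 * a ^ 4 * c ^ 2
    - 316 * a ^ 4 * c * d + 1680 * a ^ 4 * d ^ 2 + 122 * a ^ 3 * b ^ 3 + 1219 * a ^ 3 * b ^ 2 * c
    + 159 * a ^ 3 * b ^ 2 * d + 961 * a ^ 3 * b * c ^ 2 - 913 * a ^ 3 * b * c * d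
    + 1532 * a ^ 3 * b * d ^ 2 + 361 * a ^ 3 * c ^ 3 + 1320 * a ^ 3 * c ^ 2 * d
    - 480 * a ^ 3 * c * d ^ 2 - 1475 * a ^ 3 * d ^ 3 - 1178 * a ^ 2 * b ^ 4
    - 47 * a ^ 2 * b ^ 3 * c - 678 * a ^ 2 * b ^ 3 * d - 241 * a ^ 2 * b ^ 2 * c ^ 2
    + 422 * a ^ 2 * b ^ 2 * c * d + 331 * a ^ 2 * b ^ 2 * d ^ 2 - 13 * a ^ 2 * b * c ^ 3
    - 657 * a ^ 2 * b * c ^ 2 * d - 1082 * a ^ 2 * b * c * d ^ 2 + 92 * a ^ 2 * b * d ^ 3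
    - 1341 * a ^ 2 * c ^ 4 + 87 * a ^ 2 * c ^ 3 * d - 897 * a ^ 2 * c ^ 2 * d ^ 2
    - 1653 * a ^ 2 * c * d ^ 3 - 1690 * a ^ 2 * d ^ 4 - 137 * a * b ^ 5 + 1636 * a * b ^ 4 * c
    - 590 * a * b ^ 4 * d - 956 * a * b ^ 3 * c ^ 2 - 1566 * a * b ^ 3 * c * d
    - 915 * a * b ^ 3 * d ^ 2 - 1155 * a * b ^ 2 * c ^ 3 + 294 * a * b ^ 2 * c ^ 2 * d
    + 916 * a * b ^ 2 * c * d ^ 2 - 1106 * a * b ^ 2 * d ^ 3 - 720 * a * b * c ^ 4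
    - 1466 * a * b * c ^ 3 * d - 661 * a * b * c ^ 2 * d ^ 2 + 474 * a * b * c * d ^ 3
    + 470 * a * b * d ^ 4 - 1139 * a * c ^ 5 - 648 * a * c ^ 4 * d - 1069 * a * c ^ 3 * d ^ 2
    - 383 * a * c ^ 2 * d ^ 3 - 347 * a * c * d ^ 4 + 1299 * a * d ^ 5 + 266 * b ^ 6
    + 1508 * b ^ 5 * c + 1107 * b ^ 5 * d + 795 * b ^ 4 * c ^ 2 + 1114 * b ^ 4 * c * d
    + 195 * b ^ 4 * d ^ 2 + 1576 * b ^ 3 * c ^ 3 + 661 * b ^ 3 * c ^ 2 * d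
    - 269 * b ^ 3 * c * d ^ 2 - 343 * b ^ 3 * d ^ 3 + 621 * b ^ 2 * c ^ 4
    - 212 * b ^ 2 * c ^ 3 * d + 1090 * b ^ 2 * c ^ 2 * d ^ 2 - 941 * b ^ 2 * c * d ^ 3
    + 239 * b ^ 2 * d ^ 4 + 1575 * b * c ^ 5 + 435 * b * c ^ 4 * d + 523 * b * c ^ 3 * d ^ 2
    - 1030 * b * c ^ 2 * d ^ 3 + 1254 * b * c * d ^ 4 + 433 * b * d ^ 5 + 379 * c ^ 6
    - 1489 * c ^ 5 * d + 1553 * c ^ 4 * d ^ 2 + 1553 * c ^ 3 * d ^ 3 + 1553 * c ^ 2 * d ^ 4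
    - 1508 * c * d ^ 5) * h.eq₀ + (1057 * a ^ 6 + 92 * a ^ 5 * b - 1467 * a ^ 5 * c
    + 633 * a ^ 5 * d - 194 * a ^ 4 * b ^ 2 - 126 * a ^ 4 * b * c - 595 * a ^ 4 * b * d
    - 563 * a ^ 4 * c ^ 2 + 47 * a ^ 4 * c * d - 951 * a ^ 4 * d ^ 2 + 378 * a ^ 3 * b ^ 3
    - 83 * a ^ 3 * b ^ 2 * c - 1074 * a ^ 3 * b ^ 2 * d + 1209 * a ^ 3 * b * c ^ 2
    + 1722 * a ^ 3 * b * c * d + 1184 * a ^ 3 * b * d ^ 2 + 1494 * a ^ 3 * c ^ 3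
    - 1532 * a ^ 3 * c ^ 2 * d - 1558 * a ^ 3 * d ^ 3 + 1564 * a ^ 2 * b ^ 4
    + 350 * a ^ 2 * b ^ 3 * c + 1510 * a ^ 2 * b ^ 3 * d - 239 * a ^ 2 * b ^ 2 * c ^ 2
    + 967 * a ^ 2 * b ^ 2 * c * d - 908 * a ^ 2 * b ^ 2 * d ^ 2 + 1204 * a ^ 2 * b * c ^ 3
    - 558 * a ^ 2 * b * c ^ 2 * d - 52 * a ^ 2 * b * d ^ 3 - 1665 * a ^ 2 * c ^ 4
    - 975 * a ^ 2 * c ^ 3 * d - 1436 * a ^ 2 * d ^ 4 + 1539 * a * b ^ 5 - 1135 * a * b ^ 4 * c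
    - 1082 * a * b ^ 4 * d + 1234 * a * b ^ 3 * c ^ 2 + 331 * a * b ^ 3 * c * d
    + 1614 * a * b ^ 3 * d ^ 2 - 1228 * a * b ^ 2 * c ^ 3 + 759 * a * b ^ 2 * c ^ 2 * d
    + 1561 * a * b ^ 2 * d ^ 3 + 927 * a * b * c ^ 4 - 192 * a * b * c ^ 3 * d
    + 1071 * a * b * d ^ 4 - 803 * a * c ^ 5 - 704 * a * c ^ 4 * d - 1477 * a * d ^ 5
    + 1539 * b ^ 5 * c - 1539 * b ^ 5 * d + 750 * b ^ 4 * c ^ 2 + 144 * b ^ 4 * c * d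
    + 1016 * b ^ 4 * d ^ 2 + 494 * b ^ 3 * c ^ 3 - 1008 * b ^ 3 * c ^ 2 * d - 149 * b ^ 3 * d ^ 3
    + 233 * b ^ 2 * c ^ 4 + 844 * b ^ 2 * c ^ 3 * d + 239 * b ^ 2 * d ^ 4 - 387 * b * c ^ 5
    + 827 * b * c ^ 4 * d - 1508 * b * d ^ 5 - 1721 * c ^ 6 + 222 * c ^ 5 * d
    - 1508 * d ^ 6) * h.eq₁ + (-467 * a ^ 6 + 863 * a ^ 5 * b - 1503 * a ^ 5 * c - 14 * a ^ 5 * d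
    + 58 * a ^ 4 * b ^ 2 + 866 * a ^ 4 * b * c + 1489 * a ^ 4 * b * d - 1628 * a ^ 4 * c ^ 2
    + 1503 * a ^ 4 * c * d + 668 * a ^ 4 * d ^ 2 + 1253 * a ^ 3 * b ^ 3 + 1087 * a ^ 3 * b ^ 2 * c
    - 216 * a ^ 3 * b ^ 2 * d + 1223 * a ^ 3 * b * c ^ 2 + 577 * a ^ 3 * b * c * d
    - 1244 * a ^ 3 * c ^ 3 + 1229 * a ^ 3 * c ^ 2 * d - 1715 * a ^ 3 * d ^ 3 - 871 * a ^ 2 * b ^ 4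
    - 802 * a ^ 2 * b ^ 3 * c - 73 * a ^ 2 * b ^ 3 * d + 1305 * a ^ 2 * b ^ 2 * c ^ 2
    - 569 * a ^ 2 * b ^ 2 * c * d + 209 * a ^ 2 * b * c ^ 3 + 56 * a ^ 2 * c ^ 4
    + 1244 * a ^ 2 * c ^ 3 * d + 1565 * a ^ 2 * d ^ 4 + 948 * a * b ^ 5 - 742 * a * b ^ 4 * c
    + 1335 * a * b ^ 4 * d + 1703 * a * b ^ 3 * c ^ 2 + 159 * a * b ^ 2 * c ^ 3
    + 1588 * a * b * c ^ 4 - 629 * a * c ^ 5 + 847 * a * c ^ 4 * d - 1477 * a * d ^ 5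
    + 105 * b ^ 6 + 175 * b ^ 5 * c + 1296 * b ^ 5 * d + 1014 * b ^ 3 * c ^ 3
    + 1532 * b ^ 2 * c ^ 4 - 629 * b * c ^ 5 - 75 * c ^ 6 + 629 * c ^ 5 * d
    - 1508 * d ^ 6) * h.eq₂ + (-1030 * a ^ 6 + 725 * a ^ 5 * b + 1075 * a ^ 5 * c
    - 1061 * a ^ 5 * d - 5 * a ^ 4 * b * c + 104 * a ^ 4 * b * d + 900 * a ^ 4 * c * d
    - 171 * a ^ 4 * d ^ 2 + 1357 * a ^ 3 * b ^ 3 + 756 * a ^ 3 * b ^ 2 * c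
    + 96 * a ^ 3 * b ^ 2 * d + 1466 * a ^ 3 * b * c ^ 2 + 1437 * a ^ 3 * b * c * d
    + 1376 * a ^ 3 * c ^ 3 + 1481 * a ^ 3 * d ^ 3 - 96 * a ^ 2 * b ^ 4 - 261 * a ^ 2 * b ^ 3 * c
    - 235 * a ^ 2 * b ^ 3 * d + 1617 * a ^ 2 * b ^ 2 * c ^ 2 - 534 * a ^ 2 * b ^ 2 * c * d
    + 1428 * a ^ 2 * d ^ 4 + 1498 * a * b ^ 5 - 9 * a * b ^ 4 * c - 647 * a * d ^ 5) * h.eq₃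
    - (2 * a ^ 8 * b - a ^ 8 * c + a ^ 8 * d + a ^ 7 * b ^ 2 - 2 * a ^ 7 * b * c
    - 2 * a ^ 7 * b * d - 2 * a ^ 7 * c ^ 2 + 2 * a ^ 7 * c * d + 2 * a ^ 7 * d ^ 2
    + a ^ 6 * b ^ 3 + a ^ 6 * b ^ 2 * c - a ^ 6 * b ^ 2 * d - 3 * a ^ 6 * b * c ^ 2
    + 2 * a ^ 6 * b * c * d + 2 * a ^ 6 * b * d ^ 2 + 5 * a ^ 6 * c ^ 3 + 6 * a ^ 6 * c ^ 2 * d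
    - 2 * a ^ 6 * c * d ^ 2 - 6 * a ^ 6 * d ^ 3 - a ^ 5 * b ^ 4 - 2 * a ^ 5 * b ^ 3 * d
    - a ^ 5 * b ^ 2 * c ^ 2 - 2 * a ^ 5 * b ^ 2 * c * d + 4 * a ^ 5 * b ^ 2 * d ^ 2
    - 13 * a ^ 5 * b * c ^ 3 + 2 * a ^ 5 * b * c ^ 2 * d + a ^ 5 * b * c * d ^ 2
    - 6 * a ^ 5 * b * d ^ 3 + 18 * a ^ 5 * c ^ 4 + a ^ 5 * c ^ 3 * d - 3 * a ^ 5 * c ^ 2 * d ^ 2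
    - 4 * a ^ 5 * c * d ^ 3 - 2 * a ^ 5 * d ^ 4 - a ^ 4 * b ^ 5 + a ^ 4 * b ^ 4 * c
    - a ^ 4 * b ^ 4 * d - 3 * a ^ 4 * b ^ 3 * c * d - 3 * a ^ 4 * b ^ 2 * c ^ 3
    - 3 * a ^ 4 * b ^ 2 * c ^ 2 * d + 3 * a ^ 4 * b ^ 2 * c * d ^ 2 - 5 * a ^ 4 * b ^ 2 * d ^ 3
    - 13 * a ^ 4 * b * c ^ 4 - 22 * a ^ 4 * b * c ^ 3 * d - 3 * a ^ 4 * b * c ^ 2 * d ^ 2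
    - 8 * a ^ 4 * b * c * d ^ 3 + 5 * a ^ 4 * b * d ^ 4 + 18 * a ^ 4 * c ^ 5
    - 19 * a ^ 4 * c ^ 4 * d - 12 * a ^ 4 * c ^ 3 * d ^ 2 - 3 * a ^ 4 * c ^ 2 * d ^ 3
    + 5 * a ^ 4 * c * d ^ 4 + a ^ 4 * d ^ 5 + 2 * a ^ 3 * b ^ 5 * c - a ^ 3 * b ^ 5 * d
    + 3 * a ^ 3 * b ^ 4 * c ^ 2 + 2 * a ^ 3 * b ^ 4 * d ^ 2 - 15 * a ^ 3 * b ^ 3 * c ^ 3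
    - 4 * a ^ 3 * b ^ 3 * c ^ 2 * d + a ^ 3 * b ^ 3 * c * d ^ 2 + a ^ 3 * b ^ 3 * d ^ 3
    - 15 * a ^ 3 * b ^ 2 * c ^ 4 + 2 * a ^ 3 * b ^ 2 * c ^ 3 * d - 3 * a ^ 3 * b ^ 2 * c * d ^ 3
    + a ^ 3 * b ^ 2 * d ^ 4 - 18 * a ^ 3 * b * c ^ 5 - 9 * a ^ 3 * b * c ^ 4 * d
    - 2 * a ^ 3 * b * c ^ 3 * d ^ 2 + 2 * a ^ 3 * b * c ^ 2 * d ^ 3 + 8 * a ^ 3 * b * c * d ^ 4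
    + a ^ 3 * b * d ^ 5 + 14 * a ^ 3 * c ^ 6 - 15 * a ^ 3 * c ^ 5 * d + 2 * a ^ 3 * c ^ 4 * d ^ 2
    + 28 * a ^ 3 * c ^ 3 * d ^ 3 + 3 * a ^ 3 * c ^ 2 * d ^ 4 + 2 * a ^ 3 * c * d ^ 5
    + 3 * a ^ 3 * d ^ 6 + a ^ 2 * b ^ 7 + 2 * a ^ 2 * b ^ 6 * c + 2 * a ^ 2 * b ^ 6 * d
    + 4 * a ^ 2 * b ^ 5 * c ^ 2 - 2 * a ^ 2 * b ^ 5 * c * d - a ^ 2 * b ^ 5 * d ^ 2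
    + 16 * a ^ 2 * b ^ 4 * c ^ 3 - 4 * a ^ 2 * b ^ 4 * c ^ 2 * d + a ^ 2 * b ^ 4 * c * d ^ 2
    - 2 * a ^ 2 * b ^ 4 * d ^ 3 + 11 * a ^ 2 * b ^ 3 * c ^ 4 + 3 * a ^ 2 * b ^ 3 * c ^ 2 * d ^ 2
    - 2 * a ^ 2 * b ^ 3 * c * d ^ 3 + a ^ 2 * b ^ 3 * d ^ 4 - 16 * a ^ 2 * b ^ 2 * c ^ 5
    + 6 * a ^ 2 * b ^ 2 * c ^ 4 * d + 2 * a ^ 2 * b ^ 2 * c ^ 2 * d ^ 3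
    + a ^ 2 * b ^ 2 * c * d ^ 4 - a ^ 2 * b ^ 2 * d ^ 5 - 5 * a ^ 2 * b * c ^ 6
    + a ^ 2 * b * c ^ 5 * d + 3 * a ^ 2 * b * c ^ 4 * d ^ 2 + 3 * a ^ 2 * b * c ^ 3 * d ^ 3
    + 3 * a ^ 2 * b * c ^ 2 * d ^ 4 - 2 * a ^ 2 * b * c * d ^ 5 - 2 * a ^ 2 * c ^ 7
    - 14 * a ^ 2 * c ^ 6 * d + 2 * a ^ 2 * c ^ 5 * d ^ 2 + a ^ 2 * c ^ 4 * d ^ 3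
    - 20 * a ^ 2 * c ^ 3 * d ^ 4 - 2 * a ^ 2 * c ^ 2 * d ^ 5 - a ^ 2 * c * d ^ 6
    + 3 * a ^ 2 * d ^ 7 + a * b ^ 8 - a * b ^ 7 * d + 4 * a * b ^ 6 * c ^ 2
    - 2 * a * b ^ 6 * c * d - a * b ^ 6 * d ^ 2 - 10 * a * b ^ 5 * c ^ 3
    - 5 * a * b ^ 5 * c ^ 2 * d + 3 * a * b ^ 5 * d ^ 3 + 14 * a * b ^ 4 * c ^ 4
    - 23 * a * b ^ 4 * c ^ 3 * d + a * b ^ 4 * c ^ 2 * d ^ 2 - 4 * a * b ^ 4 * c * d ^ 3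
    + a * b ^ 4 * d ^ 4 - 21 * a * b ^ 3 * c ^ 5 - 4 * a * b ^ 3 * c ^ 4 * d
    + a * b ^ 3 * c ^ 3 * d ^ 2 - 4 * a * b ^ 3 * c ^ 2 * d ^ 3 + 3 * a * b ^ 3 * c * d ^ 4
    - 2 * a * b ^ 3 * d ^ 5 - a * b ^ 2 * c ^ 6 - 2 * a * b ^ 2 * c ^ 5 * d
    - 2 * a * b ^ 2 * c ^ 3 * d ^ 3 + 4 * a * b ^ 2 * c ^ 2 * d ^ 4 - 3 * a * b ^ 2 * c * d ^ 5
    - 22 * a * b * c ^ 7 + a * b * c ^ 5 * d ^ 2 + a * b * c ^ 3 * d ^ 4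
    - 5 * a * b * c ^ 2 * d ^ 5 + a * b * c * d ^ 6 + 2 * a * b * d ^ 7 + 8 * a * c ^ 8
    - 10 * a * c ^ 7 * d + a * c ^ 6 * d ^ 2 - a * c ^ 5 * d ^ 3 - 2 * a * c ^ 4 * d ^ 4
    + 17 * a * c ^ 3 * d ^ 5 + a * c ^ 2 * d ^ 6 + 3 * a * c * d ^ 7 - 2 * a * d ^ 8 + b ^ 8 * c
    - b ^ 8 * d + b ^ 7 * c ^ 2 - 3 * b ^ 6 * c ^ 2 * d - b ^ 6 * c * d ^ 2 + b ^ 6 * d ^ 3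
    - b ^ 5 * c ^ 4 - 19 * b ^ 5 * c ^ 3 * d - b ^ 5 * c * d ^ 3 + b ^ 4 * c ^ 5
    - 3 * b ^ 4 * c ^ 4 * d + b ^ 4 * c ^ 3 * d ^ 2 + b ^ 4 * c * d ^ 4 - b ^ 4 * d ^ 5
    - 14 * b ^ 3 * c ^ 6 - 2 * b ^ 3 * c ^ 5 * d + b ^ 3 * c ^ 4 * d ^ 2
    - 2 * b ^ 3 * c ^ 3 * d ^ 3 + 2 * b ^ 3 * c ^ 2 * d ^ 4 - b ^ 3 * c * d ^ 5 - b ^ 3 * d ^ 6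
    - 20 * b ^ 2 * c ^ 7 - b ^ 2 * c ^ 6 * d - b ^ 2 * c ^ 4 * d ^ 3 + 2 * b ^ 2 * c ^ 3 * d ^ 4
    - 3 * b ^ 2 * c ^ 2 * d ^ 5 + b ^ 2 * c * d ^ 6 + b ^ 2 * d ^ 7 + 8 * b * c ^ 8
    + 2 * b * c ^ 6 * d ^ 2 - b * c ^ 5 * d ^ 3 - 2 * b * c ^ 3 * d ^ 5 + 2 * b * c ^ 2 * d ^ 6
    + b * c * d ^ 7 + c ^ 9 - 8 * c ^ 8 * d - c ^ 6 * d ^ 3 + 21 * c ^ 3 * d ^ 6) * hp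

/-! ### Elimination in the `x`-equations and the degenerate cases -/

/-- The partial derivatives of `f` have no common zero with `x₂ = 0` except the origin. -/
theorem eq_zero_of_xCrit {k : Type*} [Field k] (hp : (3449 : k) = 0) {a b d : k}
    (h₀ : 10 * a ^ 3 + a * b ^ 2 + 8 * a * b * d + 4 * a * d ^ 2 = 0)
    (h₁ : 2 * a ^ 2 * b + 8 * a ^ 2 * d + b ^ 3 = 0)
    (h₂ : 4 * a ^ 2 * b + 2 * a ^ 2 * d + b ^ 2 * d + 2 * b * d ^ 2 = 0)
    (h₃ : 8 * a ^ 2 * b + 8 * a ^ 2 * d + 4 * d ^ 3 = 0) :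
    a = 0 ∧ b = 0 ∧ d = 0 := by
  -- Four cubics in only three variables: the fifth power of each variable already lies in their
  -- ideal modulo 3449, with quadratic cofactors.
  have ha : a ^ 5 = 0 := by
    linear_combination (345 * a ^ 2 + 297 * b ^ 2 + 800 * b * d - 182 * d ^ 2) * h₀
      + (-297 * a * b + 91 * a * d) * h₁ + (182 * a * b - 872 * a * d) * h₂ + (182 * a * d) * h₃
      - (a ^ 5 + a ^ 3 * b ^ 2 + 2 * a ^ 3 * b * d + a * b ^ 3 * d + 2 * a * b ^ 2 * d ^ 2) * hp
  have hb : b ^ 5 = 0 := by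
    linear_combination (765 * a * b - 1150 * a * d) * h₀ + (-767 * a ^ 2 + b ^ 2 - 958 * b * d
      + 575 * d ^ 2) * h₁ + (-1529 * a ^ 2 + 958 * b ^ 2 + 958 * b * d) * h₂ + (-479 * b ^ 2) * h₃
      - (-6 * a ^ 4 * d + a ^ 2 * b ^ 2 * d - 4 * a ^ 2 * b * d ^ 2 + b ^ 3 * d ^ 2) * hp
  have hd : d ^ 5 = 0 := by
    linear_combination (-958 * a * b - 575 * a * d) * h₀ + (-1341 * a ^ 2 + 479 * b * d
      - 575 * d ^ 2) * h₁ + (1341 * a ^ 2 - 479 * b ^ 2 + 1533 * b * d) * h₂ + (958 * b ^ 2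
      - 862 * d ^ 2) * h₃ - (-2 * a ^ 4 * b - 4 * a ^ 4 * d + a ^ 2 * b ^ 3
      + 2 * a ^ 2 * b ^ 2 * d - 2 * a ^ 2 * b * d ^ 2 - 4 * a ^ 2 * d ^ 3 + 2 * b ^ 2 * d ^ 3
      - d ^ 5) * hp
  exact ⟨eq_zero_of_pow_eq_zero ha, eq_zero_of_pow_eq_zero hb, eq_zero_of_pow_eq_zero hd⟩

/-- The partial derivatives of `g` have no common zero with `y₂ = 0` except the origin. -/
theorem eq_zero_of_yCrit {k : Type*} [Field k] (hp : (3449 : k) = 0) {a b d : k}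
    (h₀ : 4 * a ^ 3 + 3 * a ^ 2 * b - 3 * a ^ 2 * d + a * b ^ 2 - 4 * a * b * d - a * d ^ 2
      - b ^ 2 * d + b * d ^ 2 = 0)
    (h₁ : a ^ 3 + a ^ 2 * b - 2 * a ^ 2 * d - 2 * a * b * d + a * d ^ 2 + 2 * b ^ 3 - b * d ^ 2 =
      0)
    (h₂ : a ^ 3 + 2 * a ^ 2 * b - 2 * a ^ 2 * d + a * b ^ 2 - 3 * a * b * d + a * d ^ 2
      - b ^ 2 * d + b * d ^ 2 = 0)
    (h₃ : -a ^ 3 - 2 * a ^ 2 * b - a ^ 2 * d - a * b ^ 2 + 2 * a * b * d - b ^ 2 * d + 6 * d ^ 3 =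
      0) :
    a = 0 ∧ b = 0 ∧ d = 0 := by
  have ha : a ^ 5 = 0 := by
    linear_combination (-1323 * a ^ 2 - 252 * a * b + 1197 * a * d + 608 * b ^ 2 - 865 * b * d
      - 735 * d ^ 2) * h₀ + (526 * a ^ 2 - 735 * a * b - 1514 * a * d - 127 * b * d
      + 988 * d ^ 2) * h₁ + (-1269 * a ^ 2 - 899 * a * b + 756 * a * d + 1723 * d ^ 2) * h₂
      + (862 * a ^ 2 - 1724 * a * d - 862 * b ^ 2) * h₃ - (-2 * a ^ 5 - 3 * a ^ 4 * b
      + 3 * a ^ 4 * d - a ^ 3 * b ^ 2 + 5 * a ^ 3 * b * d + a ^ 2 * b ^ 3 + 2 * a ^ 2 * b ^ 2 * d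
      - 2 * a ^ 2 * b * d ^ 2 - 2 * a * b ^ 3 * d + a * b ^ 2 * d ^ 2 - 2 * a * d ^ 4
      + b ^ 3 * d ^ 2 - 2 * b ^ 2 * d ^ 3) * hp
  have hb : b ^ 5 = 0 := by
    linear_combination (-332 * a ^ 2 - 929 * a * b + 903 * a * d + 451 * b ^ 2 - 1724 * b * d
      + 1498 * d ^ 2) * h₀ + (-902 * a ^ 2 + 1499 * a * b + 1128 * a * d - 1724 * b ^ 2
      - 1499 * b * d - 225 * d ^ 2) * h₁ + (506 * a ^ 2 + 1380 * a * b + 370 * a * d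
      - 1723 * d ^ 2) * h₂ + (-1724 * a ^ 2 - 1724 * a * b + 1724 * a * d) * h₃ - (a ^ 4 * b
      + 2 * a ^ 4 * d + 2 * a ^ 3 * b ^ 2 - 3 * a ^ 3 * b * d - a ^ 3 * d ^ 2
      - 3 * a ^ 2 * b ^ 2 * d + 3 * a ^ 2 * b * d ^ 2 - 3 * a ^ 2 * d ^ 3 + a * b ^ 4
      + a * b ^ 3 * d + a * b ^ 2 * d ^ 2 - 3 * a * b * d ^ 3 + 2 * a * d ^ 4 - b ^ 5 - b ^ 4 * d
      + b ^ 3 * d ^ 2) * hp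
  have hd : d ^ 5 = 0 := by
    linear_combination (-196 * a ^ 2 - 1004 * a * b + 614 * a * d + 316 * b ^ 2 + 285 * b * d
      + 1709 * d ^ 2) * h₀ + (535 * a ^ 2 - 589 * a * b + 1205 * a * d - 273 * b * d
      + 1709 * d ^ 2) * h₁ + (-1188 * a ^ 2 + 711 * a * b - 94 * a * d) * h₂ + (-1437 * a ^ 2
      - 862 * b ^ 2 + 575 * d ^ 2) * h₃ - (-a ^ 4 * b + 2 * a ^ 4 * d + 2 * a ^ 3 * b * d
      + a ^ 3 * d ^ 2 + a ^ 2 * b ^ 3 + 2 * a ^ 2 * b ^ 2 * d - 5 * a ^ 2 * d ^ 3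
      - 3 * a * b * d ^ 3 + b ^ 3 * d ^ 2 - 2 * b ^ 2 * d ^ 3 + d ^ 5) * hp
  exact ⟨eq_zero_of_pow_eq_zero ha, eq_zero_of_pow_eq_zero hb, eq_zero_of_pow_eq_zero hd⟩

/-- The values of `∂f/∂x₂` at the zeros with `x₀ = 0` of `∂f/∂x₁` and `∂f/∂x₃`. -/
theorem ratio_of_x₀_eq_zero {k : Type*} [Field k] (hp : (3449 : k) = 0) {b c d e : k}
    (h₁ : b ^ 3 + 2 * b * c ^ 2 + 2 * b * c * d + 2 * c * d ^ 2 = 0)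
    (h₃ : b ^ 2 * c + 4 * b * c * d + 2 * c ^ 2 * d + 4 * d ^ 3 = 0)
    (he : e = 2 * b ^ 2 * c + b ^ 2 * d + 2 * b * d ^ 2 + 2 * c * d ^ 2) :
    e = 0 ∨ e = 858 * c ^ 3 ∨ e = -70 * c ^ 3 ∨ e = 1600 * c ^ 3 ∨ e = 1427 * c ^ 3 ∨ e =
      -376 * c ^ 3 := by
  -- The two cubics have no nontrivial common zero with `c = 0`, since there they reduce to `b³` and
  -- `4d³`. They therefore meet in finitely many points of the plane, and `e / c³` takes finitely
  -- many values. The prime is such that all these values lie in the prime field, so the eliminant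
  -- is this product of linear factors. The factor `e` accounts for the common zeros of `bc + d²`
  -- and `b² + 2cd`, because `e = 2b(bc + d²) + d(b² + 2cd)`.
  have key : e * (e - (858) * c ^ 3) * (e - (-70) * c ^ 3) * (e - (1600) * c ^ 3) * (e - (1427) * c ^ 3) * (e - (-376) * c ^ 3) = 0 := by
    subst he
    linear_combination (1234 * b ^ 14 * c + 609 * b ^ 13 * c ^ 2 + 662 * b ^ 13 * c * d
      - 503 * b ^ 12 * c ^ 3 - 1093 * b ^ 12 * c ^ 2 * d + 128 * b ^ 12 * c * d ^ 2
      + 1487 * b ^ 12 * d ^ 3 - 1409 * b ^ 11 * c ^ 4 - 745 * b ^ 11 * c ^ 3 * d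
      + 1136 * b ^ 11 * c ^ 2 * d ^ 2 - 262 * b ^ 11 * c * d ^ 3 + 149 * b ^ 11 * d ^ 4
      + 60 * b ^ 10 * c ^ 5 + 1561 * b ^ 10 * c ^ 4 * d - 980 * b ^ 10 * c ^ 3 * d ^ 2
      - 185 * b ^ 10 * c ^ 2 * d ^ 3 + 109 * b ^ 10 * c * d ^ 4 - 84 * b ^ 10 * d ^ 5
      + 680 * b ^ 9 * c ^ 6 - 1394 * b ^ 9 * c ^ 5 * d + 1204 * b ^ 9 * c ^ 4 * d ^ 2
      - 166 * b ^ 9 * c ^ 3 * d ^ 3 + 168 * b ^ 9 * c ^ 2 * d ^ 4 + 454 * b ^ 9 * c * d ^ 5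
      - 108 * b ^ 9 * d ^ 6 - 456 * b ^ 8 * c ^ 7 + 1284 * b ^ 8 * c ^ 6 * d
      - 670 * b ^ 8 * c ^ 5 * d ^ 2 + 996 * b ^ 8 * c ^ 4 * d ^ 3 + 346 * b ^ 8 * c ^ 3 * d ^ 4
      + 1080 * b ^ 8 * c ^ 2 * d ^ 5 + 74 * b ^ 8 * c * d ^ 6 + 264 * b ^ 8 * d ^ 7
      - 1103 * b ^ 7 * c ^ 8 - 911 * b ^ 7 * c ^ 7 * d + 259 * b ^ 7 * c ^ 6 * d ^ 2
      + 1150 * b ^ 7 * c ^ 5 * d ^ 3 + 513 * b ^ 7 * c ^ 4 * d ^ 4 + 1536 * b ^ 7 * c ^ 3 * d ^ 5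
      + 676 * b ^ 7 * c ^ 2 * d ^ 6 + 992 * b ^ 7 * c * d ^ 7 + 112 * b ^ 7 * d ^ 8
      + 1371 * b ^ 6 * c ^ 9 + 1311 * b ^ 6 * c ^ 8 * d - 1488 * b ^ 6 * c ^ 7 * d ^ 2
      + 543 * b ^ 6 * c ^ 6 * d ^ 3 + 1499 * b ^ 6 * c ^ 5 * d ^ 4 - 1329 * b ^ 6 * c ^ 4 * d ^ 5
      + 1616 * b ^ 6 * c ^ 3 * d ^ 6 + 1360 * b ^ 6 * c ^ 2 * d ^ 7 + 672 * b ^ 6 * c * d ^ 8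
      + 288 * b ^ 6 * d ^ 9 + 139 * b ^ 5 * c ^ 10 + 993 * b ^ 5 * c ^ 9 * d
      + 1265 * b ^ 5 * c ^ 8 * d ^ 2 + 1281 * b ^ 5 * c ^ 7 * d ^ 3 - 1339 * b ^ 5 * c ^ 6 * d ^ 4
      + 1430 * b ^ 5 * c ^ 5 * d ^ 5 - 785 * b ^ 5 * c ^ 4 * d ^ 6 + 1144 * b ^ 5 * c ^ 3 * d ^ 7
      + 1520 * b ^ 5 * c ^ 2 * d ^ 8 + 480 * b ^ 5 * c * d ^ 9 + 192 * b ^ 5 * d ^ 10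
      - 1213 * b ^ 4 * c ^ 11 - 525 * b ^ 4 * c ^ 10 * d - 451 * b ^ 4 * c ^ 9 * d ^ 2
      - 1559 * b ^ 4 * c ^ 8 * d ^ 3 - 1712 * b ^ 4 * c ^ 7 * d ^ 4 + 332 * b ^ 4 * c ^ 6 * d ^ 5
      - 107 * b ^ 4 * c ^ 5 * d ^ 6 + 736 * b ^ 4 * c ^ 4 * d ^ 7 - 1345 * b ^ 4 * c ^ 3 * d ^ 8
      + 320 * b ^ 4 * c ^ 2 * d ^ 9 + 480 * b ^ 4 * c * d ^ 10 + 844 * b ^ 3 * c ^ 12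
      + 1525 * b ^ 3 * c ^ 11 * d + 1187 * b ^ 3 * c ^ 10 * d ^ 2 - 210 * b ^ 3 * c ^ 9 * d ^ 3
      + 1648 * b ^ 3 * c ^ 8 * d ^ 4 + 144 * b ^ 3 * c ^ 7 * d ^ 5 - 545 * b ^ 3 * c ^ 6 * d ^ 6
      + 64 * b ^ 3 * c ^ 5 * d ^ 7 - 1289 * b ^ 3 * c ^ 4 * d ^ 8 + 640 * b ^ 3 * c ^ 2 * d ^ 10
      - 1321 * b ^ 2 * c ^ 12 * d - 278 * b ^ 2 * c ^ 11 * d ^ 2 - 1387 * b ^ 2 * c ^ 10 * d ^ 3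
      + 835 * b ^ 2 * c ^ 9 * d ^ 4 - 220 * b ^ 2 * c ^ 8 * d ^ 5 - 1637 * b ^ 2 * c ^ 7 * d ^ 6
      - 336 * b ^ 2 * c ^ 6 * d ^ 7 + 1632 * b ^ 2 * c ^ 5 * d ^ 8 - 96 * b ^ 2 * c ^ 4 * d ^ 9
      + 480 * b ^ 2 * c ^ 3 * d ^ 10 - 1512 * b * c ^ 14 - 838 * b * c ^ 13 * d
      + 1468 * b * c ^ 12 * d ^ 2 - 135 * b * c ^ 11 * d ^ 3 + 135 * b * c ^ 10 * d ^ 4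
      - 270 * b * c ^ 9 * d ^ 5 + 920 * b * c ^ 8 * d ^ 6 - 160 * b * c ^ 7 * d ^ 7
      + 768 * b * c ^ 6 * d ^ 8 - 32 * b * c ^ 5 * d ^ 9 + 192 * b * c ^ 4 * d ^ 10
      + 838 * c ^ 13 * d ^ 2 + 135 * c ^ 11 * d ^ 4 + 270 * c ^ 9 * d ^ 6 + 160 * c ^ 7 * d ^ 8
      + 32 * c ^ 5 * d ^ 10) * h₁ + (-1234 * b ^ 15 - 609 * b ^ 14 * c + 825 * b ^ 14 * d
      + 1484 * b ^ 13 * c ^ 2 + 80 * b ^ 13 * c * d + 21 * b ^ 13 * d ^ 2 + 191 * b ^ 12 * c ^ 3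
      + 383 * b ^ 12 * c ^ 2 * d - 835 * b ^ 12 * d ^ 3 + 946 * b ^ 11 * c ^ 4
      + 1348 * b ^ 11 * c ^ 3 * d - 63 * b ^ 11 * d ^ 4 - 1247 * b ^ 10 * c ^ 5
      - 1721 * b ^ 10 * c ^ 4 * d - 13 * b ^ 10 * d ^ 5 + 336 * b ^ 9 * c ^ 6
      - 1430 * b ^ 9 * c ^ 5 * d - 32 * b ^ 9 * d ^ 6 + 63 * b ^ 8 * c ^ 7
      + 840 * b ^ 8 * c ^ 6 * d + 12 * b ^ 8 * d ^ 7 - 459 * b ^ 7 * c ^ 8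
      - 442 * b ^ 7 * c ^ 7 * d + 48 * b ^ 7 * d ^ 8 - 842 * b ^ 6 * c ^ 9
      - 1073 * b ^ 6 * c ^ 8 * d + 16 * b ^ 6 * d ^ 9 - 1529 * b ^ 5 * c ^ 10
      - 553 * b ^ 5 * c ^ 9 * d - 852 * b ^ 4 * c ^ 11 + 967 * b ^ 4 * c ^ 10 * d
      - 1023 * b ^ 3 * c ^ 12 + 916 * b ^ 3 * c ^ 11 * d - 1099 * b ^ 2 * c ^ 13
      + 973 * b ^ 2 * c ^ 12 * d - 1263 * b * c ^ 13 * d - 1512 * c ^ 14 * d) * h₃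
      - (-b ^ 16 * c * d + b ^ 15 * c ^ 3 - b ^ 15 * c ^ 2 * d + b ^ 15 * c * d ^ 2
      - b ^ 15 * d ^ 3 + 2 * b ^ 14 * c ^ 3 * d + 2 * b ^ 14 * c ^ 2 * d ^ 2 - b ^ 14 * c * d ^ 3
      + b ^ 14 * d ^ 4 + b ^ 13 * c ^ 4 * d + 3 * b ^ 13 * c ^ 2 * d ^ 3 - b ^ 12 * c ^ 6
      - b ^ 12 * c ^ 5 * d + 2 * b ^ 12 * c ^ 4 * d ^ 2 + b ^ 12 * c * d ^ 5 - b ^ 12 * d ^ 6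
      - 2 * b ^ 11 * c ^ 5 * d ^ 2 + 2 * b ^ 11 * c ^ 3 * d ^ 4 + 32 * b ^ 10 * c ^ 8
      + 79 * b ^ 10 * c ^ 7 * d + 77 * b ^ 10 * c ^ 6 * d ^ 2 + 40 * b ^ 10 * c ^ 5 * d ^ 3
      + 7 * b ^ 10 * c ^ 4 * d ^ 4 + b ^ 10 * c ^ 3 * d ^ 5 + b ^ 9 * c ^ 8 * d
      + 160 * b ^ 9 * c ^ 7 * d ^ 2 + 319 * b ^ 9 * c ^ 6 * d ^ 3 + 239 * b ^ 9 * c ^ 5 * d ^ 4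
      + 79 * b ^ 9 * c ^ 4 * d ^ 5 + 10 * b ^ 9 * c ^ 3 * d ^ 6 - 14725 * b ^ 8 * c ^ 10
      - 29450 * b ^ 8 * c ^ 9 * d - 21927 * b ^ 8 * c ^ 8 * d ^ 2 - 7041 * b ^ 8 * c ^ 7 * d ^ 3
      - 361 * b ^ 8 * c ^ 6 * d ^ 4 + 560 * b ^ 8 * c ^ 5 * d ^ 5 + 249 * b ^ 8 * c ^ 4 * d ^ 6
      + 40 * b ^ 8 * c ^ 3 * d ^ 7 - 58899 * b ^ 7 * c ^ 9 * d ^ 2 - 88347 * b ^ 7 * c ^ 8 * d ^ 3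
      - 43534 * b ^ 7 * c ^ 7 * d ^ 4 - 6404 * b ^ 7 * c ^ 6 * d ^ 5 + 797 * b ^ 7 * c ^ 5 * d ^ 6
      + 400 * b ^ 7 * c ^ 4 * d ^ 7 + 79 * b ^ 7 * c ^ 3 * d ^ 8 - 267682 * b ^ 6 * c ^ 12
      - 401524 * b ^ 6 * c ^ 11 * d - 259657 * b ^ 6 * c ^ 10 * d ^ 2
      - 121804 * b ^ 6 * c ^ 9 * d ^ 3 - 132200 * b ^ 6 * c ^ 8 * d ^ 4
      - 95228 * b ^ 6 * c ^ 7 * d ^ 5 - 20889 * b ^ 6 * c ^ 6 * d ^ 6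
      + 996 * b ^ 6 * c ^ 5 * d ^ 7 + 399 * b ^ 6 * c ^ 4 * d ^ 8 + 80 * b ^ 6 * c ^ 3 * d ^ 9
      - b ^ 5 * c ^ 13 - 3 * b ^ 5 * c ^ 12 * d - 803046 * b ^ 5 * c ^ 11 * d ^ 2
      - 803049 * b ^ 5 * c ^ 10 * d ^ 3 - 377453 * b ^ 5 * c ^ 9 * d ^ 4
      - 176690 * b ^ 5 * c ^ 8 * d ^ 5 - 102113 * b ^ 5 * c ^ 7 * d ^ 6
      - 28490 * b ^ 5 * c ^ 6 * d ^ 7 + 876 * b ^ 5 * c ^ 5 * d ^ 8 + 318 * b ^ 5 * c ^ 4 * d ^ 9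
      + 32 * b ^ 5 * c ^ 3 * d ^ 10 + 864315853 * b ^ 4 * c ^ 14 + 864315853 * b ^ 4 * c ^ 13 * d
      + 215275920 * b ^ 4 * c ^ 12 * d ^ 2 - 803047 * b ^ 4 * c ^ 11 * d ^ 3
      - 1092151 * b ^ 4 * c ^ 10 * d ^ 4 - 489868 * b ^ 4 * c ^ 9 * d ^ 5
      - 198458 * b ^ 4 * c ^ 8 * d ^ 6 - 88026 * b ^ 4 * c ^ 7 * d ^ 7
      - 13688 * b ^ 4 * c ^ 6 * d ^ 8 + 478 * b ^ 4 * c ^ 5 * d ^ 9 + 158 * b ^ 4 * c ^ 4 * d ^ 10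
      - 3 * b ^ 3 * c ^ 14 * d + 1728631708 * b ^ 3 * c ^ 13 * d ^ 2
      + 864315852 * b ^ 3 * c ^ 12 * d ^ 3 - 1606091 * b ^ 3 * c ^ 11 * d ^ 4
      - 803046 * b ^ 3 * c ^ 10 * d ^ 5 - 444372 * b ^ 3 * c ^ 9 * d ^ 6
      - 88346 * b ^ 3 * c ^ 8 * d ^ 7 - 58258 * b ^ 3 * c ^ 7 * d ^ 8
      + 320 * b ^ 3 * c ^ 6 * d ^ 9 + 318 * b ^ 3 * c ^ 5 * d ^ 10 + 29898811824 * b ^ 2 * c ^ 16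
      + 14949405910 * b ^ 2 * c ^ 15 * d + 1728631706 * b ^ 2 * c ^ 14 * d ^ 2
      + 864315852 * b ^ 2 * c ^ 13 * d ^ 3 + 863512808 * b ^ 2 * c ^ 12 * d ^ 4
      - 401524 * b ^ 2 * c ^ 11 * d ^ 5 - 861942 * b ^ 2 * c ^ 10 * d ^ 6
      - 29448 * b ^ 2 * c ^ 9 * d ^ 7 - 88186 * b ^ 2 * c ^ 8 * d ^ 8 + 80 * b ^ 2 * c ^ 7 * d ^ 9
      + 320 * b ^ 2 * c ^ 6 * d ^ 10 + 29898811822 * b * c ^ 15 * d ^ 2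
      + 1728631706 * b * c ^ 13 * d ^ 4 - 803046 * b * c ^ 11 * d ^ 6 - 58896 * b * c ^ 9 * d ^ 8
      + 160 * b * c ^ 7 * d ^ 10 + 29898811824 * c ^ 16 * d ^ 2 + 864315852 * c ^ 14 * d ^ 4
      - 267682 * c ^ 12 * d ^ 6 - 14724 * c ^ 10 * d ^ 8 + 32 * c ^ 8 * d ^ 10) * hp
  simpa only [mul_eq_zero, sub_eq_zero, or_assoc] using key

/-- The values of `∂f/∂x₂` at the zeros of `∂f/∂x₁` and `∂f/∂x₃`, after elimination of `x₀²`. -/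
theorem ratio_of_x₀_ne_zero {k : Type*} [Field k] (hp : (3449 : k) = 0) {b c d e : k}
    (h₁ : 4 * b ^ 3 - 6 * b ^ 2 * c - 12 * b ^ 2 * d - 24 * b * c * d - 36 * b * d ^ 2 - 4 * c ^ 3
      - 12 * c ^ 2 * d - 6 * c * d ^ 2 - 16 * d ^ 3 = 0)
    (h₃ : -4 * b ^ 3 - 12 * b ^ 2 * c - 36 * b ^ 2 * d - 12 * b * c ^ 2 - 12 * b * c * d
      - 48 * b * d ^ 2 - 2 * c ^ 3 - 12 * c * d ^ 2 + 4 * d ^ 3 = 0)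
    (he : e = -2 * b ^ 3 - 12 * b ^ 2 * d - 12 * b * c ^ 2 - 24 * b * c * d - 6 * b * d ^ 2
      - 4 * c ^ 3 - 6 * c ^ 2 * d - 4 * d ^ 3) :
    e = 0 ∨ e = -627 * c ^ 3 ∨ e = 322 * c ^ 3 ∨ e = -1382 * c ^ 3 := by
  -- Again the eliminant of `e / c³` splits into linear factors modulo 3449. Here `e` is five times
  -- an eighth of `∂f/∂x₂` after `x₀²` has been eliminated, so the constants are five times the
  -- ratios `v` used later.
  have key : e * (e - (-627) * c ^ 3) * (e - (322) * c ^ 3) * (e - (-1382) * c ^ 3) = 0 := by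
    subst he
    linear_combination (1193 * b ^ 9 - 497 * b ^ 8 * c - 486 * b ^ 8 * d - 1661 * b ^ 7 * c ^ 2
      + 929 * b ^ 7 * c * d - 1658 * b ^ 7 * d ^ 2 - 346 * b ^ 6 * c ^ 3
      + 1253 * b ^ 6 * c ^ 2 * d - 546 * b ^ 6 * c * d ^ 2 - 809 * b ^ 6 * d ^ 3
      - 1179 * b ^ 5 * c ^ 4 - 1717 * b ^ 5 * c ^ 3 * d - 1277 * b ^ 5 * c ^ 2 * d ^ 2
      + 1350 * b ^ 5 * c * d ^ 3 + 1597 * b ^ 5 * d ^ 4 - 1532 * b ^ 4 * c ^ 5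
      - 1042 * b ^ 4 * c ^ 4 * d - 978 * b ^ 4 * c ^ 3 * d ^ 2 - 1454 * b ^ 4 * c ^ 2 * d ^ 3
      - 29 * b ^ 4 * c * d ^ 4 - 38 * b ^ 4 * d ^ 5 - 1390 * b ^ 3 * c ^ 6
      - 204 * b ^ 3 * c ^ 5 * d - 379 * b ^ 3 * c ^ 4 * d ^ 2 + 1450 * b ^ 3 * c ^ 3 * d ^ 3
      + 551 * b ^ 3 * c ^ 2 * d ^ 4 - 485 * b ^ 3 * c * d ^ 5 - 1346 * b ^ 3 * d ^ 6
      - 589 * b ^ 2 * c ^ 7 - 1703 * b ^ 2 * c ^ 6 * d - 1281 * b ^ 2 * c ^ 5 * d ^ 2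
      + 1409 * b ^ 2 * c ^ 4 * d ^ 3 - 559 * b ^ 2 * c ^ 3 * d ^ 4 + 1105 * b ^ 2 * c ^ 2 * d ^ 5
      - 1180 * b ^ 2 * c * d ^ 6 - 261 * b ^ 2 * d ^ 7 + 412 * b * c ^ 8 + 534 * b * c ^ 7 * d
      - 476 * b * c ^ 6 * d ^ 2 + 609 * b * c ^ 5 * d ^ 3 + 317 * b * c ^ 4 * d ^ 4
      - 374 * b * c ^ 3 * d ^ 5 - 909 * b * c ^ 2 * d ^ 6 - 351 * b * c * d ^ 7 - 60 * b * d ^ 8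
      + 1605 * c ^ 9 + 1140 * c ^ 8 * d + 1321 * c ^ 7 * d ^ 2 - 634 * c ^ 6 * d ^ 3
      - 1115 * c ^ 5 * d ^ 4 + 899 * c ^ 4 * d ^ 5 + 1219 * c ^ 3 * d ^ 6 + 776 * c ^ 2 * d ^ 7
      + 6 * c * d ^ 8 - 16 * d ^ 9) * h₁ + (1189 * b ^ 9 - 680 * b ^ 8 * c - 1066 * b ^ 8 * d
      - 814 * b ^ 7 * c ^ 2 + 1550 * b ^ 7 * c * d + 722 * b ^ 7 * d ^ 2 + 1284 * b ^ 6 * c ^ 3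
      - 1688 * b ^ 6 * c ^ 2 * d + 1595 * b ^ 6 * c * d ^ 2 + 1352 * b ^ 5 * c ^ 4
      + 1009 * b ^ 5 * c ^ 3 * d - 1414 * b ^ 5 * c ^ 2 * d ^ 2 + 1093 * b ^ 4 * c ^ 5
      + 328 * b ^ 4 * c ^ 4 * d - 1579 * b ^ 4 * c ^ 3 * d ^ 2 + 742 * b ^ 3 * c ^ 6
      - 771 * b ^ 3 * c ^ 5 * d - 671 * b ^ 3 * c ^ 4 * d ^ 2 - 1266 * b ^ 2 * c ^ 7
      - 261 * b ^ 2 * c ^ 6 * d - 773 * b ^ 2 * c ^ 5 * d ^ 2 - 1341 * b * c ^ 8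
      - 52 * b * c ^ 7 * d + 241 * b * c ^ 6 * d ^ 2 + 361 * c ^ 9 + 986 * c ^ 8 * d
      + 767 * c ^ 7 * d ^ 2) * h₃ - (-6 * b ^ 11 * c - 16 * b ^ 11 * d - 2 * b ^ 10 * c ^ 2
      - 20 * b ^ 10 * d ^ 2 + 8 * b ^ 9 * c ^ 3 + 14 * b ^ 9 * c ^ 2 * d - 10 * b ^ 9 * c * d ^ 2
      + 8 * b ^ 9 * d ^ 3 - 4 * b ^ 8 * c ^ 4 + 66 * b ^ 8 * c ^ 3 * d
      + 10 * b ^ 8 * c ^ 2 * d ^ 2 - 54 * b ^ 8 * c * d ^ 3 + 62 * b ^ 7 * c ^ 5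
      + 122 * b ^ 7 * c ^ 4 * d + 388 * b ^ 7 * c ^ 3 * d ^ 2 - 62 * b ^ 7 * c ^ 2 * d ^ 3
      - 94 * b ^ 7 * c * d ^ 4 - 8 * b ^ 7 * d ^ 5 - 244 * b ^ 6 * c ^ 6 + 844 * b ^ 6 * c ^ 5 * d
      + 1578 * b ^ 6 * c ^ 4 * d ^ 2 + 1106 * b ^ 6 * c ^ 3 * d ^ 3 - 214 * b ^ 6 * c ^ 2 * d ^ 4
      - 114 * b ^ 6 * c * d ^ 5 - 36 * b ^ 6 * d ^ 6 + 416 * b ^ 5 * c ^ 7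
      - 1122 * b ^ 5 * c ^ 6 * d + 4884 * b ^ 5 * c ^ 5 * d ^ 2 + 5498 * b ^ 5 * c ^ 4 * d ^ 3
      + 1248 * b ^ 5 * c ^ 3 * d ^ 4 - 218 * b ^ 5 * c ^ 2 * d ^ 5 - 98 * b ^ 5 * c * d ^ 6
      - 20 * b ^ 5 * d ^ 7 - 2776 * b ^ 4 * c ^ 8 - 2634 * b ^ 4 * c ^ 7 * d
      + 1000 * b ^ 4 * c ^ 6 * d ^ 2 + 13930 * b ^ 4 * c ^ 5 * d ^ 3
      + 5130 * b ^ 4 * c ^ 4 * d ^ 4 + 1282 * b ^ 4 * c ^ 3 * d ^ 5 - 182 * b ^ 4 * c ^ 2 * d ^ 6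
      - 38 * b ^ 4 * c * d ^ 7 + 4 * b ^ 4 * d ^ 8 - 161920 * b ^ 3 * c ^ 9
      - 13006 * b ^ 3 * c ^ 8 * d - 19426 * b ^ 3 * c ^ 7 * d ^ 2 + 7342 * b ^ 3 * c ^ 6 * d ^ 3
      + 8476 * b ^ 3 * c ^ 5 * d ^ 4 + 4368 * b ^ 3 * c ^ 4 * d ^ 5 + 808 * b ^ 3 * c ^ 3 * d ^ 6
      - 72 * b ^ 3 * c ^ 2 * d ^ 7 - 8 * b ^ 3 * c * d ^ 8 + 4 * b ^ 3 * d ^ 9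
      - 8326 * b ^ 2 * c ^ 10 - 1008674 * b ^ 2 * c ^ 9 * d - 44950 * b ^ 2 * c ^ 8 * d ^ 2
      - 8954 * b ^ 2 * c ^ 7 * d ^ 3 - 1824 * b ^ 2 * c ^ 6 * d ^ 4 + 5268 * b ^ 2 * c ^ 5 * d ^ 5
      + 1588 * b ^ 2 * c ^ 4 * d ^ 6 + 458 * b ^ 2 * c ^ 3 * d ^ 7 - 20 * b ^ 2 * c ^ 2 * d ^ 8
      + 2 * b ^ 2 * c * d ^ 9 - 976610 * b * c ^ 11 - 1961564 * b * c ^ 10 * d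
      - 504366 * b * c ^ 9 * d ^ 2 - 8504 * b * c ^ 8 * d ^ 3 - 9984 * b * c ^ 7 * d ^ 4
      - 1094 * b * c ^ 6 * d ^ 5 + 690 * b * c ^ 5 * d ^ 6 + 536 * b * c ^ 4 * d ^ 7
      + 118 * b * c ^ 3 * d ^ 8 - 6 * b * c ^ 2 * d ^ 9 - 324582 * c ^ 12 - 488312 * c ^ 11 * d
      - 2092 * c ^ 10 * d ^ 2 - 325448 * c ^ 9 * d ^ 3 - 2782 * c ^ 8 * d ^ 4
      + 208 * c ^ 7 * d ^ 5 - 926 * c ^ 6 * d ^ 6 + 138 * c ^ 5 * d ^ 7 - 10 * c ^ 4 * d ^ 8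
      + 24 * c ^ 3 * d ^ 9 - 4 * c ^ 2 * d ^ 10) * hp
  simpa only [mul_eq_zero, sub_eq_zero, or_assoc] using key

/-! ### Nonsingularity in characteristic 3449 -/

/-- The ratio `v` turns the coupling term into a multiple of `y₂³`. The `x₂`-equation yields `y₂² =
(1 + 2v) x₂²`, hence `2 y₂ (x₂² - y₂²) = -4v x₂² y₂ = t y₂³`, so the `y`-coordinates satisfy `GCrit
t`. The element `n` witnesses that `1 + 2v` is invertible. -/
theorem HCrit.x₂_eq_zero_of_ratio {k : Type*} [Field k] {x₀ x₁ x₂ x₃ y₀ y₁ y₂ y₃ v t n : k}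
    (h : HCrit x₀ x₁ x₂ x₃ y₀ y₁ y₂ y₃)
    (hv : 4 * x₀ ^ 2 * x₁ + 4 * x₀ ^ 2 * x₂ + 2 * x₀ ^ 2 * x₃ + 2 * x₁ ^ 2 * x₂ + x₁ ^ 2 * x₃
      + 2 * x₁ * x₃ ^ 2 + 2 * x₂ * x₃ ^ 2 = v * x₂ ^ 3)
    (hn : n * (1 + 2 * v) = 1) (ht : t * (1 + 2 * v) = -4 * v)
    (hg : GCrit t y₀ y₁ y₂ y₃ → y₂ ^ 9 = 0) : x₂ = 0 := by
  by_contra hx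
  have hy : y₂ ^ 2 = (1 + 2 * v) * x₂ ^ 2 :=
    mul_left_cancel₀ hx (by linear_combination 2 * hv - h.eqx₂)
  have hy₂ : y₂ = 0 := eq_zero_of_pow_eq_zero (hg
    ⟨h.eqy₀, h.eqy₁, by linear_combination h.eqy₂ - (t + 2) * y₂ * hy - y₂ * x₂ ^ 2 * ht, h.eqy₃⟩)
  -- With `y₂ = 0` the relation `hy` reads `(1 + 2v) x₂² = 0`, and `n` cancels the factor.
  refine hx (pow_eq_zero_iff two_ne_zero |>.mp ?_)
  linear_combination n * y₂ * hy₂ - n * hy - x₂ ^ 2 * hn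

/-- In characteristic `3449`, the form `h` defines a nonsingular hypersurface. -/
theorem HCrit.eq_zero {k : Type*} [Field k] (hp : (3449 : k) = 0)
    {x₀ x₁ x₂ x₃ y₀ y₁ y₂ y₃ : k} (h : HCrit x₀ x₁ x₂ x₃ y₀ y₁ y₂ y₃) :
    x₀ = 0 ∧ x₁ = 0 ∧ x₂ = 0 ∧ x₃ = 0 ∧ y₀ = 0 ∧ y₁ = 0 ∧ y₂ = 0 ∧ y₃ = 0 := by
  have hx₂ : x₂ = 0 := by
    -- The `x₀`-equation is `x₀` times a quadratic form in which `x₀` enters only as `10 x₀²`. So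
    -- either `x₀ = 0`, or `x₀²` can be eliminated from the other equations.
    by_cases hx₀ : x₀ = 0
    · rcases ratio_of_x₀_eq_zero hp (b := x₁) (c := x₂) (d := x₃) (e := 2 * x₁ ^ 2 * x₂ + x₁ ^ 2 * x₃ + 2 * x₁ * x₃ ^ 2 + 2 * x₂ * x₃ ^ 2)
        (by linear_combination h.eqx₁ - (2 * x₀ * x₁ + 4 * x₀ * x₂ + 8 * x₀ * x₃) * hx₀)
        (by linear_combination h.eqx₃ - (8 * x₀ * x₁ + 2 * x₀ * x₂ + 8 * x₀ * x₃) * hx₀) rfl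
        with he | he | he | he | he | he
      -- In each case `n` is the inverse of `1 + 2v` modulo 3449 and `t` is the residue of `-4 v n`.
      -- The multiples of `hp` are the quotients in these congruences.
      · exact h.x₂_eq_zero_of_ratio (v := 0) (t := 0) (n := 1) (by linear_combination he + (4 * x₀ * x₁ + 4 * x₀ * x₂ + 2 * x₀ * x₃) * hx₀)
          (by linear_combination (0) * hp) (by linear_combination (0) * hp)
          (GCrit.pow_nine_eq_zero_of_0 hp)
      · exact h.x₂_eq_zero_of_ratio (v := 858) (t := -922) (n := -460) (by linear_combination he + (4 * x₀ * x₁ + 4 * x₀ * x₂ + 2 * x₀ * x₃) * hx₀)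
          (by linear_combination (-229) * hp) (by linear_combination (-458) * hp)
          (GCrit.pow_nine_eq_zero_of_neg_922 hp)
      · exact h.x₂_eq_zero_of_ratio (v := -70) (t := 792) (n := 397) (by linear_combination he + (4 * x₀ * x₁ + 4 * x₀ * x₂ + 2 * x₀ * x₃) * hx₀)
          (by linear_combination (-16) * hp) (by linear_combination (-32) * hp)
          (GCrit.pow_nine_eq_zero_of_792 hp)
      · exact h.x₂_eq_zero_of_ratio (v := 1600) (t := -753) (n := 1349) (by linear_combination he + (4 * x₀ * x₁ + 4 * x₀ * x₂ + 2 * x₀ * x₃) * hx₀)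
          (by linear_combination (1252) * hp) (by linear_combination (-697) * hp)
          (GCrit.pow_nine_eq_zero_of_neg_753 hp)
      · exact h.x₂_eq_zero_of_ratio (v := 1427) (t := -362) (n := -180) (by linear_combination he + (4 * x₀ * x₁ + 4 * x₀ * x₂ + 2 * x₀ * x₃) * hx₀)
          (by linear_combination (-149) * hp) (by linear_combination (-298) * hp)
          (GCrit.pow_nine_eq_zero_of_neg_362 hp)
      · exact h.x₂_eq_zero_of_ratio (v := -376) (t := -250) (n := -124) (by linear_combination he + (4 * x₀ * x₁ + 4 * x₀ * x₂ + 2 * x₀ * x₃) * hx₀)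
          (by linear_combination (27) * hp) (by linear_combination (54) * hp)
          (GCrit.pow_nine_eq_zero_of_neg_250 hp)
    · have hN : 10 * x₀ ^ 2 + (x₁ ^ 2 + 4 * x₁ * x₂ + 8 * x₁ * x₃ + 2 * x₂ ^ 2 + 2 * x₂ * x₃ + 4 * x₃ ^ 2) = 0 :=
        mul_left_cancel₀ hx₀ (by linear_combination h.eqx₀)
      rcases ratio_of_x₀_ne_zero hp (b := x₁) (c := x₂) (d := x₃)
        (e := -2 * x₁ ^ 3 - 12 * x₁ ^ 2 * x₃ - 12 * x₁ * x₂ ^ 2 - 24 * x₁ * x₂ * x₃ - 6 * x₁ * x₃ ^ 2 - 4 * x₂ ^ 3 - 6 * x₂ ^ 2 * x₃ - 4 * x₃ ^ 3)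
        -- The factor 5 makes every occurrence of `x₀²` a multiple of `10 x₀²`, which `hN` then
        -- replaces.
        (by linear_combination 5 * h.eqx₁ - (x₁ + 2 * x₂ + 4 * x₃) * hN)
        (by linear_combination 5 * h.eqx₃ - (4 * x₁ + x₂ + 4 * x₃) * hN) rfl
        with he | he | he | he
      -- Since `690 · 5 = 3449 + 1`, multiplication by 690 undoes the factor 5, and `v` is 690 times
      -- the constant in `he`, reduced modulo 3449.
      · exact h.x₂_eq_zero_of_ratio (v := 0) (t := 0) (n := 1) (by linear_combination (690) * (he + (2 * x₁ + 2 * x₂ + x₃) * hN) - (1) * (4 * x₀ ^ 2 * x₁ + 4 * x₀ ^ 2 * x₂ + 2 * x₀ ^ 2 * x₃ + 2 * x₁ ^ 2 * x₂ + x₁ ^ 2 * x₃ + 2 * x₁ * x₃ ^ 2 + 2 * x₂ * x₃ ^ 2) * hp + (0) * x₂ ^ 3 * hp)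
          (by linear_combination (0) * hp) (by linear_combination (0) * hp)
          (GCrit.pow_nine_eq_zero_of_0 hp)
      · exact h.x₂_eq_zero_of_ratio (v := -1505) (t := 484) (n := 243) (by linear_combination (690) * (he + (2 * x₁ + 2 * x₂ + x₃) * hN) - (1) * (4 * x₀ ^ 2 * x₁ + 4 * x₀ ^ 2 * x₂ + 2 * x₀ ^ 2 * x₃ + 2 * x₁ ^ 2 * x₂ + x₁ ^ 2 * x₃ + 2 * x₁ * x₃ ^ 2 + 2 * x₂ * x₃ ^ 2) * hp + (-125) * x₂ ^ 3 * hp)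
          (by linear_combination (-212) * hp) (by linear_combination (-424) * hp)
          (GCrit.pow_nine_eq_zero_of_484 hp)
      · exact h.x₂_eq_zero_of_ratio (v := 1444) (t := 1587) (n := -930) (by linear_combination (690) * (he + (2 * x₁ + 2 * x₂ + x₃) * hN) - (1) * (4 * x₀ ^ 2 * x₁ + 4 * x₀ ^ 2 * x₂ + 2 * x₀ ^ 2 * x₃ + 2 * x₁ ^ 2 * x₂ + x₁ ^ 2 * x₃ + 2 * x₁ * x₃ ^ 2 + 2 * x₂ * x₃ ^ 2) * hp + (64) * x₂ ^ 3 * hp)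
          (by linear_combination (-779) * hp) (by linear_combination (1331) * hp)
          (GCrit.pow_nine_eq_zero_of_1587 hp)
      · exact h.x₂_eq_zero_of_ratio (v := -1656) (t := 48) (n := 25) (by linear_combination (690) * (he + (2 * x₁ + 2 * x₂ + x₃) * hN) - (1) * (4 * x₀ ^ 2 * x₁ + 4 * x₀ ^ 2 * x₂ + 2 * x₀ ^ 2 * x₃ + 2 * x₁ ^ 2 * x₂ + x₁ ^ 2 * x₃ + 2 * x₁ * x₃ ^ 2 + 2 * x₂ * x₃ ^ 2) * hp + (-276) * x₂ ^ 3 * hp)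
          (by linear_combination (-24) * hp) (by linear_combination (-48) * hp)
          (GCrit.pow_nine_eq_zero_of_48 hp)
  -- With `x₂ = 0` the coupling term disappears from the `x`-equations, and in the `y₂`-equation it
  -- becomes `-2 y₂³`, that is, `t = -2`.
  subst hx₂
  obtain ⟨rfl, rfl, rfl⟩ := eq_zero_of_xCrit hp (a := x₀) (b := x₁) (d := x₃)
    (by linear_combination h.eqx₀) (by linear_combination h.eqx₁)
    -- 1725 is the inverse of 2 modulo 3449.
    (by linear_combination 1725 * h.eqx₂ - (1) * (4 * x₀ ^ 2 * x₁ + 2 * x₀ ^ 2 * x₃ + x₁ ^ 2 * x₃ + 2 * x₁ * x₃ ^ 2) * hp) (by linear_combination h.eqx₃)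
  have hy₂ : y₂ = 0 := eq_zero_of_pow_eq_zero
    (GCrit.pow_nine_eq_zero_of_neg_2 hp ⟨h.eqy₀, h.eqy₁, by linear_combination h.eqy₂, h.eqy₃⟩)
  subst hy₂
  obtain ⟨rfl, rfl, rfl⟩ := eq_zero_of_yCrit hp (a := y₀) (b := y₁) (d := y₃)
    (by linear_combination h.eqy₀) (by linear_combination h.eqy₁)
    (by linear_combination h.eqy₂) (by linear_combination h.eqy₃)
  simp

/-! ### Specialization from characteristic zero to characteristic 3449 -/

/-- The condition `HCrit` for a point with coordinates indexed by `Var`. -/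
def HCritAt {k : Type*} [CommRing k] (z : Var → k) : Prop :=
  HCrit (z (.inl 0)) (z (.inl 1)) (z (.inl 2)) (z (.inl 3))
    (z (.inr 0)) (z (.inr 1)) (z (.inr 2)) (z (.inr 3))

theorem HCritAt.map {R S : Type*} [CommRing R] [CommRing S] (φ : R →+* S) {z : Var → R}
    (h : HCritAt z) : HCritAt fun i => φ (z i) where
  eqx₀ := by simpa [map_ofNat] using congrArg φ h.eqx₀
  eqx₁ := by simpa [map_ofNat] using congrArg φ h.eqx₁
  eqx₂ := by simpa [map_ofNat] using congrArg φ h.eqx₂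
  eqx₃ := by simpa [map_ofNat] using congrArg φ h.eqx₃
  eqy₀ := by simpa [map_ofNat] using congrArg φ h.eqy₀
  eqy₁ := by simpa [map_ofNat] using congrArg φ h.eqy₁
  eqy₂ := by simpa [map_ofNat] using congrArg φ h.eqy₂
  eqy₃ := by simpa [map_ofNat] using congrArg φ h.eqy₃

theorem HCritAt.of_map {R S : Type*} [CommRing R] [CommRing S] {φ : R →+* S}
    (hφ : Function.Injective φ) {z : Var → R} (h : HCritAt fun i => φ (z i)) : HCritAt z where
  eqx₀ := hφ (by simpa [map_ofNat] using h.eqx₀)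
  eqx₁ := hφ (by simpa [map_ofNat] using h.eqx₁)
  eqx₂ := hφ (by simpa [map_ofNat] using h.eqx₂)
  eqx₃ := hφ (by simpa [map_ofNat] using h.eqx₃)
  eqy₀ := hφ (by simpa [map_ofNat] using h.eqy₀)
  eqy₁ := hφ (by simpa [map_ofNat] using h.eqy₁)
  eqy₂ := hφ (by simpa [map_ofNat] using h.eqy₂)
  eqy₃ := hφ (by simpa [map_ofNat] using h.eqy₃)

theorem HCritAt.smul {k : Type*} [CommRing k] (c : k) {z : Var → k} (h : HCritAt z) :
    HCritAt fun i => c * z i where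
  eqx₀ := by linear_combination c ^ 3 * h.eqx₀
  eqx₁ := by linear_combination c ^ 3 * h.eqx₁
  eqx₂ := by linear_combination c ^ 3 * h.eqx₂
  eqx₃ := by linear_combination c ^ 3 * h.eqx₃
  eqy₀ := by linear_combination c ^ 3 * h.eqy₀
  eqy₁ := by linear_combination c ^ 3 * h.eqy₁
  eqy₂ := by linear_combination c ^ 3 * h.eqy₂
  eqy₃ := by linear_combination c ^ 3 * h.eqy₃

theorem HCritAt.eq_zero_of_char {k : Type*} [Field k] (hp : (3449 : k) = 0) {z : Var → k}
    (h : HCritAt z) : z = 0 := by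
  obtain ⟨h0, h1, h2, h3, h4, h5, h6, h7⟩ := HCrit.eq_zero hp h
  funext i
  rcases i with i | i <;> fin_cases i <;> assumption

/-- A field of characteristic zero has a valuation subring in which `p` is not a unit. -/
theorem exists_valuationSubring_natCast_mem_maximalIdeal (K : Type*) [Field K] [CharZero K]
    {p : ℕ} (hp : p ≠ 1) :
    ∃ B : ValuationSubring K, (p : B) ∈ IsLocalRing.maximalIdeal B := by
  -- In characteristic zero the prime subring is a copy of `ℤ`, where `p ≠ 1` is not a unit.
  have hI : Ideal.span {(p : (Int.castRingHom K).range)} ≠ ⊤ := by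
    intro h
    rw [Ideal.span_singleton_eq_top] at h
    obtain ⟨⟨_, n, rfl⟩, hn⟩ := h.exists_right_inv
    have h1 : ((p * n : ℤ) : K) = ((1 : ℤ) : K) := by
      have := congrArg (Subtype.val) hn
      push_cast
      simpa using this
    have h2 : (p : ℤ) * n = 1 := by exact_mod_cast h1
    have := Int.natAbs_dvd_natAbs.mpr (Dvd.intro _ h2)
    exact hp (by simpa using this)
  -- Chevalley's extension theorem: a proper ideal of a subring lies in the nonunits of some
  -- valuation subring containing that subring.
  obtain ⟨B, -, hB⟩ := Ideal.image_subset_nonunits_valuationSubring _ hI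
  refine ⟨B, ?_⟩
  have hpB : (p : K) ∈ B.nonunits :=
    hB ⟨_, Ideal.mem_span_singleton_self _, by simp⟩
  rw [← SetLike.mem_coe, ← ValuationSubring.image_maximalIdeal] at hpB
  obtain ⟨b, hb, hbp⟩ := hpB
  have : b = (p : B) := Subtype.ext (by simpa using hbp)
  exact this ▸ hb

/-- This is the valuative form of the properness of projective space. The equations are homogeneous
with integer coefficients, so a nonzero solution can be scaled to a primitive one over a valuation
ring and then reduced, and the reduction is a nonzero solution over the residue field. -/
theorem HCritAt.eq_zero {K : Type*} [Field K] [CharZero K] {z : Var → K} (h : HCritAt z) :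
    z = 0 := by
  by_contra hz
  obtain ⟨B, hB⟩ := exists_valuationSubring_natCast_mem_maximalIdeal K (p := 3449) (by norm_num)
  -- Division by a coordinate of largest valuation makes every coordinate integral and the `j`-th
  -- one equal to 1.
  obtain ⟨j, hj⟩ := Finite.exists_max fun i => B.valuation (z i)
  have hzj : z j ≠ 0 := by
    intro h0
    refine hz (funext fun i => ?_)
    have := hj i
    simpa [h0] using this
  have hmem : ∀ i, (z j)⁻¹ * z i ∈ B := fun i => by
    rw [← B.valuation_le_one_iff, map_mul, map_inv₀, mul_comm]
    exact (mul_inv_le_iff₀ (by simpa [zero_lt_iff] using hzj)).mpr (by simpa using hj i)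
  have hcrit : HCritAt fun i => (⟨(z j)⁻¹ * z i, hmem i⟩ : B) :=
    HCritAt.of_map (φ := B.subtype) B.subtype_injective (h.smul (z j)⁻¹)
  have hchar : (3449 : IsLocalRing.ResidueField B) = 0 := by
    have := (IsLocalRing.residue_eq_zero_iff _).mpr hB
    rw [map_natCast] at this
    exact_mod_cast this
  have := congrFun ((hcrit.map (IsLocalRing.residue B)).eq_zero_of_char hchar) j
  have hone : (⟨(z j)⁻¹ * z j, hmem j⟩ : B) = 1 := Subtype.ext (inv_mul_cancel₀ hzj)
  simp [hone] at this

/-! ### From the critical equations to nonsingularity -/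

theorem pderiv_ofNat {σ R : Type*} [CommSemiring R] (i : σ) (n : ℕ) [n.AtLeastTwo] :
    pderiv i (ofNat(n) : MvPolynomial σ R) = 0 :=
  (pderiv i).map_natCast n

/-- The common zeros of the partial derivatives of `h`. -/
theorem hCritAt_of_aeval_pderiv {K : Type*} [Field K] [Algebra ℚ K] {z : Var → K}
    (hz : ∀ i, aeval z (pderiv i h) = 0) : HCritAt z := by
  have := algebraRat.charZero K
  have X0 := hz (.inl 0)
  have X1 := hz (.inl 1)
  have X2 := hz (.inl 2)
  have X3 := hz (.inl 3)
  have Y0 := hz (.inr 0)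
  have Y1 := hz (.inr 1)
  have Y2 := hz (.inr 2)
  have Y3 := hz (.inr 3)
  simp [h, f, g, q₁, q₂, q₃, q₄, r, x, y, pderiv_X, pderiv_ofNat, Derivation.leibniz,
    Derivation.leibniz_pow] at X0 X1 X2 X3 Y0 Y1 Y2 Y3
  constructor
  · linear_combination X0 / 16
  · linear_combination X1 / 8
  · linear_combination X2 / 4
  · linear_combination X3 / 8
  · linear_combination Y0 / 2
  · linear_combination Y1 / 2
  · linear_combination Y2 / 2
  · linear_combination Y3 / 2

theorem eq_zero_of_aeval_pderiv_eq_zero {K : Type*} [Field K] [Algebra ℚ K] {z : Var → K}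
    (hz : ∀ i, aeval z (pderiv i h) = 0) : z = 0 :=
  have := algebraRat.charZero K
  (hCritAt_of_aeval_pderiv hz).eq_zero

theorem not_isSingularPoint {K : Type*} [Field K] [Algebra ℚ K] (P : ℙ K (Var → K)) :
    ¬ IsSingularPoint h P :=
  fun hP => P.rep_nonzero (eq_zero_of_aeval_pderiv_eq_zero hP.2)

/-- By the Nullstellensatz over an algebraic closure of `ℚ`, the radical is the vanishing ideal of
the zero locus. That locus is the origin alone, since a common zero of the derivatives is zero in
every extension field. The polynomials vanishing at the origin are those without constant term. -/
theorem radical_singularIdeal : (singularIdeal h).radical = irrelevantIdeal ℚ Var := by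
  have key : zeroLocus (AlgebraicClosure ℚ) (singularIdeal h) = {0} := by
    refine Set.eq_singleton_iff_unique_mem.mpr ⟨?_, fun z hz => ?_⟩
    · rw [singularIdeal, zeroLocus_span]
      rintro p (rfl | ⟨i, rfl⟩)
      · simp [h, f, g, q₁, q₂, q₃, q₄, r, x, y]
      · rcases i with i | i <;> fin_cases i <;>
          simp [h, f, g, q₁, q₂, q₃, q₄, r, x, y, pderiv_X, pderiv_ofNat,
            Derivation.leibniz, Derivation.leibniz_pow]
    · exact eq_zero_of_aeval_pderiv_eq_zero fun i =>
        hz _ (Ideal.subset_span (Set.mem_insert_of_mem _ ⟨i, rfl⟩))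
  have hrad := vanishingIdeal_zeroLocus_eq_radical (K := AlgebraicClosure ℚ) (singularIdeal h)
  rw [key] at hrad
  refine hrad.symm.trans ?_
  ext p
  rw [mem_vanishingIdeal_singleton_iff]
  have : p ∈ irrelevantIdeal ℚ Var ↔ coeff 0 p = 0 := by
    -- The criterion for membership in the first power of the ideal of the variables: all
    -- coefficients of degree less than 1 vanish.
    have := mem_pow_idealOfVars_iff' (σ := Var) (R := ℚ) 1 p
    rw [pow_one] at this
    simp only [irrelevantIdeal]
    rw [this]
    simp [Finsupp.degree_eq_zero_iff]
  rw [this]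
  simp [aeval_zero, constantCoeff_eq]

/-! ### Homogeneity -/

theorem isHomogeneous_ofNat {σ R : Type*} [CommSemiring R] (n : ℕ) [n.AtLeastTwo] :
    (ofNat(n) : MvPolynomial σ R).IsHomogeneous 0 := by
  rw [← map_ofNat (C : R →+* MvPolynomial σ R) n]
  exact isHomogeneous_C _ _

theorem isHomogeneous_f : f.IsHomogeneous 4 := by
  have hx : ∀ i, (x i).IsHomogeneous 1 := fun i => isHomogeneous_X ℚ _
  have hn : ∀ (n : ℕ) [n.AtLeastTwo], (ofNat(n) : MvPolynomial Var ℚ).IsHomogeneous 0 :=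
    isHomogeneous_ofNat
  exact ((((((((((((((hn _).mul ((hx 0).pow 4))).add
      (((hn _).mul ((hx 0).pow 2)).mul ((hx 1).pow 2))).add
      ((((hn _).mul ((hx 0).pow 2)).mul (hx 1)).mul (hx 2))).add
      ((((hn _).mul ((hx 0).pow 2)).mul (hx 1)).mul (hx 3))).add
      (((hn _).mul ((hx 0).pow 2)).mul ((hx 2).pow 2))).add
      ((((hn _).mul ((hx 0).pow 2)).mul (hx 2)).mul (hx 3))).add
      (((hn _).mul ((hx 0).pow 2)).mul ((hx 3).pow 2))).add
      ((hn _).mul ((hx 1).pow 4))).add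
      (((hn _).mul ((hx 1).pow 2)).mul ((hx 2).pow 2))).add
      ((((hn _).mul ((hx 1).pow 2)).mul (hx 2)).mul (hx 3))).add
      ((((hn _).mul (hx 1)).mul (hx 2)).mul ((hx 3).pow 2))).add
      (((hn _).mul ((hx 2).pow 2)).mul ((hx 3).pow 2))).add
      ((hn _).mul ((hx 3).pow 4))

theorem isHomogeneous_h : h.IsHomogeneous 4 := by
  have hx : ∀ i, (x i).IsHomogeneous 1 := fun i => isHomogeneous_X ℚ _
  have hy : ∀ i, (y i).IsHomogeneous 1 := fun i => isHomogeneous_X ℚ _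
  have hyy : ∀ i j, (y i * y j).IsHomogeneous 2 := fun i j => (hy i).mul (hy j)
  have h₁ : ∀ i j, (y i ^ 2 - y j ^ 2).IsHomogeneous 2 := fun i j =>
    ((hy i).pow 2).sub ((hy j).pow 2)
  have h₄ : q₄.IsHomogeneous 2 :=
    (((((((hy 0).pow 2).neg.sub (hyy 0 1)).sub (hyy 0 2)).add (hyy 0 3)).sub (hyy 1 2)).add
      (hyy 1 3)).add (hyy 2 3)
  have hr : r.IsHomogeneous 2 := ((hx 2).pow 2).sub ((hy 2).pow 2)
  exact (isHomogeneous_f.add (((((h₁ 0 3).pow 2).add ((h₁ 1 3).pow 2)).add ((h₁ 2 3).pow 2)).add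
    (h₄.pow 2))).add (hr.pow 2)

/-! ### Sum of squares over the reals -/

/-- The identity `f = 16 x₀² (x₂ + α x₁ + α² x₃)² + 8 s² + 2 t²` holds for `α³ = 2`. The corrections
`2 - 2α` and `2 - 4α²` in `s` and `t` are chosen so that every `α` cancels in the expansion. -/
theorem isSosOver_real : IsSosOver ℝ h := by
  obtain ⟨α, hα⟩ : ∃ α : ℝ, α ^ 3 = 2 := ⟨2 ^ (1 / 3 : ℝ), by
    rw [← Real.rpow_natCast, ← Real.rpow_mul (by norm_num)]; norm_num⟩
  let X' : Fin 4 → MvPolynomial Var ℝ := fun i => X (.inl i)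
  let Y' : Fin 4 → MvPolynomial Var ℝ := fun i => X (.inr i)
  have hC : (C α : MvPolynomial Var ℝ) ^ 3 = 2 := by rw [← C_pow, hα]; rfl
  let s : MvPolynomial Var ℝ := X' 1 * X' 2 + X' 3 ^ 2 + (2 - 2 * C α) * X' 0 ^ 2
  let t : MvPolynomial Var ℝ := 2 * X' 2 * X' 3 + X' 1 ^ 2 + (2 - 4 * C α ^ 2) * X' 0 ^ 2
  have key : map (algebraMap ℚ ℝ) h =
      (4 * X' 0 * (X' 2 + C α * X' 1 + C α ^ 2 * X' 3)) * (4 * X' 0 * (X' 2 + C α * X' 1 + C α ^ 2 * X' 3))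
      -- The multiples `8 s²` and `2 t²` are written as repeated squares, which avoids square roots
      -- of the coefficients.
      + ((2 * s) * (2 * s) + ((2 * s) * (2 * s) + (t * t + (t * t
      + ((Y' 0 ^ 2 - Y' 3 ^ 2) * (Y' 0 ^ 2 - Y' 3 ^ 2)
      + ((Y' 1 ^ 2 - Y' 3 ^ 2) * (Y' 1 ^ 2 - Y' 3 ^ 2)
      + ((Y' 2 ^ 2 - Y' 3 ^ 2) * (Y' 2 ^ 2 - Y' 3 ^ 2)
      + (map (algebraMap ℚ ℝ) q₄ * map (algebraMap ℚ ℝ) q₄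
      + (X' 2 ^ 2 - Y' 2 ^ 2) * (X' 2 ^ 2 - Y' 2 ^ 2))))))))) := by
    simp only [h, f, g, q₁, q₂, q₃, r, x, y, map_add, map_sub, map_mul, map_pow, map_X,
      map_ofNat, s, t, X', Y']
    linear_combination -(32 * X (.inl 0) ^ 2 * X (.inl 1) * X (.inl 3)
      + 16 * C α * X (.inl 0) ^ 2 * X (.inl 3) ^ 2 + 32 * C α * X (.inl 0) ^ 4) * hC
  rw [IsSosOver, key]
  repeat' first
    | exact .mul_self _
    | exact IsSumSq.add (.mul_self _) (by assumption)
    | apply IsSumSq.add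

/-! ### Reduction to squares of quadratic forms -/

theorem exists_sum_sq_of_isSumSq {R : Type*} [CommSemiring R] {a : R} (ha : IsSumSq a) :
    ∃ (n : ℕ) (p : Fin n → R), a = ∑ i, p i ^ 2 := by
  induction ha with
  | zero => exact ⟨0, ![], by simp⟩
  | sq_add b _ ih =>
    obtain ⟨n, p, rfl⟩ := ih
    exact ⟨n + 1, Fin.cons b p, by simp [Fin.sum_univ_succ, pow_two]⟩

/-- The terms of degree at most `2` of a polynomial, evaluated at a real point. -/
theorem exists_coeff_aeval_eq {σ : Type*} [Fintype σ] (p : MvPolynomial σ ℚ) :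
    ∃ (c : ℚ) (l : σ → ℚ) (m : σ → σ → ℚ), ∀ z : σ → ℝ,
      (aeval (fun j => Polynomial.C (z j) * Polynomial.X) p).coeff 0 = (c : ℝ) ∧
      (aeval (fun j => Polynomial.C (z j) * Polynomial.X) p).coeff 1 = ∑ j, l j * z j ∧
      (aeval (fun j => Polynomial.C (z j) * Polynomial.X) p).coeff 2 =
        ∑ j, ∑ k, m j k * z j * z k := by
  classical
  induction p using MvPolynomial.induction_on with
  | C a =>
    refine ⟨a, 0, 0, fun z => ?_⟩
    have : algebraMap ℚ (Polynomial ℝ) a = Polynomial.C (a : ℝ) := rfl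
    simp [this, Polynomial.coeff_C]
  | add p q hp hq =>
    obtain ⟨c, l, m, hp⟩ := hp
    obtain ⟨c', l', m', hq⟩ := hq
    refine ⟨c + c', l + l', m + m', fun z => ?_⟩
    obtain ⟨h0, h1, h2⟩ := hp z
    obtain ⟨h0', h1', h2'⟩ := hq z
    simp only [map_add, Polynomial.coeff_add, h0, h1, h2, h0', h1', h2']
    simp [add_mul, Finset.sum_add_distrib]
  | mul_X p i hp =>
    obtain ⟨c, l, m, hp⟩ := hp
    -- Multiplication by the variable `i` raises degrees by one: the constant term becomes the
    -- linear coefficient at `i`, and the linear terms become the column `i` of the quadratic part.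
    -- The matrix `m` is not symmetric in general.
    refine ⟨0, fun j => if j = i then c else 0, fun j k => if k = i then l j else 0,
      fun z => ?_⟩
    obtain ⟨h0, h1, -⟩ := hp z
    rw [map_mul, aeval_X, ← mul_assoc]
    refine ⟨by simp, ?_, ?_⟩
    · rw [Polynomial.coeff_mul_X _ 0, Polynomial.coeff_mul_C, h0]
      simp [apply_ite (Rat.cast : ℚ → ℝ)]
    · rw [Polynomial.coeff_mul_X _ 1, Polynomial.coeff_mul_C, h1, Finset.sum_mul]
      simp [apply_ite (Rat.cast : ℚ → ℝ)]

/-- The lowest terms of a sum of real squares cannot cancel. The coefficient of degree 0 forces all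
constant terms to vanish, then that of degree 2 forces all linear terms to vanish, and after that
only the squares of the quadratic terms contribute in degree 4. -/
theorem sum_sq_coeff_two {ι : Type*} [Fintype ι] (P : ι → Polynomial ℝ) (a : ℝ)
    (h : ∑ i, P i ^ 2 = Polynomial.C a * Polynomial.X ^ 4) : ∑ i, (P i).coeff 2 ^ 2 = a := by
  have hc := fun n => congrArg (fun q : Polynomial ℝ => q.coeff n) h
  simp only [Polynomial.finsetSum_coeff, Polynomial.coeff_X_pow, pow_two,
    Polynomial.coeff_mul] at hc
  have h0 := hc 0
  have h2 := hc 2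
  have h4 := hc 4
  simp [Finset.Nat.antidiagonal_succ] at h0 h2 h4
  have z0 : ∀ i, (P i).coeff 0 = 0 := fun i => by
    have := (Finset.sum_eq_zero_iff_of_nonneg (fun i _ => mul_self_nonneg _)).mp h0 i
      (Finset.mem_univ i)
    simpa using this
  simp only [z0] at h2 h4
  have z1 : ∀ i, (P i).coeff 1 = 0 := fun i => by
    simp only [zero_mul, mul_zero, zero_add, add_zero] at h2
    have := (Finset.sum_eq_zero_iff_of_nonneg (fun i _ => mul_self_nonneg _)).mp h2 i
      (Finset.mem_univ i)
    simpa using this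
  simp only [z1] at h4
  simpa [pow_two] using h4

theorem aeval_scale_h (z : Var → ℝ) :
    aeval (fun j => Polynomial.C (z j) * Polynomial.X) h =
      Polynomial.C (aeval z h) * Polynomial.X ^ 4 := by
  simp only [h, f, g, q₁, q₂, q₃, q₄, r, x, y, map_add, map_sub, map_neg, map_mul, map_pow,
    map_ofNat, aeval_X]
  ring

/-- Along each line through the origin `h` restricts to a multiple of the fourth power of the
parameter, so `sum_sq_coeff_two` discards everything but the quadratic parts. The coefficients stay
rational while the points `z` are real, so real zeros of `f` may be inserted later. -/
theorem exists_quadratic_of_isSosOver (hh : IsSosOver ℚ h) :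
    ∃ (n : ℕ) (m : Fin n → Var → Var → ℚ), ∀ z : Var → ℝ,
      ∑ i, (∑ j, ∑ k, m i j k * z j * z k) ^ 2 = aeval z h := by
  rw [IsSosOver, Algebra.algebraMap_self, map_id] at hh
  obtain ⟨n, p, hp⟩ := exists_sum_sq_of_isSumSq hh
  choose c l m hm using fun i => exists_coeff_aeval_eq (p i)
  refine ⟨n, m, fun z => ?_⟩
  simp only [← (hm _ z).2.2]
  refine sum_sq_coeff_two _ _ ?_
  rw [← aeval_scale_h, hp]
  simp

/-! ### Irrationality of the cube root of two -/

theorem rat_cube_ne_two (q : ℚ) : q ^ 3 ≠ 2 := by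
  intro hq
  refine irrational_nrt_of_notint_nrt (x := (q : ℝ)) 3 2 (by exact_mod_cast hq) ?_ (by norm_num)
    ⟨q, rfl⟩
  rintro ⟨k, hk⟩
  have hk' : q = k := by exact_mod_cast hk
  have h3 : k ^ 3 = 2 := by
    rw [hk'] at hq
    exact_mod_cast hq
  rcases le_or_gt k 1 with h1 | h1
  · nlinarith [sq_nonneg k, sq_nonneg (k + 1)]
  · nlinarith [sq_nonneg k, sq_nonneg (k - 2)]

/-- Multiplying the relation by `s α - q` and using `α³ = 2` removes `α²` and leaves `(2s² - pq) +
(ps - q²) α = 0`. As `α` is irrational, `2s² = pq` and `ps = q²`. For `s ≠ 0` these would give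
`(q/s)³ = 2`. -/
theorem linearIndependent_cbrt_two {α : ℝ} (hα : α ^ 3 = 2) {p q s : ℚ}
    (h : (p : ℝ) + q * α + s * α ^ 2 = 0) : p = 0 ∧ q = 0 ∧ s = 0 := by
  have hirr : ∀ u : ℚ, α ≠ u := fun u hu => rat_cube_ne_two u (by
    rw [hu] at hα
    exact_mod_cast hα)
  have hlin : ∀ u v : ℚ, (u : ℝ) + v * α = 0 → u = 0 ∧ v = 0 := fun u v huv => by
    have hv : v = 0 := by
      by_contra hv
      have hv' : (v : ℝ) ≠ 0 := by exact_mod_cast hv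
      refine hirr (-u / v) ?_
      push_cast
      field_simp
      linarith
    subst hv
    simpa using huv
  obtain ⟨h1, h2⟩ := hlin (2 * s ^ 2 - p * q) (p * s - q ^ 2) (by
    push_cast
    linear_combination (s * α - q) * h - s ^ 2 * hα)
  have hs : s = 0 := by
    by_contra hs
    refine rat_cube_ne_two (q / s) ?_
    field_simp
    linear_combination -q * h2 - s * h1
  subst hs
  obtain ⟨h3, h4⟩ := hlin p q (by simpa using h)
  exact ⟨h3, h4, rfl⟩

/-! ### Cauchy–Schwarz at the sign vectors -/

/-- Equality case of the Cauchy–Schwarz inequality for a family of vectors of length `7`. -/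
theorem eq_of_sum_sq_eq {ι : Type*} [Fintype ι] {w : ι → Fin 7 → ℝ}
    (h₁ : ∀ j, ∑ i, w i j ^ 2 = 1) (h₂ : ∑ i, (∑ j, w i j) ^ 2 = 49) (i : ι) (j k : Fin 7) :
    w i j = w i k := by
  -- For each `i` the inner double sum is `14 ∑ⱼ wᵢⱼ² - 2 (∑ⱼ wᵢⱼ)²`. Summed over `i` this is `14 ·
  -- 7 - 2 · 49 = 0`.
  have key : ∑ i, ∑ j, ∑ k, (w i j - w i k) ^ 2 = 0 := by
    have hi : ∀ i, ∑ j, ∑ k, (w i j - w i k) ^ 2 = 14 * ∑ j, w i j ^ 2 - 2 * (∑ j, w i j) ^ 2 :=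
      fun i => by simp only [Fin.sum_univ_seven]; ring
    simp only [hi, Finset.sum_sub_distrib, ← Finset.mul_sum, h₂]
    rw [Finset.sum_comm]
    simp only [h₁]
    norm_num
  have h1 := (Finset.sum_eq_zero_iff_of_nonneg fun i _ => Finset.sum_nonneg fun j _ =>
    Finset.sum_nonneg fun k _ => sq_nonneg _).mp key i (Finset.mem_univ i)
  have h2 := (Finset.sum_eq_zero_iff_of_nonneg fun j _ =>
    Finset.sum_nonneg fun k _ => sq_nonneg _).mp h1 j (Finset.mem_univ j)
  have h3 := (Finset.sum_eq_zero_iff_of_nonneg fun k _ => sq_nonneg _).mp h2 k (Finset.mem_univ k)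
  exact sub_eq_zero.mp (pow_eq_zero_iff two_ne_zero |>.mp h3)

/-- The sign vectors `(±1, ±1, 1, ±1)` other than `(1, 1, 1, -1)`. -/
def signs : Fin 7 → Fin 4 → ℝ :=
  ![![-1, 1, 1, -1], ![1, -1, 1, -1], ![1, 1, 1, 1], ![-1, -1, 1, 1],
    ![-1, -1, 1, -1], ![-1, 1, 1, 1], ![1, -1, 1, 1]]

/-- The values of `-q₄` at the sign vectors. -/
def signWeight : Fin 7 → ℝ := ![1, 1, 1, 1, -1, -1, -1]

/-- The form `f` as a function on `ℝ⁴`. -/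
def fVal (u : Fin 4 → ℝ) : ℝ :=
  40 * u 0 ^ 4 + 8 * u 0 ^ 2 * u 1 ^ 2 + 32 * u 0 ^ 2 * u 1 * u 2 + 64 * u 0 ^ 2 * u 1 * u 3
    + 16 * u 0 ^ 2 * u 2 ^ 2 + 16 * u 0 ^ 2 * u 2 * u 3 + 32 * u 0 ^ 2 * u 3 ^ 2
    + 2 * u 1 ^ 4 + 8 * u 1 ^ 2 * u 2 ^ 2 + 8 * u 1 ^ 2 * u 2 * u 3 + 16 * u 1 * u 2 * u 3 ^ 2
    + 8 * u 2 ^ 2 * u 3 ^ 2 + 8 * u 3 ^ 4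

/-- The form `g` as a function on `ℝ⁴`. -/
def gVal (v : Fin 4 → ℝ) : ℝ :=
  (v 0 ^ 2 - v 3 ^ 2) ^ 2 + (v 1 ^ 2 - v 3 ^ 2) ^ 2 + (v 2 ^ 2 - v 3 ^ 2) ^ 2
    + (-v 0 ^ 2 - v 0 * v 1 - v 0 * v 2 + v 0 * v 3 - v 1 * v 2 + v 1 * v 3 + v 2 * v 3) ^ 2

theorem aeval_h (u v : Fin 4 → ℝ) :
    aeval (Sum.elim u v) h = fVal u + gVal v + (u 2 ^ 2 - v 2 ^ 2) ^ 2 := by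
  simp [h, f, g, q₁, q₂, q₃, q₄, r, x, y, fVal, gVal]

/-- The quadratic form with coefficients `c`. -/
def quad {k : Type*} [CommRing k] (c : Fin 4 → Fin 4 → k) (u : Fin 4 → k) : k :=
  ∑ j, ∑ k, c j k * u j * u k

/-- For a polynomial of degree at most 2, the value at `(1, 1, 1, -1)` is the sum of the values at
the seven vectors `signs j` with weights `signWeight j`. This is the Cayley–Bacharach relation for
the eight intersection points of three quadrics. The weighted values have square sum 1 for each `j`,
while their totals have square sum `gVal ![1, 1, 1, -1] = 49`, so equality holds in Cauchy–Schwarz.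
-/
theorem weighted_signs_eq {ι : Type*} [Fintype ι] {a : ι → ℝ} {b : ι → Fin 4 → ℝ}
    {c : ι → Fin 4 → Fin 4 → ℝ}
    (h : ∀ v : Fin 4 → ℝ, v 2 = 1 → ∑ i, (a i + ∑ k, b i k * v k + quad (c i) v) ^ 2 = gVal v)
    (i : ι) (j k : Fin 7) :
    signWeight j * (a i + ∑ k, b i k * signs j k + quad (c i) (signs j)) =
      signWeight k * (a i + ∑ l, b i l * signs k l + quad (c i) (signs k)) := by
  refine eq_of_sum_sq_eq
    (w := fun i j => signWeight j * (a i + ∑ k, b i k * signs j k + quad (c i) (signs j)))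
    (fun j => ?_) ?_ i j k
  · have hj := h (signs j) (by fin_cases j <;> simp [signs])
    have hw : signWeight j ^ 2 = 1 := by fin_cases j <;> simp [signWeight]
    simp only [mul_pow, hw, one_mul, hj]
    fin_cases j <;> simp [signs, gVal]
  · have h0 := h ![1, 1, 1, -1] rfl
    have hg : gVal ![1, 1, 1, -1] = 49 := by simp [gVal]; norm_num
    rw [← hg, ← h0]
    refine Finset.sum_congr rfl fun i _ => ?_
    congr 1
    -- Verification of the Cayley–Bacharach relation, coefficient by coefficient.
    simp only [Fin.sum_univ_seven, Fin.sum_univ_four, quad, signs, signWeight]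
    simp
    ring

theorem quad_sumElim {k : Type*} [CommRing k] (m : Var → Var → k) (u v : Fin 4 → k) :
    ∑ i, ∑ j, m i j * Sum.elim u v i * Sum.elim u v j =
      quad (fun i j => m (.inl i) (.inl j)) u
        + ∑ j, (∑ i, (m (.inl i) (.inr j) + m (.inr j) (.inl i)) * u i) * v j
        + quad (fun i j => m (.inr i) (.inr j)) v := by
  simp only [Fintype.sum_sum_type, Fin.sum_univ_four, Sum.elim_inl, Sum.elim_inr, quad]
  ring

/-- The constraints imposed on a representation of `h` as a sum of squares by a real zero `u` of `f`
with `u 2 = 1`. -/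
theorem weighted_signs_eq_of_fVal_eq_zero {ι : Type*} [Fintype ι] {m : ι → Var → Var → ℝ}
    (hm : ∀ z : Var → ℝ, ∑ i, (∑ j, ∑ k, m i j k * z j * z k) ^ 2 = aeval z h)
    {u : Fin 4 → ℝ} (hu : fVal u = 0) (hu₂ : u 2 = 1) (i : ι) (j k : Fin 7) :
    signWeight j * (quad (fun a b => m i (.inl a) (.inl b)) u
        + quad (fun a b => m i (.inr a) (.inr b)) (signs j)) =
      signWeight k * (quad (fun a b => m i (.inl a) (.inl b)) u
        + quad (fun a b => m i (.inr a) (.inr b)) (signs k)) := by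
  -- At `(s u, v)` with `s = ±1` and `u 2 = v 2 = 1`, both `f` and `r` vanish and `h` reduces to
  -- `g(v)`. The sign `s` affects only the mixed terms.
  have key : ∀ s : ℝ, s ^ 2 = 1 → ∀ v : Fin 4 → ℝ, v 2 = 1 →
      ∑ i, (quad (fun a b => m i (.inl a) (.inl b)) u
        + ∑ k, (s * ∑ l, (m i (.inl l) (.inr k) + m i (.inr k) (.inl l)) * u l) * v k
        + quad (fun a b => m i (.inr a) (.inr b)) v) ^ 2 = gVal v := by
    intro s hs v hv
    have h1 := hm (Sum.elim (fun l => s * u l) v)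
    simp only [quad_sumElim] at h1
    rw [aeval_h] at h1
    have h2 : fVal (fun l => s * u l) = 0 := by
      have : fVal (fun l => s * u l) = s ^ 4 * fVal u := by simp only [fVal]; ring
      rw [this, hu, mul_zero]
    have h3 : (s * u 2) ^ 2 - v 2 ^ 2 = 0 := by rw [mul_pow, hs, hu₂, hv]; norm_num
    rw [h2, h3] at h1
    rw [zero_add, zero_pow two_ne_zero, add_zero] at h1
    rw [← h1]
    refine Finset.sum_congr rfl fun i _ => ?_
    have hq : quad (fun a b => m i (.inl a) (.inl b)) (fun l => s * u l) =
        s ^ 2 * quad (fun a b => m i (.inl a) (.inl b)) u := by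
      simp only [quad, Fin.sum_univ_four]; ring
    rw [hq, hs, one_mul]
    simp only [Finset.mul_sum, mul_left_comm s]
  have h1 := weighted_signs_eq (key 1 (by norm_num)) i j k
  have h2 := weighted_signs_eq (key (-1) (by norm_num)) i j k
  simp only [Fin.sum_univ_four] at h1 h2
  -- Averaging over `s = ±1` removes the mixed terms, which are linear in `s`.
  linear_combination (h1 + h2) / 2

/-! ### No sum of squares over the rationals -/

theorem sum_quadratic_coeff {ι : Type*} [Fintype ι] {p q s : ι → ℝ} {c₄ c₂ c₀ : ℝ}
    (h : ∀ τ : ℝ, ∑ i, (p i * τ ^ 2 + q i * τ + s i) ^ 2 = c₄ * τ ^ 4 + c₂ * τ ^ 2 + c₀) :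
    ∑ i, (2 * p i * s i + q i ^ 2) = c₂ := by
  -- The coefficient of `τ²` of a quartic is recovered from its values at `0, ±1, ±2`. The weights
  -- 16, -1 and -30, over 24, annihilate the terms of degree 0 and 4, and the symmetric nodes
  -- annihilate the odd ones.
  have key : ∑ i, (2 * p i * s i + q i ^ 2) =
      (16 * (∑ i, (p i * 1 ^ 2 + q i * 1 + s i) ^ 2 + ∑ i, (p i * (-1) ^ 2 + q i * (-1) + s i) ^ 2)
        - (∑ i, (p i * 2 ^ 2 + q i * 2 + s i) ^ 2 + ∑ i, (p i * (-2) ^ 2 + q i * (-2) + s i) ^ 2)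
        - 30 * ∑ i, (p i * 0 ^ 2 + q i * 0 + s i) ^ 2) / 24 := by
    simp only [← Finset.sum_add_distrib, Finset.mul_sum, ← Finset.sum_sub_distrib,
      Finset.sum_div]
    exact Finset.sum_congr rfl fun i _ => by ring
  rw [key]
  simp only [h]
  ring

/-- No member of this family of quadratic forms is positive semidefinite: the only real candidate
has `S ^ 3 = 2 ^ 13`. -/
theorem not_forall_nonneg (S T : ℚ) :
    ¬ ∀ b c d : ℚ, 0 ≤ T * b ^ 2 + 2 * S * b * c + 64 * b * d + 16 * c ^ 2 + 2 * T * c * d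
      + 2 * S * d ^ 2 := by
  intro h
  -- The test vectors express the nonnegativity of the principal `2 × 2` minors of the matrix with
  -- rows `(T, S, 32)`, `(S, 16, T)`, `(32, T, 2S)`: they give `S² ≤ 16T`, `T² ≤ 32S` and `ST ≥
  -- 512`.
  have h1 : S ^ 2 ≤ 16 * T := by linarith [h 16 (-S) 0]
  have h2 : T ^ 2 ≤ 32 * S := by linarith [h 0 (-T) 16]
  have hT : 0 ≤ T := by nlinarith [sq_nonneg S]
  have hS : 0 ≤ S := by nlinarith [sq_nonneg T]
  have h3 : 512 ≤ S * T := by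
    rcases hT.eq_or_lt with rfl | hT'
    · have : S = 0 := by nlinarith
      subst this
      linarith [h 1 0 (-1)]
    · have := h (-32) 0 T
      have h4 : 0 ≤ T * (S * T - 512) := by linarith
      linarith [nonneg_of_mul_nonneg_right h4 hT']
  -- The product of the first two minor inequalities is `(ST)² ≤ 512 ST`.
  have h5 : S * T ≤ 512 := by
    by_contra! hlt
    nlinarith [mul_le_mul h1 h2 (sq_nonneg T) (by positivity)]
  -- With `ST = 512` the minor inequalities give `S³ ≤ 2¹³` and `T³ ≤ 2¹⁴`. Since `S³T³ = 2²⁷`, both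
  -- are equalities, and `S / 16` would be a rational cube root of 2.
  have h6 : S * T = 512 := le_antisymm h5 h3
  have h7 : S ^ 3 ≤ 8192 := by nlinarith
  have h8 : T ^ 3 ≤ 16384 := by nlinarith
  have h9 : S ^ 3 * T ^ 3 = 512 ^ 3 := by rw [← mul_pow, h6]
  have h10 : S ^ 3 = 8192 := by nlinarith [pow_nonneg hS 3, pow_nonneg hT 3]
  exact rat_cube_ne_two (S / 16) (by rw [div_pow, h10]; norm_num)

/-- The first half restricts the `x`-parts of the quadratic forms by their values at two real zeros
of `f`. The second half compares coefficients of `x₀²` and produces a rational semidefinite form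
excluded by `not_forall_nonneg`. -/
theorem not_isSosOver_rat : ¬ IsSosOver ℚ h := by
  intro hh
  obtain ⟨n, m, hm⟩ := exists_quadratic_of_isSosOver hh
  obtain ⟨α, hα⟩ : ∃ α : ℝ, α ^ 3 = 2 := ⟨2 ^ (1 / 3 : ℝ), by
    rw [← Real.rpow_natCast, ← Real.rpow_mul (by norm_num)]; norm_num⟩
  let c : Fin n → Fin 4 → Fin 4 → ℚ := fun i a b => m i (.inl a) (.inl b)
  have hsplit : ∀ u v : Fin 4 → ℝ, ∑ i, (quad (fun a b => (c i a b : ℝ)) u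
      + ∑ j, (∑ l, ((m i (.inl l) (.inr j) : ℝ) + m i (.inr j) (.inl l)) * u l) * v j
      + quad (fun a b => (m i (.inr a) (.inr b) : ℝ)) v) ^ 2
        = fVal u + gVal v + (u 2 ^ 2 - v 2 ^ 2) ^ 2 := fun u v => by
    rw [← aeval_h, ← hm]
    refine Finset.sum_congr rfl fun i _ => ?_
    rw [quad_sumElim fun j k => (m i j k : ℝ)]
  have hsign := fun (u : Fin 4 → ℝ) (hu : fVal u = 0) (hu₂ : u 2 = 1) =>
    weighted_signs_eq_of_fVal_eq_zero (m := fun i j k => (m i j k : ℝ)) hm hu hu₂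
  -- On `x₀ = 0` the form `f` is `8 (x₁x₂ + x₃²)² + 2 (x₁² + 2x₂x₃)²`. Its real zeros with `x₂ = 1`
  -- are this point and `(0, -α², 1, -α)`.
  have he₂ := hsign ![0, 0, 1, 0] (by simp [fVal]) rfl
  have hα₂ := hsign ![0, -α ^ 2, 1, -α]
    (by simp [fVal]; linear_combination (2 * α ^ 5 - 4 * α ^ 2) * hα) rfl
  -- the part of the forms not involving `x₀`
  have hcoef : ∀ i, c i 1 3 + c i 3 1 = 0 ∧ 2 * c i 1 1 - (c i 2 3 + c i 3 2) = 0 ∧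
      c i 3 3 - (c i 1 2 + c i 2 1) = 0 := fun i => by
    -- The indices 0 and 4 have opposite weights, so the constraint determines the value of the
    -- `x`-part at the zero from the `y`-part alone. Hence the two zeros of `f` give the same value,
    -- and the difference is a rational relation between `1, α, α²`.
    have h1 := he₂ i 0 4
    have h2 := hα₂ i 0 4
    simp [quad, Fin.sum_univ_four, signs, signWeight] at h1 h2
    have := linearIndependent_cbrt_two hα (p := 2 * (c i 1 3 + c i 3 1))
      (q := 2 * c i 1 1 - (c i 2 3 + c i 3 2)) (s := c i 3 3 - (c i 1 2 + c i 2 1)) (by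
        push_cast
        simp only [c]
        linear_combination (h2 - h1) / 2
          - (m i (.inl 1) (.inl 1) * α + m i (.inl 1) (.inl 3) + m i (.inl 3) (.inl 1)) * hα)
    refine ⟨by linarith [this.1], this.2.1, this.2.2⟩
  -- comparison of the coefficients of `x₀²`
  have hx : ∀ b e d : ℝ, ∑ i, (2 * (c i 0 0 : ℝ) * quad (fun a b => (c i a b : ℝ)) ![0, b, e, d]
      + ((c i 0 1 + c i 1 0) * b + (c i 0 2 + c i 2 0) * e + (c i 0 3 + c i 3 0) * d) ^ 2)
        = 8 * b ^ 2 + 32 * b * e + 64 * b * d + 16 * e ^ 2 + 16 * e * d + 32 * d ^ 2 :=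
    fun b e d => by
      -- The point has `y = 0`, so `g` vanishes and `r²` contributes `e ^ 4`.
      refine sum_quadratic_coeff (c₄ := 40) (c₀ := fVal ![0, b, e, d] + e ^ 4) fun τ => ?_
      have h1 := hsplit ![τ, b, e, d] 0
      have h2 : fVal ![τ, b, e, d] + gVal 0 + ((![τ, b, e, d] : Fin 4 → ℝ) 2 ^ 2
          - (0 : Fin 4 → ℝ) 2 ^ 2) ^ 2 = 40 * τ ^ 4 + (8 * b ^ 2 + 32 * b * e + 64 * b * d
            + 16 * e ^ 2 + 16 * e * d + 32 * d ^ 2) * τ ^ 2 + (fVal ![0, b, e, d] + e ^ 4) := by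
        simp [fVal, gVal]; ring
      rw [← h2, ← h1]
      refine Finset.sum_congr rfl fun i _ => ?_
      simp [quad, Fin.sum_univ_four]
      ring
  have hy : ∀ j, ∑ i, (c i 0 0 : ℝ) * quad (fun a b => (m i (.inr a) (.inr b) : ℝ)) (signs j) ≤ 0 :=
    fun j => by
      have h1 : ∑ i, (2 * (c i 0 0 : ℝ) * quad (fun a b => (m i (.inr a) (.inr b) : ℝ)) (signs j)
          + (∑ k, ((m i (.inl 0) (.inr k) : ℝ) + m i (.inr k) (.inl 0)) * signs j k) ^ 2) = 0 := by
        -- At `x = (τ, 0, 0, 0)` the value of `h` has no term in `τ²`, so the cross terms with the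
        -- `y`-part must offset the squares of the mixed terms, which fixes their sign.
        refine sum_quadratic_coeff (c₄ := 40) (c₀ := gVal (signs j) + signs j 2 ^ 4) fun τ => ?_
        have h1 := hsplit ![τ, 0, 0, 0] (signs j)
        have h2 : fVal ![τ, 0, 0, 0] + gVal (signs j) + ((![τ, 0, 0, 0] : Fin 4 → ℝ) 2 ^ 2
            - signs j 2 ^ 2) ^ 2 = 40 * τ ^ 4 + 0 * τ ^ 2 + (gVal (signs j) + signs j 2 ^ 4) := by
          simp [fVal]; ring
        rw [← h2, ← h1]
        refine Finset.sum_congr rfl fun i _ => ?_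
        simp [quad, Fin.sum_univ_four]
        ring
      rw [Finset.sum_add_distrib] at h1
      have h2 : 0 ≤ ∑ i, (∑ k, ((m i (.inl 0) (.inr k) : ℝ) + m i (.inr k) (.inl 0))
        * signs j k) ^ 2 := Finset.sum_nonneg fun i _ => sq_nonneg _
      simp only [mul_assoc, ← Finset.mul_sum] at h1
      linarith
  have hw : 0 ≤ ∑ i, (c i 0 0 : ℝ) * c i 2 2 := by
    -- Since `c i 2 2` is the value of the `x`-part at `(0, 0, 1, 0)`, it is minus the mean of the
    -- values of the `y`-part at `signs 0` and `signs 4`. This is where the `y`-variables enter the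
    -- argument.
    have h1 : ∑ i, (c i 0 0 : ℝ) * c i 2 2 =
        -(∑ i, (c i 0 0 : ℝ) * quad (fun a b => (m i (.inr a) (.inr b) : ℝ)) (signs 0)
        + ∑ i, (c i 0 0 : ℝ) * quad (fun a b => (m i (.inr a) (.inr b) : ℝ)) (signs 4)) / 2 := by
      rw [← Finset.sum_add_distrib, ← Finset.sum_neg_distrib, Finset.sum_div]
      refine Finset.sum_congr rfl fun i _ => ?_
      have h1 := he₂ i 0 4
      have h2 : quad (fun a b => (m i (.inl a) (.inl b) : ℝ)) ![0, 0, 1, 0] = c i 2 2 := by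
        simp [quad, Fin.sum_univ_four, c]
      rw [h2] at h1
      simp only [signWeight, Matrix.cons_val] at h1
      linear_combination (c i 0 0 : ℝ) / 2 * h1
    rw [h1]
    linarith [hy 0, hy 4]
  -- `S` and `T` are read off from the coefficient of `x₀²` after moving the multiples of `be + d²`
  -- and `b² + 2ed` to one side. The remaining multiple of `e²` is nonnegative by `hw`, so adding it
  -- back preserves nonnegativity and leaves the coefficient 16 unchanged.
  refine not_forall_nonneg (16 - ∑ i, c i 0 0 * c i 3 3) (8 - 2 * ∑ i, c i 0 0 * c i 1 1)
    fun b e d => ?_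
  have h1 := hx b e d
  have h2 : ∀ i, quad (fun a b => (c i a b : ℝ)) ![0, (b : ℝ), e, d] =
      c i 2 2 * e ^ 2 + c i 3 3 * (b * e + d ^ 2) + c i 1 1 * (b ^ 2 + 2 * e * d) := fun i => by
    obtain ⟨e1, e2, e3⟩ := hcoef i
    have e1' : (c i 1 3 : ℝ) + c i 3 1 = 0 := by exact_mod_cast e1
    have e2' : 2 * (c i 1 1 : ℝ) - (c i 2 3 + c i 3 2) = 0 := by exact_mod_cast e2
    have e3' : (c i 3 3 : ℝ) - (c i 1 2 + c i 2 1) = 0 := by exact_mod_cast e3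
    simp [quad, Fin.sum_univ_four]
    linear_combination (b * d : ℝ) * e1' - (e * d : ℝ) * e2' - (b * e : ℝ) * e3'
  have h3 : ∑ i, 2 * (c i 0 0 : ℝ) * quad (fun a b => (c i a b : ℝ)) ![0, (b : ℝ), e, d] =
      2 * (∑ i, (c i 0 0 : ℝ) * c i 2 2) * e ^ 2
        + 2 * (∑ i, (c i 0 0 : ℝ) * c i 3 3) * (b * e + d ^ 2)
        + 2 * (∑ i, (c i 0 0 : ℝ) * c i 1 1) * (b ^ 2 + 2 * e * d) := by
    simp only [h2, Finset.mul_sum, Finset.sum_mul, ← Finset.sum_add_distrib]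
    exact Finset.sum_congr rfl fun i _ => by ring
  rw [Finset.sum_add_distrib, h3] at h1
  have h4 : 0 ≤ ∑ i, (((c i 0 1 : ℝ) + c i 1 0) * b + (c i 0 2 + c i 2 0) * e
    + (c i 0 3 + c i 3 0) * d) ^ 2 := Finset.sum_nonneg fun i _ => sq_nonneg _
  have h5 : 0 ≤ 2 * (∑ i, (c i 0 0 : ℝ) * c i 2 2) * (e : ℝ) ^ 2 := by positivity
  have h6 : (0 : ℝ) ≤ (8 - 2 * ∑ i, (c i 0 0 : ℝ) * c i 1 1) * b ^ 2
      + 2 * (16 - ∑ i, (c i 0 0 : ℝ) * c i 3 3) * b * e + 64 * b * d + 16 * e ^ 2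
      + 2 * (8 - 2 * ∑ i, (c i 0 0 : ℝ) * c i 1 1) * e * d
      + 2 * (16 - ∑ i, (c i 0 0 : ℝ) * c i 3 3) * d ^ 2 := by
    linarith
  exact_mod_cast h6

end NonsingularSos

theorem mainTheorem3 :
    (NonsingularSos.singularIdeal NonsingularSos.h).radical =
      NonsingularSos.irrelevantIdeal ℚ NonsingularSos.Var ∧
    (∀ (K : Type*) [Field K] [Algebra ℚ K] (P : ℙ K (NonsingularSos.Var → K)),
      ¬ NonsingularSos.IsSingularPoint NonsingularSos.h P) ∧
    NonsingularSos.h.IsHomogeneous 4 ∧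
    NonsingularSos.IsSosOver ℝ NonsingularSos.h ∧
    ¬ NonsingularSos.IsSosOver ℚ NonsingularSos.h := by
  exact ⟨NonsingularSos.radical_singularIdeal,
    fun _ _ _ P => NonsingularSos.not_isSingularPoint P, NonsingularSos.isHomogeneous_h,
    NonsingularSos.isSosOver_real, NonsingularSos.not_isSosOver_rat⟩
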